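/- **Simplicial complexes and isometries.** For a connected simplicial complex $Y$ let $Y^0$ be its set of vertices, with the combinatorial (path) metric of the $1$-skeleton. An *isometry* $f:Y'\to Y$ of connected simplicial complexes is a simplicial map that (i) preserves the combinatorial distance between vertices, (ii) is such that every simplex of $Y$ of positive dimension whose boundary lies in the image of $f$ is itself in the image of $f$, and (iii) has convex image, i.e. every vertex lying on a geodesic of the $1$-skeleton of $Y$ between two vertices of $f(Y'^0)$ belongs to $f(Y'^0)$. If $P$ is a property of finite connected simplicial complexes, a simplicial complex $X$ is called *$P$-symmetric* if for all nonempty finite connected simplicial complexes $Y',Y$ with property $P$ and every isometry $i:Y'\to Y$, the number of isometries $\beta:Y\to X$ with $\beta\circ i=\alpha$ is finite, positive and the same for all isometries $\alpha:Y'\to X$. **Buildings.** Let $\Sigma$ be the tessellation of the Euclidean plane by equilateral triangles. A *building of type $\tilde A_2$* is a $2$-dimensional simplicial complex $X$ with a family of subcomplexes isomorphic to $\Sigma$ (apartments) such that any two simplices of $X$ lie in a common apartment, for any two apartments $A,A'$ there is an isomorphism $A\to A'$ fixing $A\cap A'$ pointwise, and every edge lies in at least $3$ triangles. The number of triangles containing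 an edge does not depend on the edge; assume that it is finite, equal to $q+1$. **The model wall-tree.** Let $T$ be the $(q+1)$-regular tree, with a base vertex $o$. The model wall-tree $\Upsilon$ is the flag complex with vertices the pairs $(z,n)$, $z$ a vertex of $T$ and $n\in\mathbb Z$ with $n\equiv d(o,z) \pmod 2$, in which $(z,n)$ is adjacent to $(z,n\pm 2)$ and to $(z',n\pm1)$ for $z'$ adjacent to $z$ in $T$. (Geometrically $\Upsilon$ is $T\times\mathbb R$ with tree edges of length $\sqrt3/2$ and $(z,n)$ at height $n/2$; over a bi-infinite geodesic of $T$ it is $\Sigma$.) A finite simplicial complex has property $P_\Upsilon$ if it admits an isometry into $\Upsilon$, i.e. if it is isomorphic to a finite convex subcomplex of $\Upsilon$. **Theorem.** Let $X$ be a building of type $\tilde A_2$ in which the (finite) number of triangles containing an edge is $q+1$. Then $X$ is $P_\Upsilon$-symmetric: for every isometry $i:Y'\to Y$ of nonempty finite connected complexes with property $P_\Upsilon$ there is an integer $[Y:Y']_i\ge 1$ such that every isometry $\alpha:Y'\to X$ has exactly $[Y:Y']_i$ extensions to an isometry $\beta:Y\to X$ with $\beta\circ i=\alpha$. -/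

import Mathlib

universe u v w

/-! Abstract simplicial complexes are Mathlib's `AbstractSimplicialComplex V`: families of nonempty
finite subsets of `V`, closed under nonempty subsets and containing all singletons, so that `V` is
exactly the set of vertices. -/

namespace BuildingSymmetry

/-- The `1`-skeleton of a simplicial complex, as a graph. It carries the combinatorial metric. -/
def skeleton {V : Type u} (K : AbstractSimplicialComplex V) : SimpleGraph V :=
  SimpleGraph.fromRel fun a b => ∃ s ∈ K.faces, a ∈ s ∧ b ∈ s

/-- The flag complex of a graph: its simplices are the nonempty finite cliques. -/
def flagComplex {V : Type u} (G : SimpleGraph V) : AbstractSimplicialComplex V where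
  faces := {s | s.Nonempty ∧ G.IsClique (s : Set V)}
  isRelLowerSet_faces := fun {_} hs =>
    ⟨hs.1, fun _ hts ht => ⟨ht, hs.2.subset (Finset.coe_subset.mpr hts)⟩⟩
  singleton_mem := fun x => ⟨Finset.singleton_nonempty x, by simp⟩

/-- A set of vertices of a graph is convex if it contains every vertex of every geodesic of the
graph that joins two of its members. -/
def GeodesicallyConvex {V : Type u} (G : SimpleGraph V) (S : Set V) : Prop :=
  ∀ a ∈ S, ∀ b ∈ S, ∀ p : G.Walk a b, p.length = G.dist a b → ∀ c ∈ p.support, c ∈ S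

open Classical in
/-- The image of a finite set of vertices under a map. -/
noncomputable def faceImage {V : Type u} {W : Type v} (f : V → W) (s : Finset V) : Finset W :=
  s.image f

theorem mem_faceImage {V : Type u} {W : Type v} {f : V → W} {s : Finset V} {y : W} :
    y ∈ faceImage f s ↔ ∃ x ∈ s, f x = y := by
  simp [faceImage]

/-- Isometries (isometric embeddings) of simplicial complexes, given by their action on vertices. -/
structure IsIsometry {V : Type u} {W : Type v} (K : AbstractSimplicialComplex V)
    (L : AbstractSimplicialComplex W) (f : V → W) : Prop where
  /-- the map is simplicial -/
  simplicial : ∀ s ∈ K.faces, faceImage f s ∈ L.faces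
  /-- it preserves the combinatorial distance between vertices -/
  edist_eq : ∀ a b, (skeleton L).edist (f a) (f b) = (skeleton K).edist a b
  /-- a simplex (of positive dimension) of the target whose boundary lies in the image
  is itself in the image -/
  full : ∀ t ∈ L.faces, 2 ≤ t.card →
    (∀ r, r.Nonempty → r ⊂ t → ∃ s ∈ K.faces, faceImage f s = r) → ∃ s ∈ K.faces, faceImage f s = t
  /-- the image is convex in the `1`-skeleton of the target -/
  convex : GeodesicallyConvex (skeleton L) (Set.range f)

/-- `X` is `P`-symmetric: for all nonempty finite connected complexes `Y'`, `Y` with the property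
`P` and every isometry `i : Y' → Y`, the number of isometries `β : Y → X` with `β ∘ i = α` is finite,
positive and the same for all isometries `α : Y' → X`. -/
def IsSymmetricFor {V : Type v} (X : AbstractSimplicialComplex V)
    (P : ∀ {Z : Type u}, AbstractSimplicialComplex Z → Prop) : Prop :=
  ∀ (Z' Z : Type u) [Finite Z'] [Finite Z]
    (Y' : AbstractSimplicialComplex Z') (Y : AbstractSimplicialComplex Z),
    (skeleton Y').Connected → (skeleton Y).Connected → P Y' → P Y →
    ∀ i : Z' → Z, IsIsometry Y' Y i →
      ∃ N : ℕ, 0 < N ∧ ∀ α : Z' → V, IsIsometry Y' X α →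
        {β : Z → V | IsIsometry Y X β ∧ β ∘ i = α}.encard = N

/-- The model apartment: the tessellation of the plane by equilateral triangles. The vertex `(a, b)`
is the point `a e₁ + b e₂` of the lattice spanned by unit vectors at angle `π / 3`, whose shortest
nonzero vectors are `± e₁`, `± e₂` and `± (e₁ - e₂)`. -/
def modelApartment : AbstractSimplicialComplex (ℤ × ℤ) :=
  flagComplex (SimpleGraph.fromRel fun p r => r - p = (1, 0) ∨ r - p = (0, 1) ∨ r - p = (1, -1))

/-- `A` is a subcomplex of `X` that is a copy of the model apartment. -/
def IsApartmentIn {V : Type u} (X : AbstractSimplicialComplex V)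
    (A : PreAbstractSimplicialComplex V) : Prop :=
  A.faces ⊆ X.faces ∧
    ∃ f : ℤ × ℤ ↪ V, A.faces = (fun s => s.map f) '' modelApartment.faces

/-- The set of triangles of `X` that contain the simplex `e`. -/
def trianglesOver {V : Type u} (X : AbstractSimplicialComplex V) (e : Finset V) :
    Set (Finset V) :=
  {t | t ∈ X.faces ∧ t.card = 3 ∧ e ⊆ t}

/-- `φ` restricts to an isomorphism of the subcomplex `A` onto the subcomplex `B`. -/
def IsSubcomplexIso {V : Type u} (A B : PreAbstractSimplicialComplex V) (φ : V → V) : Prop :=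
  Set.InjOn φ {x | {x} ∈ A.faces} ∧ faceImage φ '' A.faces = B.faces

/-- Buildings of type `Ã₂`. -/
structure IsA2TildeBuilding {V : Type u} (X : AbstractSimplicialComplex V) : Prop where
  /-- `X` has dimension two -/
  card_le_three : ∀ s ∈ X.faces, s.card ≤ 3
  exists_triangle : ∃ s ∈ X.faces, s.card = 3
  /-- there is a system of apartments such that any two simplices lie in a common apartment, and
  any two apartments are isomorphic by an isomorphism that fixes their intersection pointwise -/
  exists_apartments : ∃ 𝒜 : Set (PreAbstractSimplicialComplex V),
    (∀ A ∈ 𝒜, IsApartmentIn X A) ∧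
    (∀ s ∈ X.faces, ∀ t ∈ X.faces, ∃ A ∈ 𝒜, s ∈ A.faces ∧ t ∈ A.faces) ∧
    (∀ A ∈ 𝒜, ∀ B ∈ 𝒜, ∃ φ : V → V, IsSubcomplexIso A B φ ∧
      ∀ x, {x} ∈ A.faces → {x} ∈ B.faces → φ x = x)
  /-- every edge lies in at least three triangles -/
  thick : ∀ e ∈ X.faces, e.card = 2 → 3 ≤ (trianglesOver X e).encard

/-- Vertices of the model wall-tree over the tree `T` (with base point `o`): the pair `(z, n)` stands
for the point of `T × ℝ` over the vertex `z` at height `n / 2`; the vertices are those for which `n`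
has the parity of `d(o, z)`. -/
abbrev WallTreeVertex {W : Type w} (T : SimpleGraph W) (o : W) : Type w :=
  {p : W × ℤ // Even (p.2 - (T.dist o p.1 : ℤ))}

/-- The model wall-tree over the tree `T`. With tree edges of length `√3 / 2`, adjacent vertices are
those at distance `1` in `T × ℝ`: consecutive vertices of one fibre, and vertices over
adjacent vertices of `T` whose heights differ by `1 / 2`. The part over a bi-infinite geodesic of `T`
is a model apartment. -/
def modelWallTree {W : Type w} (T : SimpleGraph W) (o : W) :
    AbstractSimplicialComplex (WallTreeVertex T o) :=
  flagComplex (SimpleGraph.fromRel fun p r =>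
    (r.1.1 = p.1.1 ∧ r.1.2 = p.1.2 + 2) ∨ (T.Adj p.1.1 r.1.1 ∧ r.1.2 = p.1.2 + 1))

/-- The property of being a finite complex isometric to a convex subcomplex of the model wall-tree
over `T`. -/
def IsConvexInWallTree {W : Type w} (T : SimpleGraph W) (o : W) {Z : Type u}
    (Y : AbstractSimplicialComplex Z) : Prop :=
  Finite Z ∧ ∃ f : Z → WallTreeVertex T o, IsIsometry Y (modelWallTree T o) f

end BuildingSymmetry

/-!
The `1`-skeleton of the building determines it, since the building is a flag complex, and it has the
following local-to-global property: a map from a connected graph that is injective, induced and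
convex on the link of each vertex is isometric with convex image. Isometries of a finite convex
subcomplex of the wall-tree into `X` are therefore determined by a condition on the links of single
vertices, and extensions can be counted one vertex at a time. When a vertex `v` is added to a convex
set `M` in which its neighbours form a path of the link of `v`, the number of admissible values at
`v` depends only on the shape of `M` near `v`: the links of the vertices of the building are
generalized triangles (incidence graphs of projective planes) of order `q`, in which the number of
points on a line, and of lines through a point, is `q + 1`.

A finite convex set of vertices of the wall-tree is the part of a double cone
`p.2 + d(p.1, z) ≤ n ≤ t.2 - d(t.1, z)` that lies over a finite subtree. Between two nested sets of
this form one passes by adding vertices one at a time, enlarging the subtree by leaves and moving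
the lower and upper vertices `p` and `t` away from each other, so the total number of extensions is
a product of numbers that do not depend on the isometry being extended.
-/

namespace BuildingSymmetry

section GraphDistance

variable {V : Type u} {V' : Type v} {G : SimpleGraph V} {G' : SimpleGraph V'}

theorem dist_map_le (f : G →g G') {a b : V} (h : G.Reachable a b) :
    G'.dist (f a) (f b) ≤ G.dist a b := by
  obtain ⟨p, hp⟩ := h.exists_walk_length_eq_dist
  simpa only [SimpleGraph.Walk.length_map, hp] using SimpleGraph.dist_le (p.map f)

theorem dist_le_dist_add_one (hG : G.Connected) {b c : V} (h : G.Adj b c) (a : V) :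
    G.dist a c ≤ G.dist a b + 1 := by
  simpa only [SimpleGraph.dist_eq_one_iff_adj.2 h] using
    hG.dist_triangle (u := a) (v := b) (w := c)

theorem exists_adj_dist_eq (hG : G.Connected) {a b : V} {k : ℕ} (h : G.dist a b = k + 1) :
    ∃ c, G.Adj c b ∧ G.dist a c = k := by
  obtain ⟨p, hp⟩ := hG.exists_walk_length_eq_dist b a
  rw [SimpleGraph.dist_comm, h] at hp
  cases p with
  | nil => simp at hp
  | @cons _ c _ hbc p =>
    refine ⟨c, hbc.symm, ?_⟩
    have h1 := dist_le_dist_add_one hG hbc.symm a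
    have h2 := SimpleGraph.dist_le p
    rw [SimpleGraph.dist_comm] at h2
    rw [SimpleGraph.Walk.length_cons] at hp
    omega

theorem ne_and_not_adj_of_dist_add_two_le (hG : G.Connected) {a b c : V}
    (h : G.dist a c + 2 ≤ G.dist a b) : c ≠ b ∧ ¬ G.Adj c b := by
  refine ⟨?_, fun hcb => ?_⟩
  · rintro rfl
    omega
  · have := dist_le_dist_add_one hG hcb a
    omega

theorem dist_eq_two_of_adj_of_adj {b c y : V} (hb : G.Adj y b) (hc : G.Adj y c) (hne : b ≠ c)
    (hn : ¬ G.Adj b c) : G.dist b c = 2 := by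
  rw [SimpleGraph.dist, SimpleGraph.edist_eq_two_iff.2 ⟨hne, hn, y, hb.symm, hc.symm⟩]
  rfl

end GraphDistance

section TriangularLattice

/-- The triangular lattice, in the coordinates of `modelApartment`. -/
def triangularLattice : SimpleGraph (ℤ × ℤ) :=
  SimpleGraph.fromRel fun p r => r - p = (1, 0) ∨ r - p = (0, 1) ∨ r - p = (1, -1)

theorem triangularLattice_adj {a b : ℤ × ℤ} : triangularLattice.Adj a b ↔
    (b.1 = a.1 + 1 ∧ b.2 = a.2) ∨ (b.1 = a.1 ∧ b.2 = a.2 + 1) ∨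
    (b.1 = a.1 + 1 ∧ b.2 = a.2 - 1) ∨ (b.1 = a.1 - 1 ∧ b.2 = a.2) ∨
    (b.1 = a.1 ∧ b.2 = a.2 - 1) ∨ (b.1 = a.1 - 1 ∧ b.2 = a.2 + 1) := by
  simp only [triangularLattice, SimpleGraph.fromRel_adj, Prod.ext_iff, Prod.fst_sub, Prod.snd_sub,
    ne_eq]
  omega

/-- The norm whose unit ball is the hexagon spanned by the six shortest vectors of the triangular
lattice. -/
def hexNorm (x : ℤ × ℤ) : ℕ :=
  max (max x.1.natAbs x.2.natAbs) (x.1 + x.2).natAbs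

theorem hexNorm_le_iff {x : ℤ × ℤ} {k : ℕ} : hexNorm x ≤ k ↔
    (-k ≤ x.1 ∧ x.1 ≤ k) ∧ (-k ≤ x.2 ∧ x.2 ≤ k) ∧ -k ≤ x.1 + x.2 ∧ x.1 + x.2 ≤ k := by
  simp only [hexNorm, max_le_iff]
  omega

theorem hexNorm_sub_le_of_adj {a b c : ℤ × ℤ} (h : triangularLattice.Adj b c) :
    hexNorm (b - a) ≤ hexNorm (c - a) + 1 := by
  have hc := hexNorm_le_iff.1 (le_refl (hexNorm (c - a)))
  rw [triangularLattice_adj] at h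
  simp only [hexNorm_le_iff, Prod.fst_sub, Prod.snd_sub, Nat.cast_add, Nat.cast_one] at hc ⊢
  omega

theorem exists_adj_hexNorm_sub {a b : ℤ × ℤ} {k : ℕ} (h : hexNorm (b - a) = k + 1) :
    ∃ c, triangularLattice.Adj b c ∧ hexNorm (c - a) = k := by
  obtain ⟨a₁, a₂⟩ := a
  obtain ⟨b₁, b₂⟩ := b
  simp only [hexNorm, Prod.mk_sub_mk] at h
  suffices ∃ c₁ c₂, triangularLattice.Adj (b₁, b₂) (c₁, c₂) ∧ hexNorm (c₁ - a₁, c₂ - a₂) = k from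
    let ⟨c₁, c₂, hc⟩ := this; ⟨(c₁, c₂), hc⟩
  simp only [triangularLattice_adj, hexNorm]
  rcases lt_trichotomy a₁ b₁ with h₁ | h₁ | h₁ <;> rcases lt_trichotomy a₂ b₂ with h₂ | h₂ | h₂
  · exact ⟨b₁ - 1, b₂, by omega⟩
  · exact ⟨b₁ - 1, b₂, by omega⟩
  · exact ⟨b₁ - 1, b₂ + 1, by omega⟩
  · exact ⟨b₁, b₂ - 1, by omega⟩
  · omega
  · exact ⟨b₁, b₂ + 1, by omega⟩
  · exact ⟨b₁ + 1, b₂ - 1, by omega⟩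
  · exact ⟨b₁ + 1, b₂, by omega⟩
  · exact ⟨b₁ + 1, b₂, by omega⟩

theorem exists_walk_length_eq_hexNorm (k : ℕ) :
    ∀ {a b : ℤ × ℤ}, hexNorm (b - a) = k → ∃ p : triangularLattice.Walk b a, p.length = k := by
  induction k with
  | zero =>
    intro a b h
    obtain rfl : b = a := by
      simp only [hexNorm, Prod.fst_sub, Prod.snd_sub] at h
      ext <;> omega
    exact ⟨.nil, rfl⟩
  | succ k ih =>
    intro a b h
    obtain ⟨c, hbc, hc⟩ := exists_adj_hexNorm_sub h
    obtain ⟨p, hp⟩ := ih hc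
    exact ⟨.cons hbc p, by simpa using hp⟩

theorem triangularLattice_connected : triangularLattice.Connected :=
  SimpleGraph.connected_iff _ |>.2
    ⟨fun _ _ => let ⟨p, _⟩ := exists_walk_length_eq_hexNorm _ rfl; ⟨p⟩, inferInstance⟩

theorem triangularLattice_dist (a b : ℤ × ℤ) : triangularLattice.dist a b = hexNorm (b - a) := by
  rw [SimpleGraph.dist_comm]
  apply le_antisymm
  · obtain ⟨p, hp⟩ := exists_walk_length_eq_hexNorm _ (rfl : hexNorm (b - a) = _)
    exact hp ▸ SimpleGraph.dist_le p
  · obtain ⟨p, hp⟩ := triangularLattice_connected.exists_walk_length_eq_dist b a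
    rw [← hp]
    clear hp
    induction p with
    | nil => simp [hexNorm]
    | cons h p ih => exact (hexNorm_sub_le_of_adj h).trans (by simpa using ih)

theorem triangularLattice_exists_triangle_of_closer (u z : ℤ × ℤ) :
    ∃ s s', triangularLattice.Adj u s ∧ triangularLattice.Adj u s' ∧ triangularLattice.Adj s s' ∧
      ∀ x, triangularLattice.Adj u x → triangularLattice.dist z x < triangularLattice.dist z u →
        x = s ∨ x = s' := by
  obtain ⟨u₁, u₂⟩ := u
  obtain ⟨z₁, z₂⟩ := z
  suffices ∃ s₁ s₂ s₁' s₂' : ℤ, triangularLattice.Adj (u₁, u₂) (s₁, s₂) ∧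
      triangularLattice.Adj (u₁, u₂) (s₁', s₂') ∧ triangularLattice.Adj (s₁, s₂) (s₁', s₂') ∧
      ∀ (k : ℕ) (x₁ x₂ : ℤ), triangularLattice.Adj (u₁, u₂) (x₁, x₂) →
        hexNorm (x₁ - z₁, x₂ - z₂) ≤ k → ¬ hexNorm (u₁ - z₁, u₂ - z₂) ≤ k →
        (x₁ = s₁ ∧ x₂ = s₂) ∨ (x₁ = s₁' ∧ x₂ = s₂') by
    obtain ⟨_, _, _, _, h₁, h₂, h₃, hcloser⟩ := this
    refine ⟨_, _, h₁, h₂, h₃, fun x hx hlt => ?_⟩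
    rw [triangularLattice_dist, triangularLattice_dist] at hlt
    simpa only [Prod.ext_iff] using hcloser _ _ _ hx le_rfl hlt.not_ge
  simp only [triangularLattice_adj, hexNorm_le_iff]
  -- The six sextants with apex `u`, one of which contains `z`.
  rcases le_total u₁ z₁ with h₁ | h₁ <;> rcases le_total u₂ z₂ with h₂ | h₂
  · refine ⟨u₁ + 1, u₂, u₁, u₂ + 1, ?_, ?_, ?_, fun _ _ _ => ?_⟩ <;> omega
  · rcases le_total (u₁ + u₂) (z₁ + z₂) with h₃ | h₃
    · refine ⟨u₁ + 1, u₂, u₁ + 1, u₂ - 1, ?_, ?_, ?_, fun _ _ _ => ?_⟩ <;> omega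
    · refine ⟨u₁, u₂ - 1, u₁ + 1, u₂ - 1, ?_, ?_, ?_, fun _ _ _ => ?_⟩ <;> omega
  · rcases le_total (u₁ + u₂) (z₁ + z₂) with h₃ | h₃
    · refine ⟨u₁, u₂ + 1, u₁ - 1, u₂ + 1, ?_, ?_, ?_, fun _ _ _ => ?_⟩ <;> omega
    · refine ⟨u₁ - 1, u₂, u₁ - 1, u₂ + 1, ?_, ?_, ?_, fun _ _ _ => ?_⟩ <;> omega
  · refine ⟨u₁ - 1, u₂, u₁, u₂ - 1, ?_, ?_, ?_, fun _ _ _ => ?_⟩ <;> omega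

theorem triangularLattice_triangle_condition {u v w : ℤ × ℤ} {k : ℕ}
    (hvw : triangularLattice.Adj v w) (hv : triangularLattice.dist u v = k + 1)
    (hw : triangularLattice.dist u w = k + 1) :
    ∃ x, triangularLattice.Adj x v ∧ triangularLattice.Adj x w ∧
      triangularLattice.dist u x = k := by
  suffices ∃ x₁ x₂, triangularLattice.Adj (x₁, x₂) v ∧ triangularLattice.Adj (x₁, x₂) w ∧
      triangularLattice.dist u (x₁, x₂) ≤ k by
    obtain ⟨x₁, x₂, hxv, hxw, hx⟩ := this
    have := dist_le_dist_add_one triangularLattice_connected hxv u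
    exact ⟨_, hxv, hxw, by omega⟩
  obtain ⟨u₁, u₂⟩ := u
  obtain ⟨v₁, v₂⟩ := v
  obtain ⟨w₁, w₂⟩ := w
  have hv' : ¬ triangularLattice.dist (u₁, u₂) (v₁, v₂) ≤ k := by omega
  have hw' : ¬ triangularLattice.dist (u₁, u₂) (w₁, w₂) ≤ k := by omega
  replace hv := hv.le
  replace hw := hw.le
  simp only [triangularLattice_dist, hexNorm_le_iff, triangularLattice_adj, Prod.mk_sub_mk,
    Nat.cast_add, Nat.cast_one] at *
  -- For each direction of `w - v` the sign says on which side of the edge `v w` the point `u` lies.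
  rcases hvw with h | h | h | h | h | h
  · rcases lt_or_ge v₂ u₂
    exacts [⟨v₁, v₂ + 1, by omega⟩, ⟨v₁ + 1, v₂ - 1, by omega⟩]
  · rcases lt_or_ge v₁ u₁
    exacts [⟨v₁ + 1, v₂, by omega⟩, ⟨v₁ - 1, v₂ + 1, by omega⟩]
  · rcases lt_or_ge (v₁ + v₂) (u₁ + u₂)
    exacts [⟨v₁ + 1, v₂, by omega⟩, ⟨v₁, v₂ - 1, by omega⟩]
  · rcases lt_or_ge v₂ u₂
    exacts [⟨v₁ - 1, v₂ + 1, by omega⟩, ⟨v₁, v₂ - 1, by omega⟩]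
  · rcases lt_or_ge v₁ u₁
    exacts [⟨v₁ + 1, v₂ - 1, by omega⟩, ⟨v₁ - 1, v₂, by omega⟩]
  · rcases lt_or_ge (v₁ + v₂) (u₁ + u₂)
    exacts [⟨v₁, v₂ + 1, by omega⟩, ⟨v₁ - 1, v₂, by omega⟩]

theorem add_eq_add_of_common_neighbors {x y z w : ℤ × ℤ} (hxy : triangularLattice.Adj x y)
    (hzx : triangularLattice.Adj z x) (hzy : triangularLattice.Adj z y)
    (hwx : triangularLattice.Adj w x) (hwy : triangularLattice.Adj w y) (hzw : z ≠ w) :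
    z + w = x + y := by
  rw [triangularLattice_adj] at hxy hzx hzy hwx hwy
  rw [Ne, Prod.ext_iff] at hzw
  simp only [Prod.ext_iff, Prod.fst_add, Prod.snd_add]
  rcases hxy with h | h | h | h | h | h <;> omega

/-- The six shortest vectors of the triangular lattice, as a list so that statements about pairs of
them can be decided. -/
def hexDirections : List (ℤ × ℤ) := [(1, 0), (0, 1), (1, -1), (-1, 0), (0, -1), (-1, 1)]

theorem triangularLattice_adj_iff_mem_hexDirections {a b : ℤ × ℤ} :
    triangularLattice.Adj a b ↔ b - a ∈ hexDirections := by
  simp only [triangularLattice_adj, hexDirections, List.mem_cons, List.not_mem_nil, or_false,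
    Prod.ext_iff, Prod.fst_sub, Prod.snd_sub]
  omega

theorem exists_path_hexDirections : ∀ d ∈ hexDirections, ∀ e ∈ hexDirections,
    e - d ∈ hexDirections ∨
    (∃ f ∈ hexDirections, d - f ∈ hexDirections ∧ e - f ∈ hexDirections) ∨
    ∃ f ∈ hexDirections, ∃ g ∈ hexDirections, d - f ∈ hexDirections ∧ f - g ∈ hexDirections ∧
      e - g ∈ hexDirections := by
  decide

theorem triangularLattice_exists_path_link {y b c : ℤ × ℤ} (hb : triangularLattice.Adj y b)
    (hc : triangularLattice.Adj y c) : triangularLattice.Adj b c ∨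
      (∃ x, triangularLattice.Adj x y ∧ triangularLattice.Adj x b ∧ triangularLattice.Adj x c) ∨
      ∃ x z, triangularLattice.Adj x y ∧ triangularLattice.Adj x b ∧ triangularLattice.Adj z y ∧
        triangularLattice.Adj z x ∧ triangularLattice.Adj z c := by
  have adj_add {f : ℤ × ℤ} (hf : f ∈ hexDirections) : triangularLattice.Adj (y + f) y := by
    simpa [SimpleGraph.adj_comm, triangularLattice_adj_iff_mem_hexDirections] using hf
  rw [triangularLattice_adj_iff_mem_hexDirections] at hb hc
  rcases exists_path_hexDirections _ hb _ hc with
    h | ⟨f, hf, hbf, hcf⟩ | ⟨f, hf, g, hg, hbf, hfg, hcg⟩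
  · exact .inl (by simpa [triangularLattice_adj_iff_mem_hexDirections] using h)
  · refine .inr (.inl ⟨y + f, adj_add hf, ?_, ?_⟩) <;>
      simpa [triangularLattice_adj_iff_mem_hexDirections, sub_add_eq_sub_sub]
  · refine .inr (.inr ⟨y + f, y + g, adj_add hf, ?_, adj_add hg, ?_, ?_⟩) <;>
      simpa [triangularLattice_adj_iff_mem_hexDirections, sub_add_eq_sub_sub]

section Rigidity

variable {g h : triangularLattice →g triangularLattice}

theorem map_add_map_of_common_neighbors (hg : Function.Injective g) {x y z w : ℤ × ℤ}
    (hxy : triangularLattice.Adj x y) (hzx : triangularLattice.Adj z x)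
    (hzy : triangularLattice.Adj z y) (hwx : triangularLattice.Adj w x)
    (hwy : triangularLattice.Adj w y) (hzw : z ≠ w) : g z + g w = g x + g y :=
  add_eq_add_of_common_neighbors (g.map_adj hxy) (g.map_adj hzx) (g.map_adj hzy) (g.map_adj hwx)
    (g.map_adj hwy) (hg.ne hzw)

theorem eq_apply_zero_of_periodic {α : Type*} {F : ℤ × ℤ → α} (h₁ : Function.Periodic F (1, 0))
    (h₂ : Function.Periodic F (0, 1)) (p : ℤ × ℤ) : F p = F 0 := by
  simpa using ((h₁.zsmul p.1).add_period (h₂.zsmul p.2)) 0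

theorem apply_eq_affine (hg : Function.Injective g) (p : ℤ × ℤ) :
    g p = g 0 + p.1 • (g (1, 0) - g 0) + p.2 • (g (0, 1) - g 0) := by
  have rhombus (p : ℤ × ℤ) : g p + g (p + (1, 1)) = g (p + (1, 0)) + g (p + (0, 1)) := by
    apply map_add_map_of_common_neighbors hg <;> simp [triangularLattice_adj, Prod.ext_iff]
  have rhombus₁ (p : ℤ × ℤ) :
      g (p + (0, 1)) + g (p + (2, 0)) = g (p + (1, 0)) + g (p + (1, 1)) := by
    apply map_add_map_of_common_neighbors hg <;> simp [triangularLattice_adj] <;> omega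
  have rhombus₂ (p : ℤ × ℤ) :
      g (p + (1, 0)) + g (p + (0, 2)) = g (p + (0, 1)) + g (p + (1, 1)) := by
    apply map_add_map_of_common_neighbors hg <;> simp [triangularLattice_adj] <;> omega
  have step₁ (p : ℤ × ℤ) : g (p + (1, 0)) - g p = g (1, 0) - g 0 := by
    have := eq_apply_zero_of_periodic (F := fun p => g (p + (1, 0)) - g p)
      (fun p => by
        simp only [add_assoc, Prod.mk_add_mk, Int.reduceAdd]
        linear_combination rhombus p + rhombus₁ p)
      (fun p => by
        simp only [add_assoc, Prod.mk_add_mk, Int.reduceAdd]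
        linear_combination rhombus p) p
    simpa using this
  have step₂ (p : ℤ × ℤ) : g (p + (0, 1)) - g p = g (0, 1) - g 0 := by
    have := eq_apply_zero_of_periodic (F := fun p => g (p + (0, 1)) - g p)
      (fun p => by
        simp only [add_assoc, Prod.mk_add_mk, Int.reduceAdd]
        linear_combination rhombus p)
      (fun p => by
        simp only [add_assoc, Prod.mk_add_mk, Int.reduceAdd]
        linear_combination rhombus p + rhombus₂ p) p
    simpa using this
  have := eq_apply_zero_of_periodic
    (F := fun p => g p - p.1 • (g (1, 0) - g 0) - p.2 • (g (0, 1) - g 0))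
    (fun p => by
      simp only [Prod.fst_add, Prod.snd_add, ← step₁ p]
      module)
    (fun p => by
      simp only [Prod.fst_add, Prod.snd_add, ← step₂ p]
      module) p
  simp only [Prod.fst_zero, Prod.snd_zero, zero_smul, sub_zero] at this
  linear_combination (norm := module) this

theorem triangle_det_ne_zero {t₁ t₂ t₃ : ℤ × ℤ} (h₁₂ : triangularLattice.Adj t₁ t₂)
    (h₁₃ : triangularLattice.Adj t₁ t₃) (h₂₃ : triangularLattice.Adj t₂ t₃) :
    (t₂.1 - t₁.1) * (t₃.2 - t₁.2) - (t₂.2 - t₁.2) * (t₃.1 - t₁.1) ≠ 0 := by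
  rw [triangularLattice_adj] at h₁₂ h₁₃ h₂₃
  rcases h₁₂ with h | h | h | h | h | h <;> rw [h.1, h.2] at h₂₃ ⊢ <;> ring_nf <;> omega

theorem eq_of_eq_on_triangle (hg : Function.Injective g) (hh : Function.Injective h)
    {t : Fin 3 → ℤ × ℤ} (ht : Pairwise fun i j => triangularLattice.Adj (t i) (t j))
    (e : ∀ i, g (t i) = h (t i)) : g = h := by
  have hdet := triangle_det_ne_zero (ht (i := 0) (j := 1) (by decide)) (ht (j := 2) (by decide))
    (ht (by decide))
  have e₀ := e 0
  have e₁ := e 1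
  have e₂ := e 2
  rw [apply_eq_affine hg, apply_eq_affine hh] at e₀ e₁ e₂
  set U := g (1, 0) - g 0 - (h (1, 0) - h 0)
  set V := g (0, 1) - g 0 - (h (0, 1) - h 0)
  have hU : U = 0 := by
    refine (smul_eq_zero.1 ?_).resolve_left hdet
    linear_combination (norm := module)
      ((t 2).2 - (t 0).2) • (e₁ - e₀) - ((t 1).2 - (t 0).2) • (e₂ - e₀)
  have hV : V = 0 := by
    refine (smul_eq_zero.1 ?_).resolve_left hdet
    linear_combination (norm := module)
      ((t 1).1 - (t 0).1) • (e₂ - e₀) - ((t 2).1 - (t 0).1) • (e₁ - e₀)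
  rw [sub_eq_zero] at hU hV
  rw [hU, hV, add_left_inj, add_left_inj] at e₀
  ext1 p
  rw [apply_eq_affine hg, apply_eq_affine hh, hU, hV, e₀]

end Rigidity

end TriangularLattice

section Complexes

variable {V : Type u} {W : Type v} {K : AbstractSimplicialComplex V}

theorem skeleton_adj {a b : V} :
    (skeleton K).Adj a b ↔ a ≠ b ∧ ∃ s ∈ K.faces, a ∈ s ∧ b ∈ s := by
  simp only [skeleton, SimpleGraph.fromRel_adj, and_comm (a := b ∈ _), or_self]

theorem mem_faces_of_subset {s t : Finset V} (hs : s ∈ K.faces) (hts : t ⊆ s)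
    (ht : t.Nonempty) : t ∈ K.faces :=
  (K.isRelLowerSet_faces hs).2 hts ht

theorem pair_mem_faces [DecidableEq V] {a b : V} (h : (skeleton K).Adj a b) :
    ({a, b} : Finset V) ∈ K.faces := by
  obtain ⟨_, s, hs, ha, hb⟩ := skeleton_adj.1 h
  exact mem_faces_of_subset hs (by simp [Finset.insert_subset_iff, ha, hb]) (by simp)

theorem pair_mem_flagComplex [DecidableEq V] {G : SimpleGraph V} {a b : V} (h : G.Adj a b) :
    ({a, b} : Finset V) ∈ (flagComplex G).faces :=
  ⟨by simp, by simp [h]⟩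

theorem adj_of_mem_flagComplex {G : SimpleGraph V} {s : Finset V}
    (hs : s ∈ (flagComplex G).faces) {a b : V} (ha : a ∈ s) (hb : b ∈ s) (hab : a ≠ b) :
    G.Adj a b :=
  hs.2 ha hb hab

theorem faceImage_eq_map (f : V ↪ W) (s : Finset V) : faceImage f s = s.map f := by
  ext x
  simp [mem_faceImage]

end Complexes

section Atlas

variable {V : Type u}

/-- The transition map from a chart `f` of an apartment to a chart `g` of another apartment: an
injective endomorphism of the triangular lattice that matches the two charts wherever they meet. -/
structure IsTransition (f g : ℤ × ℤ → V) (θ : triangularLattice →g triangularLattice) : Prop where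
  injective : Function.Injective θ
  eq_of_eq : ∀ {a b}, f a = g b → θ a = b

/-- An atlas of a building of type `Ã₂`: the charts of its apartments by the triangular lattice. -/
structure IsAtlas (X : AbstractSimplicialComplex V) (C : Set (ℤ × ℤ → V)) : Prop where
  injective : ∀ {f}, f ∈ C → Function.Injective f
  simplicial : ∀ {f}, f ∈ C → ∀ s ∈ modelApartment.faces, faceImage f s ∈ X.faces
  exists_chart : ∀ {s t}, s ∈ X.faces → t ∈ X.faces → ∃ f ∈ C,
    s ∈ faceImage f '' modelApartment.faces ∧ t ∈ faceImage f '' modelApartment.faces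
  exists_transition : ∀ {f g}, f ∈ C → g ∈ C → ∃ θ, IsTransition f g θ

theorem exists_isTransition {A B : PreAbstractSimplicialComplex V} {φ : V → V}
    (hφ : IsSubcomplexIso A B φ) (hfix : ∀ x, {x} ∈ A.faces → {x} ∈ B.faces → φ x = x)
    {f g : ℤ × ℤ ↪ V} (hf : A.faces = faceImage f '' modelApartment.faces)
    (hg : B.faces = faceImage g '' modelApartment.faces) : ∃ θ, IsTransition f g θ := by
  classical
  have singleton_mem {D : PreAbstractSimplicialComplex V} {f : ℤ × ℤ ↪ V}
      (hf : D.faces = faceImage f '' modelApartment.faces) (a : ℤ × ℤ) : {f a} ∈ D.faces := by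
    rw [hf]
    exact ⟨{a}, modelApartment.singleton_mem a, by simp [faceImage_eq_map]⟩
  have exists_face (s) (hs : s ∈ modelApartment.faces) : ∃ t ∈ modelApartment.faces,
      ∀ a ∈ s, ∃ b ∈ t, g b = φ (f a) := by
    have hmem : faceImage φ (faceImage f s) ∈ B.faces := by
      rw [← hφ.2, hf]
      exact ⟨_, ⟨s, hs, rfl⟩, rfl⟩
    rw [hg] at hmem
    obtain ⟨t, ht, hts⟩ := hmem
    refine ⟨t, ht, fun a ha => mem_faceImage.1 (hts ▸ ?_)⟩
    exact mem_faceImage.2 ⟨f a, mem_faceImage.2 ⟨a, ha, rfl⟩, rfl⟩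
  have exists_preimage (a : ℤ × ℤ) : ∃ b, g b = φ (f a) := by
    obtain ⟨t, -, ht⟩ := exists_face {a} (modelApartment.singleton_mem a)
    obtain ⟨b, -, hb⟩ := ht a (by simp)
    exact ⟨b, hb⟩
  choose θ hθ using exists_preimage
  have θ_injective : Function.Injective θ := fun a b hab =>
    f.injective (hφ.1 (singleton_mem hf a) (singleton_mem hf b) (by rw [← hθ, ← hθ, hab]))
  have θ_adj {a b} (hab : triangularLattice.Adj a b) : triangularLattice.Adj (θ a) (θ b) := by
    obtain ⟨t, ht, hts⟩ := exists_face {a, b} (pair_mem_flagComplex hab)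
    have mem {c} (hc : c ∈ ({a, b} : Finset (ℤ × ℤ))) : θ c ∈ t := by
      obtain ⟨d, hd, hdc⟩ := hts c hc
      rwa [g.injective ((hθ c).trans hdc.symm)]
    exact adj_of_mem_flagComplex ht (mem (by simp)) (mem (by simp)) (θ_injective.ne hab.ne)
  refine ⟨⟨θ, θ_adj⟩, θ_injective, fun {a b} hab => g.injective ?_⟩
  rw [RelHom.coeFn_mk, hθ, hfix (f a) (singleton_mem hf a) (hab ▸ singleton_mem hg b), hab]

theorem exists_isAtlas {X : AbstractSimplicialComplex V} (hX : IsA2TildeBuilding X) :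
    ∃ C, IsAtlas X C := by
  obtain ⟨𝒜, happ, hcover, hiso⟩ := hX.exists_apartments
  simp only [IsApartmentIn, ← faceImage_eq_map] at happ
  refine ⟨{g | ∃ A ∈ 𝒜, ∃ f : ℤ × ℤ ↪ V, A.faces = faceImage f '' modelApartment.faces ∧ f = g},
    ?_, ?_, ?_, ?_⟩
  · rintro _ ⟨A, _, f, _, rfl⟩
    exact f.injective
  · rintro _ ⟨A, hA, f, hf, rfl⟩ s hs
    exact (happ A hA).1 (hf ▸ ⟨s, hs, rfl⟩)
  · intro s t hs ht
    obtain ⟨A, hA, hsA, htA⟩ := hcover s hs t ht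
    obtain ⟨-, f, hf⟩ := happ A hA
    exact ⟨f, ⟨A, hA, f, hf, rfl⟩, hf ▸ hsA, hf ▸ htA⟩
  · rintro _ _ ⟨A, hA, f, hf, rfl⟩ ⟨B, hB, g, hg, rfl⟩
    obtain ⟨φ, hφ, hfix⟩ := hiso A hA B hB
    exact exists_isTransition hφ hfix hf hg

namespace IsAtlas

variable {X : AbstractSimplicialComplex V} {C : Set (ℤ × ℤ → V)}

theorem adj (hC : IsAtlas X C) {f : ℤ × ℤ → V} (hf : f ∈ C) {a b : ℤ × ℤ}
    (h : triangularLattice.Adj a b) : (skeleton X).Adj (f a) (f b) :=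
  skeleton_adj.2 ⟨(hC.injective hf).ne h.ne, _, hC.simplicial hf _ (pair_mem_flagComplex h),
    mem_faceImage.2 ⟨a, by simp, rfl⟩, mem_faceImage.2 ⟨b, by simp, rfl⟩⟩

/-- A chart as a homomorphism of graphs. -/
def chartHom (hC : IsAtlas X C) {f : ℤ × ℤ → V} (hf : f ∈ C) : triangularLattice →g skeleton X :=
  ⟨f, hC.adj hf⟩

theorem exists_chart_range (hC : IsAtlas X C) {s t : Finset V} (hs : s ∈ X.faces)
    (ht : t ∈ X.faces) : ∃ f ∈ C, ↑s ⊆ Set.range f ∧ ↑t ⊆ Set.range f := by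
  obtain ⟨f, hf, ⟨s', -, rfl⟩, ⟨t', -, rfl⟩⟩ := hC.exists_chart hs ht
  refine ⟨f, hf, ?_, ?_⟩ <;>
  · intro x hx
    obtain ⟨a, -, ha⟩ := mem_faceImage.1 hx
    exact ⟨a, ha⟩

section Retraction

variable {g : ℤ × ℤ → V} {t : Fin 3 → ℤ × ℤ}

/-- This makes the retraction onto an apartment well defined. -/
theorem transition_eq_transition (hC : IsAtlas X C) (hg : g ∈ C)
    (ht : Pairwise fun i j => triangularLattice.Adj (t i) (t j)) {f f' : ℤ × ℤ → V}
    (hf : f ∈ C) (hf' : f' ∈ C) (hft : ∀ i, g (t i) ∈ Set.range f)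
    (hft' : ∀ i, g (t i) ∈ Set.range f') {θ θ' : triangularLattice →g triangularLattice}
    (hθ : IsTransition f g θ) (hθ' : IsTransition f' g θ') {a b : ℤ × ℤ} (hab : f a = f' b) :
    θ a = θ' b := by
  obtain ⟨ψ, hψ⟩ := hC.exists_transition hf hf'
  obtain ⟨μ, hμ⟩ := hC.exists_transition hg hf
  choose a' ha' using hft
  choose b' hb' using hft'
  have hcomp : θ'.comp ψ = θ := by
    refine eq_of_eq_on_triangle (t := a') (hθ'.injective.comp hψ.injective) hθ.injective
      (fun i j hij => ?_) fun i => ?_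
    · change triangularLattice.Adj (a' i) (a' j)
      rw [← hμ.eq_of_eq (ha' i).symm, ← hμ.eq_of_eq (ha' j).symm]
      exact μ.map_adj (ht hij)
    · rw [RelHom.comp_apply, hψ.eq_of_eq ((ha' i).trans (hb' i).symm), hθ'.eq_of_eq (hb' i),
        hθ.eq_of_eq (ha' i)]
  rw [← hcomp, RelHom.comp_apply, hψ.eq_of_eq hab]

open Classical in
theorem triangle_mem_faces (hC : IsAtlas X C) (hg : g ∈ C)
    (ht : Pairwise fun i j => triangularLattice.Adj (t i) (t j)) :
    faceImage g (Finset.univ.image t) ∈ X.faces := by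
  refine hC.simplicial hg _ ⟨by simp, ?_⟩
  change triangularLattice.IsClique _
  rw [Finset.coe_image, Finset.coe_univ, Set.image_univ]
  rintro _ ⟨i, rfl⟩ _ ⟨j, rfl⟩ hij
  exact ht fun h => hij (congrArg t h)

theorem exists_retraction_onto_triangle (hC : IsAtlas X C) (hg : g ∈ C)
    (ht : Pairwise fun i j => triangularLattice.Adj (t i) (t j)) :
    ∃ ρ : skeleton X →g triangularLattice, (∀ a, ρ (g a) = a) ∧
      ∀ x i, ρ x = t i → x = g (t i) := by
  classical
  have exists_chart {s : Finset V} (hs : s ∈ X.faces) :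
      ∃ f ∈ C, s ∈ faceImage f '' modelApartment.faces ∧ ∀ i, g (t i) ∈ Set.range f := by
    obtain ⟨f, hf, hsf, T, -, hT⟩ := hC.exists_chart hs (hC.triangle_mem_faces hg ht)
    refine ⟨f, hf, hsf, fun i => ?_⟩
    have hti : g (t i) ∈ faceImage f T := hT ▸ mem_faceImage.2 ⟨t i, by simp, rfl⟩
    obtain ⟨a, -, ha⟩ := mem_faceImage.1 hti
    exact ⟨a, ha⟩
  choose F hF hxF hT using fun x => exists_chart (X.singleton_mem x)
  have ha (x) : ∃ a, F x a = x := by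
    obtain ⟨s, -, hs⟩ := hxF x
    obtain ⟨a, -, ha⟩ := mem_faceImage.1 (hs ▸ Finset.mem_singleton_self x)
    exact ⟨a, ha⟩
  choose A hA using ha
  choose θ hθ using fun x => hC.exists_transition (hF x) hg
  have eq_transition {f θ'} (hf : f ∈ C) (hft : ∀ i, g (t i) ∈ Set.range f)
      (hθ' : IsTransition f g θ') (a : ℤ × ℤ) : θ (f a) (A (f a)) = θ' a :=
    hC.transition_eq_transition hg ht (hF _) hf (hT _) hft (hθ _) hθ' (hA _)
  refine ⟨⟨fun x => θ x (A x), fun {x y} hxy => ?_⟩, fun a => (hθ _).eq_of_eq (hA _),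
    fun x i hx => ?_⟩
  · obtain ⟨f, hf, hsf, hft⟩ := exists_chart (pair_mem_faces hxy)
    obtain ⟨η, hη⟩ := hC.exists_transition hf hg
    obtain ⟨s, hs, hsxy⟩ := hsf
    obtain ⟨a, ha, rfl⟩ := mem_faceImage.1 (hsxy ▸ Finset.mem_insert_self x {y})
    obtain ⟨b, hb, rfl⟩ := mem_faceImage.1 (hsxy ▸ Finset.mem_insert_of_mem (by simp) :
      y ∈ faceImage f s)
    rw [eq_transition hf hft hη, eq_transition hf hft hη]
    exact η.map_adj (adj_of_mem_flagComplex hs ha hb fun h => hxy.ne (congrArg f h))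
  · obtain ⟨b, hb⟩ := hT x i
    have hAb : A x = b := (hθ x).injective (hx.trans ((hθ x).eq_of_eq hb).symm)
    rw [← hb, ← hAb, hA]

end Retraction

end IsAtlas

end Atlas

/-- The properties of the `1`-skeleton of a building of type `Ã₂`, with its vertex colouring, on
which the counting of isometries is based. -/
structure IsBuildingGraph {V : Type u} (G : SimpleGraph V) (τ : V → ZMod 3) : Prop where
  connected : G.Connected
  color : ∀ {x y}, G.Adj x y → τ x ≠ τ y
  /-- the neighbours of a vertex that are closer to another vertex form a clique -/
  closer : ∀ {u z x y}, G.Adj u x → G.Adj u y → G.dist z x < G.dist z u →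
    G.dist z y < G.dist z u → x = y ∨ G.Adj x y
  /-- the triangle condition -/
  triangle : ∀ {u v w k}, G.Adj v w → G.dist u v = k + 1 → G.dist u w = k + 1 →
    ∃ x, G.Adj x v ∧ G.Adj x w ∧ G.dist u x = k
  /-- vertices of the same colour in a link have a common neighbour in the link -/
  exists_join : ∀ {y b c}, G.Adj y b → G.Adj y c → τ b = τ c →
    ∃ x, G.Adj x y ∧ G.Adj x b ∧ G.Adj x c

theorem zmod_three_eq_of_ne : ∀ {a b c d : ZMod 3}, a ≠ b → a ≠ c → b ≠ c → a ≠ d → b ≠ d →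
    c = d := by
  decide

theorem triangularLattice_color_ne {a b : ℤ × ℤ} (h : triangularLattice.Adj a b) :
    ((a.1 - a.2 : ℤ) : ZMod 3) ≠ ((b.1 - b.2 : ℤ) : ZMod 3) := by
  rw [Ne, ZMod.intCast_eq_intCast_iff, Int.modEq_iff_dvd]
  rw [triangularLattice_adj] at h
  push_cast
  omega

namespace IsAtlas

variable {V : Type u} {X : AbstractSimplicialComplex V} {C : Set (ℤ × ℤ → V)}

theorem exists_chart_vertices (hC : IsAtlas X C) (x y : V) :
    ∃ f ∈ C, ∃ a b, f a = x ∧ f b = y := by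
  obtain ⟨f, hf, hx, hy⟩ := hC.exists_chart_range (X.singleton_mem x) (X.singleton_mem y)
  obtain ⟨a, ha⟩ := hx (Finset.mem_singleton_self x)
  obtain ⟨b, hb⟩ := hy (Finset.mem_singleton_self y)
  exact ⟨f, hf, a, b, ha, hb⟩

theorem exists_chart_vertex_edge (hC : IsAtlas X C) (x : V) {y z : V}
    (h : (skeleton X).Adj y z) : ∃ f ∈ C, ∃ a b c, f a = x ∧ f b = y ∧ f c = z := by
  classical
  obtain ⟨f, hf, hx, hyz⟩ := hC.exists_chart_range (X.singleton_mem x) (pair_mem_faces h)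
  obtain ⟨a, ha⟩ := hx (Finset.mem_singleton_self x)
  obtain ⟨b, hb⟩ := hyz (show y ∈ ({y, z} : Finset V) by simp)
  obtain ⟨c, hc⟩ := hyz (show z ∈ ({y, z} : Finset V) by simp)
  exact ⟨f, hf, a, b, c, ha, hb, hc⟩

theorem exists_chart_edges (hC : IsAtlas X C) {x y z : V} (hy : (skeleton X).Adj x y)
    (hz : (skeleton X).Adj x z) : ∃ f ∈ C, ∃ a b c, f a = x ∧ f b = y ∧ f c = z := by
  classical
  obtain ⟨f, hf, hxy, hxz⟩ := hC.exists_chart_range (pair_mem_faces hy) (pair_mem_faces hz)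
  obtain ⟨a, ha⟩ := hxy (show x ∈ ({x, y} : Finset V) by simp)
  obtain ⟨b, hb⟩ := hxy (show y ∈ ({x, y} : Finset V) by simp)
  obtain ⟨c, hc⟩ := hxz (show z ∈ ({x, z} : Finset V) by simp)
  exact ⟨f, hf, a, b, c, ha, hb, hc⟩

theorem exists_retraction (hC : IsAtlas X C) {g : ℤ × ℤ → V} (hg : g ∈ C) :
    ∃ ρ : skeleton X →g triangularLattice, ∀ a, ρ (g a) = a := by
  obtain ⟨ρ, hρ, -⟩ := hC.exists_retraction_onto_triangle hg (t := ![(0, 0), (1, 0), (0, 1)])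
    (fun i j hij => by fin_cases i <;> fin_cases j <;> simp [triangularLattice_adj] at hij ⊢)
  exact ⟨ρ, hρ⟩

theorem adj_iff (hC : IsAtlas X C) {f : ℤ × ℤ → V} (hf : f ∈ C) {a b : ℤ × ℤ} :
    (skeleton X).Adj (f a) (f b) ↔ triangularLattice.Adj a b := by
  refine ⟨fun h => ?_, hC.adj hf⟩
  obtain ⟨ρ, hρ⟩ := hC.exists_retraction hf
  simpa only [hρ] using ρ.map_adj h

theorem connected (hC : IsAtlas X C) [Nonempty V] : (skeleton X).Connected := by
  refine (SimpleGraph.connected_iff _).2 ⟨fun x y => ?_, inferInstance⟩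
  obtain ⟨f, hf, a, b, rfl, rfl⟩ := hC.exists_chart_vertices x y
  exact (triangularLattice_connected a b).map (hC.chartHom hf)

theorem dist_eq (hC : IsAtlas X C) {f : ℤ × ℤ → V} (hf : f ∈ C) (a b : ℤ × ℤ) :
    (skeleton X).dist (f a) (f b) = triangularLattice.dist a b := by
  obtain ⟨ρ, hρ⟩ := hC.exists_retraction hf
  have hab := triangularLattice_connected a b
  refine le_antisymm (dist_map_le (hC.chartHom hf) hab) ?_
  have hle := dist_map_le ρ (hab.map (hC.chartHom hf))
  change triangularLattice.dist (ρ (f a)) (ρ (f b)) ≤ _ at hle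
  rwa [hρ, hρ] at hle

theorem exists_coloring (hC : IsAtlas X C) [Nonempty V] :
    ∃ τ : V → ZMod 3, ∀ {x y}, (skeleton X).Adj x y → τ x ≠ τ y := by
  inhabit V
  obtain ⟨g, hg, -⟩ := hC.exists_chart_vertices (default : V) default
  obtain ⟨ρ, -⟩ := hC.exists_retraction hg
  exact ⟨fun x => (((ρ x).1 - (ρ x).2 : ℤ) : ZMod 3),
    fun h => triangularLattice_color_ne (ρ.map_adj h)⟩

theorem eq_or_adj_of_closer (hC : IsAtlas X C) [Nonempty V] {u z x y : V}
    (hx : (skeleton X).Adj u x) (hy : (skeleton X).Adj u y)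
    (hzx : (skeleton X).dist z x < (skeleton X).dist z u)
    (hzy : (skeleton X).dist z y < (skeleton X).dist z u) : x = y ∨ (skeleton X).Adj x y := by
  obtain ⟨f, hf, a, b, rfl, rfl⟩ := hC.exists_chart_vertices u z
  obtain ⟨s, s', hs, hs', hss', hcloser⟩ := triangularLattice_exists_triangle_of_closer a b
  -- Retracting onto the apartment decreases the distance to `f b`, and only the vertices of the
  -- triangle `f a`, `f s`, `f s'` retract into that triangle.
  obtain ⟨ρ, hρ, hρt⟩ := hC.exists_retraction_onto_triangle hf (t := ![a, s, s'])
    (fun i j hij => by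
      fin_cases i <;> fin_cases j <;> simp [hs, hs', hss', hs.symm, hs'.symm, hss'.symm] at hij ⊢)
  have eq_or_eq {x} (hx : (skeleton X).Adj (f a) x)
      (hlt : (skeleton X).dist (f b) x < (skeleton X).dist (f b) (f a)) : x = f s ∨ x = f s' := by
    have hadj := ρ.map_adj hx
    have hle := dist_map_le ρ (hC.connected (f b) x)
    rw [hρ] at hadj hle
    rw [hC.dist_eq hf] at hlt
    exact (hcloser _ hadj (hle.trans_lt hlt)).imp (hρt x 1) (hρt x 2)
  rcases eq_or_eq hx hzx with rfl | rfl <;> rcases eq_or_eq hy hzy with rfl | rfl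
  · exact .inl rfl
  · exact .inr (hC.adj hf hss')
  · exact .inr (hC.adj hf hss'.symm)
  · exact .inl rfl

theorem triangle_condition (hC : IsAtlas X C) {u v w : V} {k : ℕ}
    (hvw : (skeleton X).Adj v w) (hv : (skeleton X).dist u v = k + 1)
    (hw : (skeleton X).dist u w = k + 1) :
    ∃ x, (skeleton X).Adj x v ∧ (skeleton X).Adj x w ∧ (skeleton X).dist u x = k := by
  obtain ⟨f, hf, a, b, c, rfl, rfl, rfl⟩ := hC.exists_chart_vertex_edge u hvw
  rw [hC.dist_eq hf] at hv hw
  obtain ⟨x, hxb, hxc, hx⟩ :=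
    triangularLattice_triangle_condition ((hC.adj_iff hf).1 hvw) hv hw
  exact ⟨f x, hC.adj hf hxb, hC.adj hf hxc, (hC.dist_eq hf a x).trans hx⟩

theorem exists_join (hC : IsAtlas X C) {τ : V → ZMod 3}
    (hτ : ∀ {x y}, (skeleton X).Adj x y → τ x ≠ τ y) {y b c : V} (hb : (skeleton X).Adj y b)
    (hc : (skeleton X).Adj y c) (hbc : τ b = τ c) :
    ∃ x, (skeleton X).Adj x y ∧ (skeleton X).Adj x b ∧ (skeleton X).Adj x c := by
  obtain ⟨f, hf, y, b, c, rfl, rfl, rfl⟩ := hC.exists_chart_edges hb hc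
  rcases triangularLattice_exists_path_link ((hC.adj_iff hf).1 hb) ((hC.adj_iff hf).1 hc) with
    h | ⟨x, hxy, hxb, hxc⟩ | ⟨x, z, hxy, hxb, hzy, hzx, hzc⟩
  · exact absurd hbc (hτ (hC.adj hf h))
  · exact ⟨f x, hC.adj hf hxy, hC.adj hf hxb, hC.adj hf hxc⟩
  · -- The colours alternate along the path `b`, `x`, `z`, `c` of the link.
    rw [← hC.adj_iff hf] at hxy hxb hzy hzx hzc
    exact absurd (zmod_three_eq_of_ne (hτ hxy).symm (hτ hb) (hτ hxb) (hτ hzy).symm (hτ hzx).symm)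
      (hbc ▸ hτ hzc).symm

theorem exists_isBuildingGraph (hC : IsAtlas X C) [Nonempty V] :
    ∃ τ : V → ZMod 3, IsBuildingGraph (skeleton X) τ :=
  let ⟨τ, hτ⟩ := hC.exists_coloring
  ⟨τ, hC.connected, hτ, hC.eq_or_adj_of_closer, hC.triangle_condition, hC.exists_join hτ⟩

end IsAtlas

section Links

namespace IsBuildingGraph

variable {V : Type u} {G : SimpleGraph V} {τ : V → ZMod 3}

theorem eq_or_adj_of_common (hG : IsBuildingGraph G τ) {b c x y : V} (hb : G.Adj y b)
    (hc : G.Adj y c) (hb' : G.Adj x b) (hc' : G.Adj x c) (hne : b ≠ c) (hn : ¬ G.Adj b c) :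
    x = y ∨ G.Adj x y := by
  have h2 := dist_eq_two_of_adj_of_adj hc hb hne.symm fun h => hn h.symm
  apply hG.closer (z := c) hb'.symm hb.symm <;>
    rw [h2, SimpleGraph.dist_eq_one_iff_adj.2 (by simp only [hc.symm, hc'.symm])] <;> norm_num

theorem color_eq (hG : IsBuildingGraph G τ) {a b c d : V} (hab : G.Adj a b) (hac : G.Adj a c)
    (hbc : G.Adj b c) (had : G.Adj a d) (hbd : G.Adj b d) : τ c = τ d :=
  zmod_three_eq_of_ne (hG.color hab) (hG.color hac) (hG.color hbc) (hG.color had) (hG.color hbd)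

theorem color_eq_of_ne (hG : IsBuildingGraph G τ) {y b c d : V} (hb : G.Adj y b) (hc : G.Adj y c)
    (hd : G.Adj y d) (hbc : τ b ≠ τ c) (hbd : τ b ≠ τ d) : τ c = τ d :=
  zmod_three_eq_of_ne (hG.color hb) (hG.color hc) hbc (hG.color hd) hbd

theorem not_adj_of_color_eq (hG : IsBuildingGraph G τ) {b c : V} (h : τ b = τ c) : ¬ G.Adj b c :=
  fun h' => hG.color h' h

theorem join_unique (hG : IsBuildingGraph G τ) {y b c x x' : V} (hb : G.Adj y b)
    (hne : b ≠ c) (hτ : τ b = τ c) (hxy : G.Adj x y) (hxb : G.Adj x b) (hxc : G.Adj x c)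
    (hxy' : G.Adj x' y) (hxb' : G.Adj x' b) (hxc' : G.Adj x' c) : x = x' := by
  have hcol : τ x = τ x' := hG.color_eq hb hxy.symm hxb.symm hxy'.symm hxb'.symm
  exact (hG.eq_or_adj_of_common hxb' hxc' hxb hxc hne
    (hG.not_adj_of_color_eq hτ)).resolve_right (hG.not_adj_of_color_eq hcol)

end IsBuildingGraph

end Links

section LocalToGlobal

/-- A graph homomorphism that around each vertex is an embedding whose image contains, with two
non-adjacent vertices, all their common neighbours. This is the local form of being an isometry,
see `IsLocallyConvexEmbedding.dist_eq` and
`IsLocallyConvexEmbedding.mem_range_of_dist_add_dist_eq`. -/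
structure IsLocallyConvexEmbedding {Z : Type v} {V : Type u} (H : SimpleGraph Z)
    (G : SimpleGraph V) (f : Z → V) : Prop where
  adj : ∀ {a b}, H.Adj a b → G.Adj (f a) (f b)
  ne : ∀ {y b c}, H.Adj y b → H.Adj y c → b ≠ c → ¬ H.Adj b c → f b ≠ f c
  not_adj : ∀ {y b c}, H.Adj y b → H.Adj y c → b ≠ c → ¬ H.Adj b c → ¬ G.Adj (f b) (f c)
  exists_eq : ∀ {y b c x}, H.Adj y b → H.Adj y c → b ≠ c → ¬ H.Adj b c → G.Adj x (f b) →
    G.Adj x (f c) → ∃ w, H.Adj w b ∧ H.Adj w c ∧ f w = x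

namespace IsLocallyConvexEmbedding

variable {Z : Type v} {V : Type u} {H : SimpleGraph Z} {G : SimpleGraph V} {f : Z → V}
  {τ : V → ZMod 3}

theorem dist_eq_add_two (hf : IsLocallyConvexEmbedding H G f) (hH : H.Connected)
    (hG : IsBuildingGraph G τ) {a b c d : Z} {k : ℕ} (hbc : H.Adj b c) (hcd : H.Adj c d)
    (hb : H.dist a b = k) (hd : H.dist a d = k + 2)
    (ih : ∀ x, H.dist a x ≤ k + 1 → G.dist (f a) (f x) = H.dist a x) :
    G.dist (f a) (f d) = k + 2 := by
  obtain ⟨hne, hn⟩ := ne_and_not_adj_of_dist_add_two_le hH (a := a) (b := d) (c := b) (by omega)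
  have hne' := hf.ne hbc.symm hcd hne hn
  have hn' := hf.not_adj hbc.symm hcd hne hn
  have hc : H.dist a c = k + 1 := by
    have := dist_le_dist_add_one hH hbc a
    have := dist_le_dist_add_one hH hcd a
    omega
  have hfb := ih b (by omega)
  have hfc := ih c (by omega)
  have hle := dist_le_dist_add_one hG.connected (hf.adj hcd) (f a)
  have hge := dist_le_dist_add_one hG.connected (hf.adj hcd).symm (f a)
  have not_k : G.dist (f a) (f d) ≠ k := by
    intro h
    rcases hG.closer (z := f a) (hf.adj hbc).symm (hf.adj hcd) (by omega) (by omega) with h | h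
    exacts [hne' h, hn' h]
  have not_k_add_one : G.dist (f a) (f d) ≠ k + 1 := by
    intro h
    obtain ⟨x, hxc, hxd, hx⟩ := hG.triangle (hf.adj hcd) (hfc.trans hc) h
    rcases hG.closer (z := f a) (hf.adj hbc).symm hxc.symm (by omega) (by omega) with rfl | hbx
    · exact hn' hxd
    obtain ⟨w, hwb, hwd, rfl⟩ := hf.exists_eq hbc.symm hcd hne hn hbx.symm hxd
    have := dist_le_dist_add_one hH hwb.symm a
    have := dist_le_dist_add_one hH hwd a
    have := ih w (by omega)
    omega
  omega

theorem dist_eq (hf : IsLocallyConvexEmbedding H G f) (hH : H.Connected)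
    (hG : IsBuildingGraph G τ) (a b : Z) : G.dist (f a) (f b) = H.dist a b := by
  induction hn : H.dist a b using Nat.strong_induction_on generalizing b with
  | _ n ih =>
  match n with
  | 0 => rw [hH.dist_eq_zero_iff.1 hn, SimpleGraph.dist_self]
  | 1 => exact SimpleGraph.dist_eq_one_iff_adj.2 (hf.adj (SimpleGraph.dist_eq_one_iff_adj.1 hn))
  | k + 2 =>
    obtain ⟨c, hcb, hc⟩ := exists_adj_dist_eq hH hn
    obtain ⟨d, hdc, hd⟩ := exists_adj_dist_eq hH hc
    exact hf.dist_eq_add_two hH hG hdc hcb hd hn fun x hx => ih _ (by omega) x rfl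

theorem mem_range_of_adj (hf : IsLocallyConvexEmbedding H G f) (hH : H.Connected)
    (hG : IsBuildingGraph G τ) {a b : Z} {x : V} (hxb : G.Adj x (f b))
    (hx : G.dist (f a) x + 1 = G.dist (f a) (f b)) : x ∈ Set.range f := by
  induction n : H.dist a b generalizing b x with
  | zero => rw [hf.dist_eq hH hG] at hx; omega
  | succ k ih =>
    have hab := hf.dist_eq hH hG a b
    obtain ⟨c, hcb, hc⟩ := exists_adj_dist_eq hH n
    have hac := hf.dist_eq hH hG a c
    rcases hG.closer (z := f a) hxb.symm (hf.adj hcb).symm (by omega) (by omega) with rfl | hxc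
    · exact ⟨c, rfl⟩
    cases k with
    | zero =>
      exact ⟨a, (hG.connected.dist_eq_zero_iff (u := f a) (v := x)).1 (by omega)⟩
    | succ k =>
      obtain ⟨y, hyx, hyc, hy⟩ := hG.triangle (u := f a) (k := k) hxc (by omega) (by omega)
      obtain ⟨d, rfl⟩ := ih hyc (by omega) hc
      have hdc : H.Adj d c := by
        rwa [← SimpleGraph.dist_eq_one_iff_adj, ← hf.dist_eq hH hG,
          SimpleGraph.dist_eq_one_iff_adj]
      obtain ⟨hne, hn⟩ := ne_and_not_adj_of_dist_add_two_le hH (a := a) (b := b) (c := d) (by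
        rw [← hf.dist_eq hH hG a d]
        omega)
      obtain ⟨w, -, -, hw⟩ := hf.exists_eq hdc.symm hcb hne hn hyx.symm hxb
      exact ⟨w, hw⟩

theorem mem_range_of_dist_add_dist_eq (hf : IsLocallyConvexEmbedding H G f) (hH : H.Connected)
    (hG : IsBuildingGraph G τ) {a b : Z} {x : V}
    (hx : G.dist (f a) x + G.dist x (f b) = G.dist (f a) (f b)) : x ∈ Set.range f := by
  induction n : G.dist x (f b) generalizing b with
  | zero => exact ⟨b, (hG.connected.dist_eq_zero_iff.1 n).symm⟩
  | succ m ih =>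
    obtain ⟨y, hyb, hxy⟩ := exists_adj_dist_eq hG.connected n
    have hle := hG.connected.dist_triangle (u := f a) (v := x) (w := y)
    have hge := dist_le_dist_add_one hG.connected hyb (f a)
    obtain ⟨c, rfl⟩ := hf.mem_range_of_adj hH hG hyb (a := a) (by omega)
    exact ih (by omega) hxy

end IsLocallyConvexEmbedding

end LocalToGlobal

section Thickness

namespace IsBuildingGraph

variable {V : Type u} {G : SimpleGraph V} {τ : V → ZMod 3}

/- Joining a common neighbour of `y` and `b` to the opposite vertex `c` within the link of `y` is
injective into the common neighbours of `y` and `c`. -/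
theorem encard_commonNeighbors_le_of_opposite (hG : IsBuildingGraph G τ) {y b c : V}
    (hb : G.Adj y b) (hc : G.Adj y c) (hτ : τ b ≠ τ c) (hn : ¬ G.Adj b c) :
    (G.commonNeighbors y b).encard ≤ (G.commonNeighbors y c).encard := by
  have hex : ∀ l ∈ G.commonNeighbors y b, ∃ m, G.Adj m y ∧ G.Adj m l ∧ G.Adj m c :=
    fun l hl => hG.exists_join hl.1 hc (hG.color_eq_of_ne hb hl.1 hc (hG.color hl.2) hτ)
  choose! j hj using hex
  refine Set.encard_le_encard_of_injOn (f := j)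
    (fun l hl => ⟨(hj l hl).1.symm, (hj l hl).2.2.symm⟩) fun l hl l' hl' e => ?_
  obtain ⟨hjy, hjl, hjc⟩ := hj l hl
  obtain ⟨-, hjl', -⟩ := hj l' hl'
  have hne : b ≠ j l := fun h => hn (h ▸ hjc)
  have hτj : τ b = τ (j l) := hG.color_eq_of_ne hc hb hjy.symm hτ.symm (hG.color hjc.symm)
  rw [← e] at hjl'
  exact hG.join_unique hb hne hτj hl.1.symm hl.2.symm hjl.symm hl'.1.symm hl'.2.symm hjl'.symm

theorem encard_commonNeighbors_eq_of_opposite (hG : IsBuildingGraph G τ) {y b c : V}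
    (hb : G.Adj y b) (hc : G.Adj y c) (hτ : τ b ≠ τ c) (hn : ¬ G.Adj b c) :
    (G.commonNeighbors y b).encard = (G.commonNeighbors y c).encard :=
  le_antisymm (hG.encard_commonNeighbors_le_of_opposite hb hc hτ hn)
    (hG.encard_commonNeighbors_le_of_opposite hc hb hτ.symm fun h => hn h.symm)

theorem exists_common_opposite (hG : IsBuildingGraph G τ)
    (hthick : ∀ y b, G.Adj y b → 3 ≤ (G.commonNeighbors y b).encard) {y b c : V}
    (hb : G.Adj y b) (hc : G.Adj y c) (hbc : b ≠ c) (hτ : τ b = τ c) :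
    ∃ l, G.Adj y l ∧ τ l ≠ τ b ∧ ¬ G.Adj l b ∧ ¬ G.Adj l c := by
  obtain ⟨m, hmy, hmb, hmc⟩ := hG.exists_join hb hc hτ
  obtain ⟨d, hd, hdbc⟩ : ∃ d ∈ G.commonNeighbors y m, d ∉ ({b, c} : Set V) := by
    refine Set.not_subset.1 fun h => absurd ((hthick y m hmy.symm).trans (Set.encard_mono h)) ?_
    rw [Set.encard_pair hbc]
    norm_num
  simp only [Set.mem_insert_iff, Set.mem_singleton_iff, not_or] at hdbc
  obtain ⟨l, hl, hlm⟩ := Set.exists_ne_of_one_lt_encard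
    (lt_of_lt_of_le (by norm_num) (hthick y d hd.1)) m
  have hdb : τ d = τ b := hG.color_eq hmy.symm hd.1 hd.2 hb hmb
  refine ⟨l, hl.1, fun h => hG.color hl.2 (hdb.trans h.symm), fun h => hlm ?_, fun h => hlm ?_⟩
  · exact hG.join_unique hd.1 hdbc.1 hdb hl.1.symm hl.2.symm h hmy hd.2 hmb
  · exact hG.join_unique hd.1 hdbc.2 (hdb.trans hτ) hl.1.symm hl.2.symm h hmy hd.2 hmc

theorem exists_color_eq_not_adj (hG : IsBuildingGraph G τ)
    (hthick : ∀ y b, G.Adj y b → 3 ≤ (G.commonNeighbors y b).encard) {y b c : V}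
    (hb : G.Adj y b) (hc : G.Adj y c) (hbc : G.Adj b c) :
    ∃ l, G.Adj y l ∧ τ l = τ c ∧ ¬ G.Adj b l := by
  obtain ⟨d, hd, hdb⟩ := Set.exists_ne_of_one_lt_encard
    (lt_of_lt_of_le (by norm_num) (hthick y c hc)) b
  obtain ⟨l, hl, hlc⟩ := Set.exists_ne_of_one_lt_encard
    (lt_of_lt_of_le (by norm_num) (hthick y d hd.1)) c
  have hτd : τ d = τ b := hG.color_eq hc hd.1 hd.2 hb hbc.symm
  refine ⟨l, hl.1, hG.color_eq hd.1 hl.1 hl.2 hc hd.2.symm, fun h => hlc ?_⟩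
  exact hG.join_unique hd.1 hdb hτd hl.1.symm hl.2.symm h.symm hc.symm hd.2 hbc.symm

theorem encard_commonNeighbors_eq_of_color_eq (hG : IsBuildingGraph G τ)
    (hthick : ∀ y b, G.Adj y b → 3 ≤ (G.commonNeighbors y b).encard) {y b c : V}
    (hb : G.Adj y b) (hc : G.Adj y c) (hτ : τ b = τ c) :
    (G.commonNeighbors y b).encard = (G.commonNeighbors y c).encard := by
  by_cases hbc : b = c
  · rw [hbc]
  obtain ⟨l, hl, hτl, hlb, hlc⟩ := hG.exists_common_opposite hthick hb hc hbc hτ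
  rw [← hG.encard_commonNeighbors_eq_of_opposite hl hb hτl hlb,
    hG.encard_commonNeighbors_eq_of_opposite hl hc (hτ ▸ hτl) hlc]

theorem encard_commonNeighbors_eq_of_adj (hG : IsBuildingGraph G τ)
    (hthick : ∀ y b, G.Adj y b → 3 ≤ (G.commonNeighbors y b).encard) {y b c : V}
    (hb : G.Adj y b) (hc : G.Adj y c) :
    (G.commonNeighbors y b).encard = (G.commonNeighbors y c).encard := by
  by_cases hτ : τ b = τ c
  · exact hG.encard_commonNeighbors_eq_of_color_eq hthick hb hc hτ
  by_cases hbc : G.Adj b c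
  · obtain ⟨l, hl, hτl, hbl⟩ := hG.exists_color_eq_not_adj hthick hb hc hbc
    rw [hG.encard_commonNeighbors_eq_of_opposite hb hl (hτl ▸ hτ) hbl,
      hG.encard_commonNeighbors_eq_of_color_eq hthick hl hc hτl]
  · exact hG.encard_commonNeighbors_eq_of_opposite hb hc hτ hbc

theorem encard_commonNeighbors_eq (hG : IsBuildingGraph G τ)
    (hthick : ∀ y b, G.Adj y b → 3 ≤ (G.commonNeighbors y b).encard) {y b y' b' : V}
    (hb : G.Adj y b) (hb' : G.Adj y' b') :
    (G.commonNeighbors y b).encard = (G.commonNeighbors y' b').encard := by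
  obtain ⟨p⟩ := hG.connected.preconnected y y'
  induction p generalizing b with
  | nil => exact hG.encard_commonNeighbors_eq_of_adj hthick hb hb'
  | cons h _ ih =>
    rw [hG.encard_commonNeighbors_eq_of_adj hthick hb h, SimpleGraph.commonNeighbors_symm]
    exact ih h.symm hb'

end IsBuildingGraph

end Thickness

section Counting

theorem encard_biUnion_eq_mul {ι : Type u} {α : Type v} {s : Set ι} {t : ι → Set α} {m n : ℕ}
    (hs : s.encard = m) (ht : ∀ i ∈ s, (t i).encard = n) (hd : s.PairwiseDisjoint t) :
    (⋃ i ∈ s, t i).encard = (m * n : ℕ) := by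
  classical
  lift s to Finset ι using Set.finite_of_encard_eq_coe hs
  rw [Set.encard_coe_eq_coe_finsetCard, Nat.cast_inj] at hs
  subst hs
  induction s using Finset.induction_on with
  | empty => simp
  | insert i s hi ih =>
    simp only [Finset.coe_insert, Set.forall_mem_insert] at ht hd ⊢
    have hdisj : Disjoint (t i) (⋃ j ∈ (s : Set ι), t j) := Set.disjoint_iUnion₂_right.2 fun j hj =>
      hd (Set.mem_insert i _) (Set.mem_insert_of_mem i hj) (by rintro rfl; exact hi hj)
    rw [Set.biUnion_insert, Set.encard_union_eq hdisj, ht.1,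
      ih ht.2 (hd.subset (Set.subset_insert i _)), Finset.card_insert_of_notMem hi, ← Nat.cast_add,
      add_mul, one_mul, add_comm]

/-- The `1`-skeleton of a building of type `Ã₂` in which every edge lies in `q + 1` triangles. -/
structure IsRegularBuildingGraph {V : Type u} (G : SimpleGraph V) (τ : V → ZMod 3) (q : ℕ) : Prop
    extends IsBuildingGraph G τ where
  two_le : 2 ≤ q
  encard_common : ∀ {y b}, G.Adj y b → (G.commonNeighbors y b).encard = ((q + 1 : ℕ) : ℕ∞)
  exists_adj : ∀ y, ∃ b, G.Adj y b

namespace IsRegularBuildingGraph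

variable {V : Type u} {G : SimpleGraph V} {τ : V → ZMod 3} {q : ℕ}

theorem encard_commonNeighbors_diff_singleton (hG : IsRegularBuildingGraph G τ q) {y m c : V}
    (hm : G.Adj y m) (hc : c ∈ G.commonNeighbors y m) :
    (G.commonNeighbors y m \ {c}).encard = q := by
  rw [Set.encard_sdiff_singleton_of_mem hc, hG.encard_common hm]
  norm_cast

theorem setOf_color_eq (hG : IsRegularBuildingGraph G τ q) {y c : V} (hc : G.Adj y c) :
    {b | G.Adj y b ∧ τ b = τ c} =
      insert c (⋃ m ∈ G.commonNeighbors y c, G.commonNeighbors y m \ {c}) := by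
  ext b
  simp only [Set.mem_ofPred_eq, Set.mem_insert_iff, Set.mem_iUnion, Set.mem_sdiff,
    Set.mem_singleton_iff, exists_prop, SimpleGraph.mem_commonNeighbors]
  constructor
  · rintro ⟨hb, hτ⟩
    refine or_iff_not_imp_left.2 fun hbc => ?_
    obtain ⟨m, hmy, hmb, hmc⟩ := hG.exists_join hb hc hτ
    exact ⟨m, ⟨hmy.symm, hmc.symm⟩, ⟨hb, hmb⟩, hbc⟩
  · rintro (rfl | ⟨m, ⟨hm, hcm⟩, ⟨hb, hmb⟩, -⟩)
    · exact ⟨hc, rfl⟩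
    · exact ⟨hb, hG.color_eq hm hb hmb hc hcm.symm⟩

theorem pairwiseDisjoint_commonNeighbors (hG : IsRegularBuildingGraph G τ q) {y c : V}
    (hc : G.Adj y c) : (G.commonNeighbors y c).PairwiseDisjoint
      fun m => G.commonNeighbors y m \ {c} := by
  intro m hm m' hm' hne
  refine Set.disjoint_left.2 fun b hb hb' => hne ?_
  exact hG.join_unique hc (Ne.symm hb.2) (hG.color_eq hm.1 hc hm.2.symm hb.1.1 hb.1.2) hm.1.symm
    hm.2.symm hb.1.2 hm'.1.symm hm'.2.symm hb'.1.2

theorem encard_setOf_color_eq (hG : IsRegularBuildingGraph G τ q) {y c : V} (hc : G.Adj y c) :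
    {b | G.Adj y b ∧ τ b = τ c}.encard = ((q ^ 2 + q + 1 : ℕ) : ℕ∞) := by
  have hcount := encard_biUnion_eq_mul (hG.encard_common hc)
    (fun m hm => hG.encard_commonNeighbors_diff_singleton hm.1 ⟨hc, hm.2.symm⟩)
    (hG.pairwiseDisjoint_commonNeighbors hc)
  rw [hG.setOf_color_eq hc, Set.encard_insert_of_notMem (by simp), hcount]
  norm_cast
  ring

theorem exists_commonNeighbor (hG : IsRegularBuildingGraph G τ q) {y c : V} (hc : G.Adj y c) :
    (G.commonNeighbors y c).Nonempty := by
  rw [← Set.encard_pos, hG.encard_common hc]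
  exact_mod_cast Nat.succ_pos q

theorem encard_setOf_color_ne (hG : IsRegularBuildingGraph G τ q) {y c : V} (hc : G.Adj y c) :
    {b | G.Adj y b ∧ τ b ≠ τ c}.encard = ((q ^ 2 + q + 1 : ℕ) : ℕ∞) := by
  obtain ⟨d, hd, hcd⟩ := hG.exists_commonNeighbor hc
  have heq : {b | G.Adj y b ∧ τ b ≠ τ c} = {b | G.Adj y b ∧ τ b = τ d} := by
    refine Set.ext fun b => and_congr_right fun hb => ⟨fun hτ => ?_, fun hτ => ?_⟩
    · exact hG.color_eq_of_ne hc hb hd (Ne.symm hτ) (hG.color hcd)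
    · exact hτ ▸ (hG.color hcd).symm
  rw [heq, hG.encard_setOf_color_eq hd]

theorem encard_opposite (hG : IsRegularBuildingGraph G τ q) {y c : V} (hc : G.Adj y c) :
    {b | G.Adj y b ∧ τ b ≠ τ c ∧ ¬ G.Adj b c}.encard = ((q ^ 2 : ℕ) : ℕ∞) := by
  have hopp : {b | G.Adj y b ∧ τ b ≠ τ c ∧ ¬ G.Adj b c} =
      {b | G.Adj y b ∧ τ b ≠ τ c} \ G.commonNeighbors y c := by
    ext b
    simp only [Set.mem_ofPred_eq, Set.mem_sdiff, SimpleGraph.mem_commonNeighbors,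
      SimpleGraph.adj_comm G c b]
    tauto
  have hsub : G.commonNeighbors y c ⊆ {b | G.Adj y b ∧ τ b ≠ τ c} :=
    fun b hb => ⟨hb.1, (hG.color hb.2).symm⟩
  have hfin := Set.finite_of_encard_eq_coe (hG.encard_common hc)
  rw [hopp, Set.encard_sdiff hsub hfin, hG.encard_setOf_color_ne hc, hG.encard_common hc, add_assoc]
  norm_cast
  rw [Nat.add_sub_cancel]

theorem encard_neighborSet (hG : IsRegularBuildingGraph G τ q) (y : V) :
    (G.neighborSet y).encard = ((2 * (q ^ 2 + q + 1) : ℕ) : ℕ∞) := by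
  obtain ⟨c, hc⟩ := hG.exists_adj y
  have hunion : G.neighborSet y = {b | G.Adj y b ∧ τ b = τ c} ∪ {b | G.Adj y b ∧ τ b ≠ τ c} := by
    ext b
    simp only [SimpleGraph.mem_neighborSet, Set.mem_union, Set.mem_ofPred_eq, ← and_or_left,
      ne_eq, em, and_true]
  have hdisj : Disjoint {b | G.Adj y b ∧ τ b = τ c} {b | G.Adj y b ∧ τ b ≠ τ c} :=
    Set.disjoint_left.2 fun b hb hb' => hb'.2 hb.2
  rw [hunion, Set.encard_union_eq hdisj, hG.encard_setOf_color_eq hc, hG.encard_setOf_color_ne hc,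
    two_mul]
  norm_cast

end IsRegularBuildingGraph

end Counting

section Flag

/-- A complex is a flag complex if every finite clique of its `1`-skeleton is a simplex. -/
def IsFlag {V : Type u} (K : AbstractSimplicialComplex V) : Prop :=
  ∀ s : Finset V, s.Nonempty → (skeleton K).IsClique (s : Set V) → s ∈ K.faces

theorem isClique_of_mem_faces {V : Type u} {K : AbstractSimplicialComplex V} {s : Finset V}
    (hs : s ∈ K.faces) : (skeleton K).IsClique (s : Set V) :=
  fun _ ha _ hb hab => skeleton_adj.2 ⟨hab, s, hs, ha, hb⟩

variable {V : Type u} {X : AbstractSimplicialComplex V}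

theorem IsA2TildeBuilding.nonempty (hX : IsA2TildeBuilding X) : Nonempty V := by
  obtain ⟨s, -, hs⟩ := hX.exists_triangle
  obtain ⟨x, -⟩ := Finset.card_pos.1 (by omega : 0 < s.card)
  exact ⟨x⟩

theorem IsAtlas.triple_mem_faces [DecidableEq V] {C : Set (ℤ × ℤ → V)} (hC : IsAtlas X C)
    {a b c : V} (hab : (skeleton X).Adj a b) (hac : (skeleton X).Adj a c)
    (hbc : (skeleton X).Adj b c) : ({a, b, c} : Finset V) ∈ X.faces := by
  obtain ⟨f, hf, a, b, c, rfl, rfl, rfl⟩ := hC.exists_chart_vertex_edge a hbc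
  rw [hC.adj_iff hf] at hab hac hbc
  have hclique : triangularLattice.IsClique ({a, b, c} : Finset (ℤ × ℤ)) := by
    simp [SimpleGraph.isClique_insert, hab, hac, hbc]
  convert hC.simplicial hf {a, b, c} ⟨by simp, hclique⟩
  ext x
  simp [mem_faceImage, eq_comm]

theorem IsA2TildeBuilding.isFlag (hX : IsA2TildeBuilding X) : IsFlag X := by
  classical
  obtain ⟨C, hC⟩ := exists_isAtlas hX
  have := hX.nonempty
  obtain ⟨τ, hG⟩ := hC.exists_isBuildingGraph
  intro s hne hs
  have hcard : s.card ≤ (Finset.univ : Finset (ZMod 3)).card :=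
    Finset.card_le_card_of_injOn τ (fun _ _ => Finset.mem_univ _) fun a ha b hb hab =>
      by_contra fun h => hG.color (hs ha hb h) hab
  have hpos := hne.card_pos
  rcases (by simp only [Finset.card_univ, ZMod.card] at hcard; omega :
    s.card = 1 ∨ s.card = 2 ∨ s.card = 3) with h | h | h
  · obtain ⟨a, rfl⟩ := Finset.card_eq_one.1 h
    exact X.singleton_mem a
  · obtain ⟨a, b, hab, rfl⟩ := Finset.card_eq_two.1 h
    exact pair_mem_faces (hs (by simp) (by simp) hab)
  · obtain ⟨a, b, c, hab, hac, hbc, rfl⟩ := Finset.card_eq_three.1 h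
    exact hC.triple_mem_faces (hs (by simp) (by simp) hab) (hs (by simp) (by simp) hac)
      (hs (by simp) (by simp) hbc)

theorem IsFlag.trianglesOver_eq_image [DecidableEq V] (hX : IsFlag X) {y b : V}
    (h : (skeleton X).Adj y b) : trianglesOver X {y, b} =
      (fun c => ({y, b, c} : Finset V)) '' (skeleton X).commonNeighbors y b := by
  ext t
  constructor
  · rintro ⟨ht, hcard, hsub⟩
    have hc : (t \ {y, b}).card = 1 := by
      rw [Finset.card_sdiff_of_subset hsub, hcard, Finset.card_pair h.ne]
    obtain ⟨c, hc⟩ := Finset.card_eq_one.1 hc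
    have hct : c ∈ t \ {y, b} := hc ▸ Finset.mem_singleton_self c
    simp only [Finset.mem_sdiff, Finset.mem_insert, Finset.mem_singleton, not_or] at hct
    refine ⟨c, ⟨skeleton_adj.2 ⟨Ne.symm hct.2.1, t, ht, hsub (by simp), hct.1⟩,
      skeleton_adj.2 ⟨Ne.symm hct.2.2, t, ht, hsub (by simp), hct.1⟩⟩, ?_⟩
    rw [← Finset.union_sdiff_of_subset hsub, hc, Finset.insert_union, Finset.singleton_union]
  · rintro ⟨c, hc, rfl⟩
    obtain ⟨hyc, hbc⟩ := (SimpleGraph.mem_commonNeighbors _).1 hc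
    refine ⟨hX _ (by simp) ?_, Finset.card_eq_three.2 ⟨y, b, c, h.ne, hyc.ne, hbc.ne, rfl⟩, ?_⟩
    · simp [SimpleGraph.isClique_insert, h, hyc, hbc]
    · simp [Finset.insert_subset_iff]

theorem IsFlag.encard_trianglesOver [DecidableEq V] (hX : IsFlag X) {y b : V}
    (h : (skeleton X).Adj y b) :
    (trianglesOver X {y, b}).encard = ((skeleton X).commonNeighbors y b).encard := by
  rw [hX.trianglesOver_eq_image h, Set.InjOn.encard_image]
  intro c hc d _ hcd
  obtain ⟨hyc, hbc⟩ := (SimpleGraph.mem_commonNeighbors _).1 hc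
  have hcd : ({y, b, c} : Finset V) = {y, b, d} := hcd
  have hmem : c ∈ ({y, b, d} : Finset V) := hcd ▸ by simp
  simp only [Finset.mem_insert, Finset.mem_singleton] at hmem
  exact (hmem.resolve_left hyc.ne.symm).resolve_left hbc.ne.symm

theorem IsA2TildeBuilding.exists_isRegularBuildingGraph (hX : IsA2TildeBuilding X) {q : ℕ}
    (hq : ∃ e ∈ X.faces, e.card = 2 ∧ (trianglesOver X e).encard = ((q + 1 : ℕ) : ℕ∞)) :
    ∃ τ, IsRegularBuildingGraph (skeleton X) τ q := by
  classical
  obtain ⟨C, hC⟩ := exists_isAtlas hX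
  have := hX.nonempty
  obtain ⟨τ, hG⟩ := hC.exists_isBuildingGraph
  have hthick : ∀ y b, (skeleton X).Adj y b → 3 ≤ ((skeleton X).commonNeighbors y b).encard := by
    intro y b h
    rw [← hX.isFlag.encard_trianglesOver h]
    exact hX.thick _ (pair_mem_faces h) (Finset.card_pair h.ne)
  obtain ⟨e, he, hc, hcard⟩ := hq
  obtain ⟨a, b, hab, rfl⟩ := Finset.card_eq_two.1 hc
  have hadj : (skeleton X).Adj a b := isClique_of_mem_faces he (by simp) (by simp) hab
  rw [hX.isFlag.encard_trianglesOver hadj] at hcard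
  refine ⟨τ, hG, ?_, fun h => (hG.encard_commonNeighbors_eq hthick h hadj).trans hcard, fun y => ?_⟩
  · have hle := hthick a b hadj
    rw [hcard] at hle
    have : 3 ≤ q + 1 := by exact_mod_cast hle
    omega
  · obtain ⟨f, hf, c, -, rfl, -⟩ := hC.exists_chart_vertices y y
    exact ⟨f (c.1 + 1, c.2), hC.adj hf (by simp [triangularLattice_adj])⟩

end Flag

section Isometries

variable {V : Type u} {W : Type v} {K : AbstractSimplicialComplex V}
  {L : AbstractSimplicialComplex W} {f : V → W}

theorem injective_of_edist_eq {G : SimpleGraph V} {H : SimpleGraph W}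
    (hd : ∀ a b, H.edist (f a) (f b) = G.edist a b) : Function.Injective f := fun a b hab => by
  rw [← SimpleGraph.edist_eq_zero_iff (G := G), ← hd, hab, SimpleGraph.edist_self]

theorem adj_iff_of_edist_eq {G : SimpleGraph V} {H : SimpleGraph W}
    (hd : ∀ a b, H.edist (f a) (f b) = G.edist a b) {a b : V} :
    H.Adj (f a) (f b) ↔ G.Adj a b := by
  rw [← SimpleGraph.edist_eq_one_iff_adj, hd, SimpleGraph.edist_eq_one_iff_adj]

theorem reachable_iff_of_edist_eq {G : SimpleGraph V} {H : SimpleGraph W}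
    (hd : ∀ a b, H.edist (f a) (f b) = G.edist a b) {a b : V} :
    H.Reachable (f a) (f b) ↔ G.Reachable a b := by
  rw [← SimpleGraph.edist_ne_top_iff_reachable, hd, SimpleGraph.edist_ne_top_iff_reachable]

theorem dist_eq_of_edist_eq {G : SimpleGraph V} {H : SimpleGraph W}
    (hd : ∀ a b, H.edist (f a) (f b) = G.edist a b) (a b : V) :
    H.dist (f a) (f b) = G.dist a b := by
  rw [SimpleGraph.dist, hd, SimpleGraph.dist]

theorem IsIsometry.injective (hf : IsIsometry K L f) : Function.Injective f :=
  injective_of_edist_eq hf.edist_eq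

theorem IsIsometry.adj_iff (hf : IsIsometry K L f) {a b : V} :
    (skeleton L).Adj (f a) (f b) ↔ (skeleton K).Adj a b :=
  adj_iff_of_edist_eq hf.edist_eq

theorem faceImage_nonempty {s : Finset V} : (faceImage f s).Nonempty ↔ s.Nonempty := by
  classical
  exact Finset.image_nonempty

theorem faceImage_injective (hf : Function.Injective f) : Function.Injective (faceImage f) := by
  classical
  exact Finset.image_injective hf

theorem exists_faceImage_eq {s : Finset V} {t : Finset W} (h : t ⊆ faceImage f s) :
    ∃ r ⊆ s, faceImage f r = t := by
  classical
  exact Finset.subset_image_iff.1 h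

/- Induction on the simplex: the proper subsets of the image of a clique are images of smaller
cliques, hence of faces, and fullness then applies to the image itself. -/
theorem IsIsometry.isFlag (hf : IsIsometry K L f) (hL : IsFlag L) : IsFlag K := by
  intro s
  induction s using Finset.strongInduction with
  | _ s ih =>
  intro hne hs
  by_cases hcard : s.card = 1
  · obtain ⟨a, rfl⟩ := Finset.card_eq_one.1 hcard
    exact K.singleton_mem a
  have hL' : faceImage f s ∈ L.faces := by
    refine hL _ (faceImage_nonempty.2 hne) fun x hx y hy hxy => ?_
    obtain ⟨a, ha, rfl⟩ := mem_faceImage.1 hx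
    obtain ⟨b, hb, rfl⟩ := mem_faceImage.1 hy
    exact hf.adj_iff.2 (hs ha hb fun h => hxy (congrArg f h))
  have hcard' : 2 ≤ (faceImage f s).card := by
    have := hne.card_pos
    have := (congrArg Finset.card (faceImage_eq_map ⟨f, hf.injective⟩ s)).trans (Finset.card_map _)
    simp only [Function.Embedding.coeFn_mk] at this
    omega
  obtain ⟨s', hs', e⟩ := hf.full _ hL' hcard' fun t ht hts => by
    obtain ⟨r, hr, rfl⟩ := exists_faceImage_eq hts.subset
    have hrs : r ⊂ s := hr.ssubset_of_ne fun h => hts.ne (congrArg _ h)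
    exact ⟨r, ih r hrs (faceImage_nonempty.1 ht) (hs.subset (Finset.coe_subset.2 hr)), rfl⟩
  exact faceImage_injective hf.injective e ▸ hs'

theorem isIsometry_of_isFlag (hK : IsFlag K) (hL : IsFlag L)
    (hd : ∀ a b, (skeleton L).edist (f a) (f b) = (skeleton K).edist a b)
    (hc : GeodesicallyConvex (skeleton L) (Set.range f)) : IsIsometry K L f := by
  classical
  have hinj := injective_of_edist_eq hd
  refine ⟨fun s hs => hL _ ?_ ?_, hd, fun t ht h2 hr => ?_, hc⟩
  · exact faceImage_nonempty.2 (K.isRelLowerSet_faces hs).1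
  · intro x hx y hy hxy
    obtain ⟨a, ha, rfl⟩ := mem_faceImage.1 hx
    obtain ⟨b, hb, rfl⟩ := mem_faceImage.1 hy
    exact (adj_iff_of_edist_eq hd).2 (isClique_of_mem_faces hs ha hb fun h => hxy (congrArg f h))
  · have hrange : ↑t ⊆ Set.range f := by
      intro y hy
      have hyt : {y} ⊂ t := (Finset.singleton_subset_iff.2 hy).ssubset_of_ne <| by
        rintro rfl
        simp at h2
      obtain ⟨s, -, hs⟩ := hr {y} (Finset.singleton_nonempty y) hyt
      obtain ⟨a, -, ha⟩ := mem_faceImage.1 (hs ▸ Finset.mem_singleton_self y)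
      exact ⟨a, ha⟩
    obtain ⟨s, -, rfl⟩ := Finset.subset_set_image_iff.1 (Set.image_univ.symm ▸ hrange)
    refine ⟨s, hK s (Finset.image_nonempty.1 (L.isRelLowerSet_faces ht).1) ?_, ?_⟩
    · intro a ha b hb hab
      exact (adj_iff_of_edist_eq hd).1 (isClique_of_mem_faces ht (by simpa using ⟨a, ha, rfl⟩)
        (by simpa using ⟨b, hb, rfl⟩) (hinj.ne hab))
    · ext y
      simp only [mem_faceImage, Finset.mem_image]

theorem skeleton_flagComplex (G : SimpleGraph V) : skeleton (flagComplex G) = G := by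
  classical
  ext a b
  rw [skeleton_adj]
  exact ⟨fun ⟨hne, s, hs, ha, hb⟩ => hs.2 ha hb hne,
    fun h => ⟨h.ne, {a, b}, pair_mem_flagComplex h, by simp, by simp⟩⟩

theorem isFlag_flagComplex (G : SimpleGraph V) : IsFlag (flagComplex G) := by
  intro s hs hc
  rw [skeleton_flagComplex] at hc
  exact ⟨hs, hc⟩

theorem geodesicallyConvex_of_dist {G : SimpleGraph V} {S : Set V}
    (h : ∀ a ∈ S, ∀ b ∈ S, ∀ c, G.Reachable a c → G.Reachable c b →
      G.dist a c + G.dist c b = G.dist a b → c ∈ S) :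
    GeodesicallyConvex G S := by
  classical
  intro a ha b hb p hp c hc
  have hac := SimpleGraph.dist_le (p.takeUntil c hc)
  have hcb := SimpleGraph.dist_le (p.dropUntil c hc)
  have hlen := congrArg SimpleGraph.Walk.length (p.take_spec hc)
  rw [SimpleGraph.Walk.length_append] at hlen
  have htri := (SimpleGraph.Walk.reachable (p.takeUntil c hc)).dist_triangle_left b
  exact h a ha b hb c ⟨p.takeUntil c hc⟩ ⟨p.dropUntil c hc⟩ (by omega)

theorem GeodesicallyConvex.mem_of_dist {G : SimpleGraph V} {S : Set V}
    (hS : GeodesicallyConvex G S) {a b c : V} (ha : a ∈ S) (hb : b ∈ S) (hac : G.Reachable a c)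
    (hcb : G.Reachable c b) (h : G.dist a c + G.dist c b = G.dist a b) : c ∈ S := by
  obtain ⟨p, hp⟩ := hac.exists_walk_length_eq_dist
  obtain ⟨r, hr⟩ := hcb.exists_walk_length_eq_dist
  refine hS a ha b hb (p.append r) (by rw [SimpleGraph.Walk.length_append]; omega) c ?_
  simp

theorem GeodesicallyConvex.mem_of_adj_of_adj {G : SimpleGraph V} {S : Set V}
    (hS : GeodesicallyConvex G S) {a b c : V} (ha : a ∈ S) (hb : b ∈ S) (hne : a ≠ b)
    (hn : ¬ G.Adj a b) (hca : G.Adj c a) (hcb : G.Adj c b) : c ∈ S := by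
  refine hS.mem_of_dist ha hb hca.symm.reachable hcb.reachable ?_
  rw [dist_eq_two_of_adj_of_adj hca hcb hne hn, SimpleGraph.dist_eq_one_iff_adj.2 hca.symm,
    SimpleGraph.dist_eq_one_iff_adj.2 hcb]

theorem IsIsometry.comp {Z : Type w} {M : AbstractSimplicialComplex Z} {g : W → Z}
    (hM : IsFlag M) (hg : IsIsometry L M g) (hf : IsIsometry K L f) : IsIsometry K M (g ∘ f) := by
  refine isIsometry_of_isFlag (hf.isFlag (hg.isFlag hM)) hM
    (fun a b => (hg.edist_eq _ _).trans (hf.edist_eq a b)) (geodesicallyConvex_of_dist ?_)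
  rintro _ ⟨a, rfl⟩ _ ⟨b, rfl⟩ c hac hcb hdist
  obtain ⟨c, rfl⟩ := hg.convex.mem_of_dist ⟨f a, rfl⟩ ⟨f b, rfl⟩ hac hcb hdist
  simp only [Function.comp_apply, reachable_iff_of_edist_eq hg.edist_eq,
    dist_eq_of_edist_eq hg.edist_eq] at hac hcb hdist
  obtain ⟨d, rfl⟩ := hf.convex.mem_of_dist ⟨a, rfl⟩ ⟨b, rfl⟩ hac hcb hdist
  exact ⟨d, rfl⟩

end Isometries

section Tree

variable {W : Type w} {T : SimpleGraph W}

theorem not_adj_of_isTree (hT : T.IsTree) {z a b : W} (ha : T.Adj z a) (hb : T.Adj z b) :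
    ¬ T.Adj a b := by
  intro h
  have hdist := hT.dist_eq_dist_add_one_of_adj z h
  rw [SimpleGraph.dist_eq_one_iff_adj.2 ha, SimpleGraph.dist_eq_one_iff_adj.2 hb] at hdist
  omega

theorem mem_support_of_dist_lt (hT : T.IsTree) {x z c : W} (h : T.Adj z c)
    (hd : T.dist x c < T.dist x z) (r : T.Walk z x) : c ∈ r.support := by
  classical
  obtain ⟨p, hp⟩ := hT.connected.exists_walk_length_eq_dist c x
  have hpath : (SimpleGraph.Walk.cons h p).IsPath := by
    apply SimpleGraph.Walk.isPath_of_length_eq_dist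
    have hxzc := hT.dist_eq_dist_add_one_of_adj x h
    rw [SimpleGraph.Walk.length_cons, hp, SimpleGraph.dist_comm, SimpleGraph.dist_comm (u := z)]
    omega
  have heq : SimpleGraph.Walk.cons h p = r.bypass := congrArg Subtype.val
    ((hT.isAcyclic.subsingleton_path z x).elim ⟨_, hpath⟩ ⟨_, r.bypass_isPath⟩)
  exact r.support_bypass_subset_support (heq ▸ by simp)

theorem eq_of_adj_of_dist_lt (hT : T.IsTree) {x z a b : W} (ha : T.Adj z a) (hb : T.Adj z b)
    (hda : T.dist x a < T.dist x z) (hdb : T.dist x b < T.dist x z) : a = b := by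
  obtain ⟨p, hp, -⟩ := hT.connected.exists_path_of_dist z x
  rw [hT.isAcyclic.eq_snd_of_adj_start hp ha (mem_support_of_dist_lt hT ha hda p),
    hT.isAcyclic.eq_snd_of_adj_start hp hb (mem_support_of_dist_lt hT hb hdb p)]

theorem exists_adj_dist_eq_add_one (hT : T.Connected) {x z : W} (h : x ≠ z) :
    ∃ a, T.Adj z a ∧ T.dist x z = T.dist x a + 1 := by
  obtain ⟨k, hk⟩ := Nat.exists_eq_succ_of_ne_zero fun e => h (hT.dist_eq_zero_iff.1 e)
  obtain ⟨a, ha, hd⟩ := exists_adj_dist_eq hT hk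
  exact ⟨a, ha.symm, by omega⟩

end Tree

/-- The `1`-skeleton of the model wall-tree over `T`, without the parity condition on its vertices:
its vertices are all pairs `(z, n)`, so that it is the disjoint union of the model wall-tree and its
translate by `(z, n) ↦ (z, n + 1)`, and it needs no base point. -/
def wallGraph {W : Type w} (T : SimpleGraph W) : SimpleGraph (W × ℤ) where
  Adj a b := (a.1 = b.1 ∧ (b.2 = a.2 + 2 ∨ a.2 = b.2 + 2)) ∨
    (T.Adj a.1 b.1 ∧ (b.2 = a.2 + 1 ∨ a.2 = b.2 + 1))
  symm := ⟨by
    rintro a b (⟨h, h'⟩ | ⟨h, h'⟩)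
    · exact Or.inl ⟨h.symm, h'.symm⟩
    · exact Or.inr ⟨h.symm, h'.symm⟩⟩
  loopless := ⟨by
    rintro a (⟨-, h⟩ | ⟨h, -⟩)
    · omega
    · exact h.ne rfl⟩

section WallGraph

variable {W : Type w} {T : SimpleGraph W}

theorem wallGraph_adj {a b : W × ℤ} : (wallGraph T).Adj a b ↔
    (a.1 = b.1 ∧ (b.2 = a.2 + 2 ∨ a.2 = b.2 + 2)) ∨
    (T.Adj a.1 b.1 ∧ (b.2 = a.2 + 1 ∨ a.2 = b.2 + 1)) := Iff.rfl

theorem wallGraph_adj_vertical {z : W} {m n : ℤ} (h : n = m + 2 ∨ m = n + 2) :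
    (wallGraph T).Adj (z, m) (z, n) := Or.inl ⟨rfl, h⟩

theorem wallGraph_adj_transverse {z z' : W} {m n : ℤ} (hz : T.Adj z z')
    (h : n = m + 1 ∨ m = n + 1) : (wallGraph T).Adj (z, m) (z', n) := Or.inr ⟨hz, h⟩

theorem not_three_dvd_of_wallGraph_adj {a b : W × ℤ} (h : (wallGraph T).Adj a b) :
    ¬ (3 : ℤ) ∣ a.2 - b.2 := by
  rw [wallGraph_adj] at h
  omega

theorem wallGraph_adj_cases {y b : W × ℤ} (h : (wallGraph T).Adj y b) :
    (b.1 = y.1 ∧ (b.2 = y.2 + 2 ∨ b.2 = y.2 - 2)) ∨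
    (b.1 ≠ y.1 ∧ T.Adj y.1 b.1 ∧ (b.2 = y.2 + 1 ∨ b.2 = y.2 - 1)) := by
  rcases h with ⟨h, h'⟩ | ⟨h, h'⟩
  · exact Or.inl ⟨h.symm, by omega⟩
  · exact Or.inr ⟨h.ne.symm, h, by omega⟩

theorem wallGraph_adj_iff_of_common_neighbor (hT : T.IsTree) {y b x : W × ℤ}
    (hb : (wallGraph T).Adj y b) (hx : (wallGraph T).Adj y x) : (wallGraph T).Adj b x ↔
      (b.1 = y.1 ∧ x.1 ≠ y.1 ∧ b.2 - y.2 = 2 * (x.2 - y.2)) ∨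
      (b.1 ≠ y.1 ∧ x.1 = y.1 ∧ x.2 - y.2 = 2 * (b.2 - y.2)) ∨
      (b.1 ≠ y.1 ∧ b.1 = x.1 ∧ b.2 + x.2 = 2 * y.2) := by
  rcases wallGraph_adj_cases hb with ⟨h1, h2⟩ | ⟨h1, h1', h2⟩ <;>
    rcases wallGraph_adj_cases hx with ⟨h3, h4⟩ | ⟨h3, h3', h4⟩
  · simp only [wallGraph_adj, h1, h3, SimpleGraph.irrefl, ne_eq, not_true_eq_false, false_and,
      and_false, or_false, true_and, iff_false]
    omega
  · simp only [wallGraph_adj, h1, h3, h3', ne_eq, not_true_eq_false, not_false_eq_true, false_and,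
      or_false, true_and, h3.symm, false_or]
    omega
  · simp only [wallGraph_adj, h1, h3, h1'.symm, ne_eq, not_true_eq_false, not_false_eq_true,
      false_and, and_false, or_false, true_and, false_or]
    omega
  · have := not_adj_of_isTree hT h1' h3'
    by_cases hbx : b.1 = x.1
    · simp only [wallGraph_adj, hbx, SimpleGraph.irrefl, h3, ne_eq, not_false_eq_true, false_and,
        and_false, or_false, true_and, false_or]
      omega
    · simp [wallGraph_adj, hbx, h1, h3, this]

theorem exists_common_wallGraph_neighbor {y b c : W × ℤ} (hb : (wallGraph T).Adj y b)
    (hc : (wallGraph T).Adj y c) (hne : b ≠ c) (h3 : (3 : ℤ) ∣ b.2 - c.2) :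
    ∃ x, (wallGraph T).Adj x y ∧ (wallGraph T).Adj x b ∧ (wallGraph T).Adj x c := by
  obtain ⟨z, n⟩ := y
  obtain ⟨z1, b⟩ := b
  obtain ⟨z2, c⟩ := c
  rcases wallGraph_adj_cases hb with ⟨h1, h2⟩ | ⟨h1, h1', h2⟩ <;>
    rcases wallGraph_adj_cases hc with ⟨h3, h4⟩ | ⟨h3, h3', h4⟩ <;> dsimp only at *
  · subst h1 h3
    exfalso
    apply hne
    rw [Prod.mk.injEq]
    exact ⟨rfl, by omega⟩
  · subst h1
    refine ⟨(z2, n + (n - c)), ?_⟩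
    simp only [wallGraph_adj, h3'.symm, h3, false_and, true_and, false_or]
    omega
  · subst h3
    refine ⟨(z1, n + (n - b)), ?_⟩
    simp only [wallGraph_adj, h1'.symm, h1, false_and, true_and, false_or]
    omega
  · refine ⟨(z, n + 2 * (b - n)), ?_⟩
    simp only [wallGraph_adj, h1', h3', h1.symm, h3.symm, false_and, true_and, false_or,
      SimpleGraph.irrefl, or_false]
    omega

theorem common_wallGraph_neighbor_unique (hT : T.IsTree) {y b c x x' : W × ℤ}
    (hb : (wallGraph T).Adj y b) (hc : (wallGraph T).Adj y c) (hne : b ≠ c)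
    (hxy : (wallGraph T).Adj x y) (hxb : (wallGraph T).Adj x b) (hxc : (wallGraph T).Adj x c)
    (hxy' : (wallGraph T).Adj x' y) (hxb' : (wallGraph T).Adj x' b)
    (hxc' : (wallGraph T).Adj x' c) : x = x' := by
  rw [wallGraph_adj_iff_of_common_neighbor hT hxy.symm hb] at hxb
  rw [wallGraph_adj_iff_of_common_neighbor hT hxy.symm hc] at hxc
  rw [wallGraph_adj_iff_of_common_neighbor hT hxy'.symm hb] at hxb'
  rw [wallGraph_adj_iff_of_common_neighbor hT hxy'.symm hc] at hxc'
  have k1 := wallGraph_adj_cases hb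
  have k2 := wallGraph_adj_cases hc
  have k3 := wallGraph_adj_cases hxy.symm
  have k4 := wallGraph_adj_cases hxy'.symm
  rw [Ne, Prod.ext_iff] at hne
  rw [Prod.ext_iff]
  grind

end WallGraph

section LocalEmbedding

variable {V : Type u} {W : Type w} {T : SimpleGraph W} {G : SimpleGraph V} {τ : V → ZMod 3} {q : ℕ}
  {D M : Set (W × ℤ)} {g h : W × ℤ → V}

/-- A map sending the vertices `b` and `c` of a link of the wall-tree to `x` and `y` respects their
colours (the colour of `(z, n)` being `n` modulo `3`), is injective on them, and does not create an
edge between them. -/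
structure IsLinkCompatible (T : SimpleGraph W) (G : SimpleGraph V) (τ : V → ZMod 3)
    (b c : W × ℤ) (x y : V) : Prop where
  color_eq_iff : τ x = τ y ↔ (3 : ℤ) ∣ b.2 - c.2
  eq_of_eq : x = y → b = c
  adj_of_adj : G.Adj x y → (wallGraph T).Adj b c

namespace IsLinkCompatible

variable {b c : W × ℤ} {x y : V}

theorem refl (b : W × ℤ) (x : V) : IsLinkCompatible T G τ b b x x :=
  ⟨by simp, fun _ => rfl, fun h => absurd rfl h.ne⟩

theorem symm (h : IsLinkCompatible T G τ b c x y) : IsLinkCompatible T G τ c b y x :=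
  ⟨by rw [eq_comm, h.color_eq_iff, dvd_sub_comm], fun e => (h.eq_of_eq e.symm).symm,
    fun e => (h.adj_of_adj e.symm).symm⟩

theorem of_adj (hG : IsBuildingGraph G τ) (hbc : (wallGraph T).Adj b c) (hxy : G.Adj x y) :
    IsLinkCompatible T G τ b c x y :=
  ⟨iff_of_false (hG.color hxy) (not_three_dvd_of_wallGraph_adj hbc), fun e => absurd e hxy.ne,
    fun _ => hbc⟩

end IsLinkCompatible

/-- A map on a set `D` of vertices of the wall-tree that is, in the neighbourhood of every vertex
of `D`, an embedding of graphs compatible with the colourings. Only the values of `g` on `D` are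
relevant. -/
structure IsLocalEmbedding (T : SimpleGraph W) (G : SimpleGraph V) (τ : V → ZMod 3)
    (D : Set (W × ℤ)) (g : W × ℤ → V) : Prop where
  adj : ∀ {a b}, a ∈ D → b ∈ D → (wallGraph T).Adj a b → G.Adj (g a) (g b)
  compatible : ∀ {y b c}, y ∈ D → b ∈ D → c ∈ D → (wallGraph T).Adj y b → (wallGraph T).Adj y c →
    IsLinkCompatible T G τ b c (g b) (g c)

/-- `x` is a value at `v` with which the local embedding `g` of `M` extends to `insert v M`. -/
structure IsExtensionValue (T : SimpleGraph W) (G : SimpleGraph V) (τ : V → ZMod 3)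
    (M : Set (W × ℤ)) (g : W × ℤ → V) (v : W × ℤ) (x : V) : Prop where
  adj : ∀ u ∈ M, (wallGraph T).Adj v u → G.Adj x (g u)
  compatible_center : ∀ b ∈ M, ∀ c ∈ M, (wallGraph T).Adj v b → (wallGraph T).Adj v c →
    IsLinkCompatible T G τ b c (g b) (g c)
  compatible_star : ∀ y ∈ M, (wallGraph T).Adj v y → ∀ c ∈ M, (wallGraph T).Adj y c →
    IsLinkCompatible T G τ v c x (g c)

namespace IsLocalEmbedding

theorem mono (hg : IsLocalEmbedding T G τ D g) (hMD : M ⊆ D) : IsLocalEmbedding T G τ M g :=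
  ⟨fun ha hb => hg.adj (hMD ha) (hMD hb), fun hy hb hc => hg.compatible (hMD hy) (hMD hb) (hMD hc)⟩

theorem congr (hg : IsLocalEmbedding T G τ D g) (hgh : Set.EqOn g h D) :
    IsLocalEmbedding T G τ D h where
  adj ha hb hab := hgh ha ▸ hgh hb ▸ hg.adj ha hb hab
  compatible hy hb hc hyb hyc := hgh hb ▸ hgh hc ▸ hg.compatible hy hb hc hyb hyc

theorem insert_iff {v : W × ℤ} (hv : v ∉ M) (hg : IsLocalEmbedding T G τ M g) :
    IsLocalEmbedding T G τ (insert v M) g ↔ IsExtensionValue T G τ M g v (g v) := by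
  have hvM : v ∈ insert v M := Set.mem_insert v M
  have hM : ∀ {u}, u ∈ M → u ∈ insert v M := Set.mem_insert_of_mem v
  refine ⟨fun h => ⟨fun u hu => h.adj hvM (hM hu),
    fun b hb c hc => h.compatible hvM (hM hb) (hM hc),
    fun y hy hvy c hc => h.compatible (hM hy) hvM (hM hc) hvy.symm⟩, fun h => ⟨?_, ?_⟩⟩
  · rintro a b (rfl | ha) (rfl | hb) hab
    · exact absurd rfl hab.ne
    · exact h.adj b hb hab
    · exact (h.adj a ha hab.symm).symm
    · exact hg.adj ha hb hab
  · rintro y b c (rfl | hy) hb hc hyb hyc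
    · exact h.compatible_center b (hb.resolve_left hyb.ne.symm) c (hc.resolve_left hyc.ne.symm)
        hyb hyc
    · rcases hb with rfl | hb <;> rcases hc with rfl | hc
      · exact .refl _ _
      · exact h.compatible_star y hy hyb.symm c hc hyc
      · exact (h.compatible_star y hy hyc.symm b hb hyb).symm
      · exact hg.compatible hy hb hc hyb hyc

end IsLocalEmbedding

theorem IsExtensionValue.congr {v : W × ℤ} {x : V} (hx : IsExtensionValue T G τ M g v x)
    (hgh : Set.EqOn g h M) : IsExtensionValue T G τ M h v x where
  adj u hu := hgh hu ▸ hx.adj u hu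
  compatible_center b hb c hc := hgh hb ▸ hgh hc ▸ hx.compatible_center b hb c hc
  compatible_star y hy hvy c hc := hgh hc ▸ hx.compatible_star y hy hvy c hc

/-- Every vertex of `M` opposite to `v` in the link of a neighbour `y` of `v` is joined in the
link, within `M`, to a common neighbour of `v` and `y`. This forces the images of opposite vertices
to be opposite when `v` is added to `M`. -/
def LinksJoined (T : SimpleGraph W) (M : Set (W × ℤ)) (v : W × ℤ) : Prop :=
  ∀ y ∈ M, (wallGraph T).Adj v y → ∀ c ∈ M, (wallGraph T).Adj y c → ¬ (wallGraph T).Adj v c →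
    ¬ (3 : ℤ) ∣ v.2 - c.2 → ∃ y' ∈ M, ∃ x ∈ M, (wallGraph T).Adj v y' ∧ (wallGraph T).Adj y y' ∧
      (wallGraph T).Adj x y ∧ (wallGraph T).Adj x c ∧ (wallGraph T).Adj x y'

theorem IsLocalEmbedding.color_eq_iff_of_triangle (hG : IsBuildingGraph G τ)
    (hg : IsLocalEmbedding T G τ M g) {v y y' c : W × ℤ} {x : V} (hy : y ∈ M) (hy' : y' ∈ M)
    (hc : c ∈ M) (hvy : (wallGraph T).Adj v y) (hvy' : (wallGraph T).Adj v y')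
    (hyy' : (wallGraph T).Adj y y') (hyc : (wallGraph T).Adj y c) (hxy : G.Adj x (g y))
    (hxy' : G.Adj x (g y')) : τ x = τ (g c) ↔ (3 : ℤ) ∣ v.2 - c.2 := by
  have hcy' := (hg.compatible hy hc hy' hyc hyy').color_eq_iff
  have c1 := not_three_dvd_of_wallGraph_adj hvy
  have c2 := not_three_dvd_of_wallGraph_adj hvy'
  have c3 := not_three_dvd_of_wallGraph_adj hyy'
  have c4 := not_three_dvd_of_wallGraph_adj hyc
  constructor
  · intro h
    have : ¬ (3 : ℤ) ∣ c.2 - y'.2 := by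
      rw [← hcy', ← h]
      exact hG.color hxy'
    omega
  · intro h
    have : ¬ (3 : ℤ) ∣ c.2 - y'.2 := by omega
    rw [← hcy'] at this
    exact hG.color_eq_of_ne (hg.adj hy hy' hyy') hxy.symm (hg.adj hy hc hyc)
      (hG.color hxy').symm (Ne.symm this)

theorem IsExtensionValue.of_linksJoined (hG : IsBuildingGraph G τ)
    (hg : IsLocalEmbedding T G τ M g) {v : W × ℤ} {x : V} (hlink : LinksJoined T M v)
    (hadj : ∀ y ∈ M, (wallGraph T).Adj v y → G.Adj x (g y))
    (hcenter : ∀ b ∈ M, ∀ c ∈ M, (wallGraph T).Adj v b → (wallGraph T).Adj v c →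
      IsLinkCompatible T G τ b c (g b) (g c))
    (hex : ∀ y ∈ M, (wallGraph T).Adj v y → ∃ y' ∈ M, (wallGraph T).Adj v y' ∧
      (wallGraph T).Adj y y')
    (hnew : ∀ y ∈ M, ∀ y' ∈ M, ∀ c ∈ M, (wallGraph T).Adj v y → (wallGraph T).Adj v y' →
      (wallGraph T).Adj y y' → (wallGraph T).Adj c y → (wallGraph T).Adj c y' → g c ≠ x) :
    IsExtensionValue T G τ M g v x := by
  refine ⟨hadj, hcenter, fun y hy hvy c hc hyc => ?_⟩
  have hxy := hadj y hy hvy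
  have hgyc := hg.adj hy hc hyc
  obtain ⟨y', hy', hvy', hyy'⟩ := hex y hy hvy
  have hcol := hg.color_eq_iff_of_triangle hG hy hy' hc hvy hvy' hyy' hyc hxy (hadj y' hy' hvy')
  refine ⟨hcol, ?_, ?_⟩
  · rintro rfl
    have hcy' := (hg.compatible hy hc hy' hyc hyy').adj_of_adj (hadj y' hy' hvy')
    exact absurd rfl (hnew y hy y' hy' c hc hvy hvy' hyy' hyc.symm hcy')
  · intro hxc
    by_contra hvc
    have hc3 : ¬ (3 : ℤ) ∣ v.2 - c.2 := by
      rw [← hcol]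
      exact hG.color hxc
    obtain ⟨y', hy', d, hd, hvy', hyy', hdy, hdc, hdy'⟩ := hlink y hy hvy c hc hyc hvc hc3
    have hcompat := hg.compatible hy hc hy' hyc hyy'
    have hcol' : τ (g c) = τ (g y') := by
      have c1 := not_three_dvd_of_wallGraph_adj hvy
      have c2 := not_three_dvd_of_wallGraph_adj hvy'
      have c3 := not_three_dvd_of_wallGraph_adj hyy'
      have c4 := not_three_dvd_of_wallGraph_adj hyc
      exact hcompat.color_eq_iff.2 (by omega)
    have hne : g c ≠ g y' := fun e => hvc (hcompat.eq_of_eq e ▸ hvy')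
    exact hnew y hy y' hy' d hd hvy hvy' hyy' hdy hdy' (hG.join_unique hgyc hne hcol'
      (hg.adj hd hy hdy) (hg.adj hd hc hdc) (hg.adj hd hy' hdy') hxy hxc (hadj y' hy' hvy'))

end LocalEmbedding

section UniformExtension

variable {V : Type u} {W : Type w} {T : SimpleGraph W} {G : SimpleGraph V} {τ : V → ZMod 3} {q : ℕ}
  {v₀ : V} {D M : Set (W × ℤ)} {g : W × ℤ → V}

/-- The extensions of `g` from `D₀` to a local embedding of `D`, normalized to take the value `v₀`
outside of `D`. -/
def localExtensions (T : SimpleGraph W) (G : SimpleGraph V) (τ : V → ZMod 3) (v₀ : V)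
    (D₀ D : Set (W × ℤ)) (g : W × ℤ → V) : Set (W × ℤ → V) :=
  {h | IsLocalEmbedding T G τ D h ∧ Set.EqOn h g D₀ ∧ ∀ x, x ∉ D → h x = v₀}

/-- Every local embedding of `D₀` has the same finite positive number of extensions to a local
embedding of `D`. -/
def UniformExtension (T : SimpleGraph W) (G : SimpleGraph V) (τ : V → ZMod 3) (v₀ : V)
    (D₀ D : Set (W × ℤ)) : Prop :=
  ∃ N : ℕ, 0 < N ∧ ∀ g, IsLocalEmbedding T G τ D₀ g → (localExtensions T G τ v₀ D₀ D g).encard = N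

open Classical in
theorem localExtensions_insert {v : W × ℤ} (hv : v ∉ M) (hg : IsLocalEmbedding T G τ M g) :
    localExtensions T G τ v₀ M (insert v M) g =
      Function.update (M.piecewise g fun _ => v₀) v '' {x | IsExtensionValue T G τ M g v x} := by
  set k := M.piecewise g fun _ => v₀ with hk
  have hkM : Set.EqOn k g M := M.piecewise_eqOn g _
  have hupdate : ∀ x, Set.EqOn (Function.update k v x) g M := fun x u hu => by
    rw [Function.update_of_ne (ne_of_mem_of_not_mem hu hv), hkM hu]
  ext h
  constructor
  · rintro ⟨hemb, heq, hout⟩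
    refine ⟨h v, (((hg.congr heq.symm).insert_iff hv).1 hemb).congr heq, ?_⟩
    funext u
    by_cases huv : u = v
    · rw [huv, Function.update_self]
    rw [Function.update_of_ne huv]
    by_cases huM : u ∈ M
    · rw [hkM huM, heq huM]
    · rw [hk, Set.piecewise_eq_of_notMem _ _ _ huM, hout u (by simp [huv, huM])]
  · rintro ⟨x, hx, rfl⟩
    refine ⟨((hg.congr (hupdate x).symm).insert_iff hv).2 ?_, hupdate x, fun u hu => ?_⟩
    · rw [Function.update_self]
      exact hx.congr (hupdate x).symm
    · rw [Set.mem_insert_iff, not_or] at hu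
      rw [Function.update_of_ne hu.1, hk, Set.piecewise_eq_of_notMem _ _ _ hu.2]

namespace UniformExtension

theorem refl (D : Set (W × ℤ)) : UniformExtension T G τ v₀ D D := by
  classical
  refine ⟨1, one_pos, fun g hg => ?_⟩
  have hext : localExtensions T G τ v₀ D D g = {D.piecewise g fun _ => v₀} := by
    ext h
    constructor
    · rintro ⟨-, heq, hout⟩
      funext x
      by_cases hx : x ∈ D
      · rw [Set.piecewise_eq_of_mem _ _ _ hx, heq hx]
      · rw [Set.piecewise_eq_of_notMem _ _ _ hx, hout x hx]
    · rintro rfl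
      have heq := D.piecewise_eqOn g fun _ => v₀
      exact ⟨hg.congr heq.symm, heq, fun x hx => Set.piecewise_eq_of_notMem _ _ _ hx⟩
  rw [hext, Set.encard_singleton, Nat.cast_one]

theorem trans {D₀ D₁ D₂ : Set (W × ℤ)} (h₀₁ : D₀ ⊆ D₁) (h₁₂ : D₁ ⊆ D₂)
    (h : UniformExtension T G τ v₀ D₀ D₁) (h' : UniformExtension T G τ v₀ D₁ D₂) :
    UniformExtension T G τ v₀ D₀ D₂ := by
  classical
  obtain ⟨N, hN, h⟩ := h
  obtain ⟨N', hN', h'⟩ := h'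
  refine ⟨N * N', Nat.mul_pos hN hN', fun g hg => ?_⟩
  have hext : localExtensions T G τ v₀ D₀ D₂ g =
      ⋃ k ∈ localExtensions T G τ v₀ D₀ D₁ g, localExtensions T G τ v₀ D₁ D₂ k := by
    ext f
    simp only [Set.mem_iUnion, exists_prop]
    constructor
    · rintro ⟨hf, heq, hout⟩
      have hpw := D₁.piecewise_eqOn f fun _ => v₀
      exact ⟨D₁.piecewise f fun _ => v₀, ⟨(hf.mono h₁₂).congr hpw.symm, (hpw.mono h₀₁).trans heq,
        fun x hx => Set.piecewise_eq_of_notMem _ _ _ hx⟩, hf, hpw.symm, hout⟩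
    · rintro ⟨k, ⟨-, hkg, -⟩, hf, hfk, hout⟩
      exact ⟨hf, (hfk.mono h₀₁).trans hkg, hout⟩
  rw [hext]
  refine encard_biUnion_eq_mul (h g hg) (fun k hk => h' k hk.1) ?_
  refine fun k hk k' hk' hne => Set.disjoint_left.2 fun f hf hf' => hne ?_
  funext x
  by_cases hx : x ∈ D₁
  · exact (hf.2.1 hx).symm.trans (hf'.2.1 hx)
  · rw [hk.2.2 x hx, hk'.2.2 x hx]

theorem insert_of_encard {v : W × ℤ} (hv : v ∉ M) {N : ℕ} (hN : 0 < N)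
    (h : ∀ g, IsLocalEmbedding T G τ M g → {x | IsExtensionValue T G τ M g v x}.encard = N) :
    UniformExtension T G τ v₀ M (insert v M) := by
  classical
  refine ⟨N, hN, fun g hg => ?_⟩
  rw [localExtensions_insert hv hg, (Function.update_injective _ v).encard_image, h g hg]

theorem insert_of_neighbor_isolated (hG : IsRegularBuildingGraph G τ q) {v y : W × ℤ}
    (hv : v ∉ M) (hy : y ∈ M) (hvM : ∀ u ∈ M, (wallGraph T).Adj v u ↔ u = y)
    (hyM : ∀ u ∈ M, ¬ (wallGraph T).Adj y u) : UniformExtension T G τ v₀ M (insert v M) := by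
  refine insert_of_encard hv (N := 2 * (q ^ 2 + q + 1)) (by positivity) fun g _ => ?_
  rw [← hG.encard_neighborSet (g y)]
  congr 1
  ext x
  refine ⟨fun h => (h.adj y hy ((hvM y hy).2 rfl)).symm, fun h => ⟨?_, ?_, ?_⟩⟩
  · intro u hu hvu
    rw [(hvM u hu).1 hvu]
    exact SimpleGraph.Adj.symm h
  · intro b hb c hc hvb hvc
    rw [(hvM b hb).1 hvb, (hvM c hc).1 hvc]
    exact .refl _ _
  · intro u hu hvu c hc huc
    rw [(hvM u hu).1 hvu] at huc
    exact absurd huc (hyM c hc)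

theorem insert_opposite (hG : IsRegularBuildingGraph G τ q) {v y c : W × ℤ}
    (hv : v ∉ M) (hy : y ∈ M) (hc : c ∈ M) (hvM : ∀ u ∈ M, (wallGraph T).Adj v u ↔ u = y)
    (hyM : ∀ u ∈ M, (wallGraph T).Adj y u ↔ u = c) (h3 : ¬ (3 : ℤ) ∣ v.2 - c.2) :
    UniformExtension T G τ v₀ M (insert v M) := by
  have hq := hG.two_le
  refine insert_of_encard hv (N := q ^ 2) (by positivity) fun g hg => ?_
  have hyc := (hyM c hc).2 rfl
  have hvy := (hvM y hy).2 rfl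
  have hvc : ¬ (wallGraph T).Adj v c := fun h => hyc.ne ((hvM c hc).1 h).symm
  rw [← hG.encard_opposite (hg.adj hy hc hyc)]
  congr 1
  ext x
  constructor
  · intro h
    have hcompat := h.compatible_star y hy hvy c hc hyc
    exact ⟨(h.adj y hy hvy).symm, fun e => h3 (hcompat.color_eq_iff.1 e),
      fun e => hvc (hcompat.adj_of_adj e)⟩
  · rintro ⟨hyx, hcol, hxc⟩
    refine ⟨?_, ?_, ?_⟩
    · intro u hu hvu
      rw [(hvM u hu).1 hvu]
      exact hyx.symm
    · intro b hb d hd hvb hvd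
      rw [(hvM b hb).1 hvb, (hvM d hd).1 hvd]
      exact .refl _ _
    · intro u hu hvu d hd hud
      rw [(hvM u hu).1 hvu] at hud
      rw [(hyM d hd).1 hud]
      exact ⟨iff_of_false hcol h3, fun e => absurd (congrArg τ e) hcol, fun e => absurd e hxc⟩

theorem setOf_isExtensionValue_edge (hG : IsBuildingGraph G τ) (hg : IsLocalEmbedding T G τ M g)
    {v y y' : W × ℤ} (hv : v ∉ M) (hy : y ∈ M) (hy' : y' ∈ M) (hyy' : (wallGraph T).Adj y y')
    (hvM : ∀ u ∈ M, (wallGraph T).Adj v u ↔ u = y ∨ u = y') (hlink : LinksJoined T M v) :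
    {x | IsExtensionValue T G τ M g v x} =
      G.commonNeighbors (g y) (g y') \ g '' ((wallGraph T).commonNeighbors y y' ∩ M) := by
  have hvy := (hvM y hy).2 (Or.inl rfl)
  have hvy' := (hvM y' hy').2 (Or.inr rfl)
  ext x
  constructor
  · intro h
    refine ⟨⟨(h.adj y hy hvy).symm, (h.adj y' hy' hvy').symm⟩, ?_⟩
    rintro ⟨c, hc, rfl⟩
    exact hv ((h.compatible_star y hy hvy c hc.2 hc.1.1).eq_of_eq rfl ▸ hc.2)
  · rintro ⟨⟨hyx, hy'x⟩, hnew⟩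
    refine .of_linksJoined hG hg hlink ?_ ?_ ?_ ?_
    · intro u hu hvu
      rcases (hvM u hu).1 hvu with rfl | rfl
      exacts [hyx.symm, hy'x.symm]
    · intro b hb c hc hvb hvc
      rcases (hvM b hb).1 hvb with rfl | rfl <;> rcases (hvM c hc).1 hvc with rfl | rfl
      · exact .refl _ _
      · exact .of_adj hG hyy' (hg.adj hb hc hyy')
      · exact .of_adj hG hyy'.symm (hg.adj hb hc hyy'.symm)
      · exact .refl _ _
    · intro u hu hvu
      rcases (hvM u hu).1 hvu with rfl | rfl
      · exact ⟨y', hy', hvy', hyy'⟩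
      · exact ⟨y, hy, hvy, hyy'.symm⟩
    · rintro a ha b hb c hc hva hvb hab hca hcb rfl
      refine hnew ⟨c, ⟨?_, hc⟩, rfl⟩
      rcases (hvM a ha).1 hva with rfl | rfl <;> rcases (hvM b hb).1 hvb with rfl | rfl
      · exact absurd rfl hab.ne
      · exact ⟨hca.symm, hcb.symm⟩
      · exact ⟨hcb.symm, hca.symm⟩
      · exact absurd rfl hab.ne

theorem insert_edge (hG : IsRegularBuildingGraph G τ q) {v y y' : W × ℤ}
    (hdeg : ((wallGraph T).commonNeighbors y y').encard ≤ ((q + 1 : ℕ) : ℕ∞))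
    (hv : v ∉ M) (hy : y ∈ M) (hy' : y' ∈ M) (hyy' : (wallGraph T).Adj y y')
    (hvM : ∀ u ∈ M, (wallGraph T).Adj v u ↔ u = y ∨ u = y') (hlink : LinksJoined T M v) :
    UniformExtension T G τ v₀ M (insert v M) := by
  set C := (wallGraph T).commonNeighbors y y' ∩ M
  have hCfin : C.Finite := (Set.finite_of_encard_le_coe hdeg).subset Set.inter_subset_left
  have hlt : C.ncard < q + 1 := by
    have hssub : C ⊂ (wallGraph T).commonNeighbors y y' :=
      ⟨Set.inter_subset_left, fun h =>
        hv (h ⟨((hvM y hy).2 (Or.inl rfl)).symm, ((hvM y' hy').2 (Or.inr rfl)).symm⟩).2⟩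
    have hlt := (hCfin.encard_lt_encard hssub).trans_le hdeg
    rw [← hCfin.cast_ncard_eq] at hlt
    exact_mod_cast hlt
  refine insert_of_encard hv (N := q + 1 - C.ncard) (by omega) fun g hg => ?_
  have hinj : Set.InjOn g C := fun a ha b hb =>
    (hg.compatible hy ha.2 hb.2 ha.1.1 hb.1.1).eq_of_eq
  have hsub : g '' C ⊆ G.commonNeighbors (g y) (g y') := by
    rintro _ ⟨a, ha, rfl⟩
    exact ⟨hg.adj hy ha.2 ha.1.1, hg.adj hy' ha.2 ha.1.2⟩
  rw [setOf_isExtensionValue_edge hG.toIsBuildingGraph hg hv hy hy' hyy' hvM hlink,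
    Set.encard_sdiff hsub (hCfin.image g), hinj.encard_image, hG.encard_common (hg.adj hy hy' hyy'),
    ← hCfin.cast_ncard_eq, ENat.natCast_sub]

theorem isExtensionValue_path (hT : T.IsTree) (hG : IsBuildingGraph G τ)
    (hg : IsLocalEmbedding T G τ M g) {v y₁ y₂ y₃ : W × ℤ} {x : V} (hv : v ∉ M) (hy₁ : y₁ ∈ M)
    (hy₂ : y₂ ∈ M) (hy₃ : y₃ ∈ M) (h12 : (wallGraph T).Adj y₂ y₁) (h23 : (wallGraph T).Adj y₂ y₃)
    (h13 : ¬ (wallGraph T).Adj y₁ y₃) (hne : y₁ ≠ y₃)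
    (hvM : ∀ u ∈ M, (wallGraph T).Adj v u ↔ u = y₁ ∨ u = y₂ ∨ u = y₃) (hlink : LinksJoined T M v)
    (hx₁ : G.Adj x (g y₁)) (hx₂ : G.Adj x (g y₂)) (hx₃ : G.Adj x (g y₃)) :
    IsExtensionValue T G τ M g v x := by
  have hv1 := (hvM y₁ hy₁).2 (by simp)
  have hv2 := (hvM y₂ hy₂).2 (by simp)
  have hv3 := (hvM y₃ hy₃).2 (by simp)
  have hneighbor : ∀ b ∈ M, (wallGraph T).Adj v b → b = y₂ ∨ (wallGraph T).Adj y₂ b := by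
    intro b hb hvb
    rcases (hvM b hb).1 hvb with rfl | rfl | rfl
    exacts [Or.inr h12, Or.inl rfl, Or.inr h23]
  refine .of_linksJoined hG hg hlink ?_ ?_ ?_ ?_
  · intro u hu hvu
    rcases (hvM u hu).1 hvu with rfl | rfl | rfl
    exacts [hx₁, hx₂, hx₃]
  · intro b hb c hc hvb hvc
    rcases hneighbor b hb hvb with rfl | hyb <;> rcases hneighbor c hc hvc with rfl | hyc
    · exact .refl _ _
    · exact .of_adj hG hyc (hg.adj hb hc hyc)
    · exact .of_adj hG hyb.symm (hg.adj hb hc hyb.symm)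
    · exact hg.compatible hy₂ hb hc hyb hyc
  · intro u hu hvu
    rcases (hvM u hu).1 hvu with rfl | rfl | rfl
    · exact ⟨y₂, hy₂, hv2, h12.symm⟩
    · exact ⟨y₁, hy₁, hv1, h12⟩
    · exact ⟨y₂, hy₂, hv2, h23.symm⟩
  · rintro a ha b hb c hc hva hvb hab hca hcb rfl
    have hc2 : (wallGraph T).Adj y₂ c := by
      rcases (hvM a ha).1 hva with rfl | rfl | rfl
      · rcases (hvM b hb).1 hvb with rfl | rfl | rfl
        exacts [absurd rfl hab.ne, hcb.symm, absurd hab h13]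
      · exact hca.symm
      · rcases (hvM b hb).1 hvb with rfl | rfl | rfl
        exacts [absurd hab.symm h13, hcb.symm, absurd rfl hab.ne]
    have hc1 := (hg.compatible hy₂ hc hy₁ hc2 h12).adj_of_adj hx₁
    have hc3 := (hg.compatible hy₂ hc hy₃ hc2 h23).adj_of_adj hx₃
    exact hv (common_wallGraph_neighbor_unique hT h12 h23 hne hv2 hv1 hv3 hc2.symm hc1 hc3 ▸ hc)

theorem insert_path (hT : T.IsTree) (hG : IsBuildingGraph G τ)
    {v y₁ y₂ y₃ : W × ℤ} (hv : v ∉ M) (hy₁ : y₁ ∈ M) (hy₂ : y₂ ∈ M) (hy₃ : y₃ ∈ M)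
    (h12 : (wallGraph T).Adj y₂ y₁) (h23 : (wallGraph T).Adj y₂ y₃) (hne : y₁ ≠ y₃)
    (hvM : ∀ u ∈ M, (wallGraph T).Adj v u ↔ u = y₁ ∨ u = y₂ ∨ u = y₃) (hlink : LinksJoined T M v) :
    UniformExtension T G τ v₀ M (insert v M) := by
  have hv1 := (hvM y₁ hy₁).2 (by simp)
  have hv2 := (hvM y₂ hy₂).2 (by simp)
  have hv3 := (hvM y₃ hy₃).2 (by simp)
  have h3 : (3 : ℤ) ∣ y₁.2 - y₃.2 := by
    have := not_three_dvd_of_wallGraph_adj hv1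
    have := not_three_dvd_of_wallGraph_adj hv2
    have := not_three_dvd_of_wallGraph_adj hv3
    have := not_three_dvd_of_wallGraph_adj h12
    have := not_three_dvd_of_wallGraph_adj h23
    omega
  have h13 : ¬ (wallGraph T).Adj y₁ y₃ := fun h => not_three_dvd_of_wallGraph_adj h h3
  refine insert_of_encard hv (N := 1) one_pos fun g hg => ?_
  have hcompat := hg.compatible hy₂ hy₁ hy₃ h12 h23
  have hcol := hcompat.color_eq_iff.2 h3
  have hgne : g y₁ ≠ g y₃ := fun h => hne (hcompat.eq_of_eq h)
  have g12 := hg.adj hy₂ hy₁ h12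
  obtain ⟨x₀, hx₂, hx₁, hx₃⟩ := hG.exists_join g12 (hg.adj hy₂ hy₃ h23) hcol
  rw [Nat.cast_one, Set.encard_eq_one]
  refine ⟨x₀, Set.eq_singleton_iff_unique_mem.2 ⟨isExtensionValue_path hT hG hg hv hy₁ hy₂ hy₃ h12
    h23 h13 hne hvM hlink hx₁ hx₂ hx₃, fun x hx => ?_⟩⟩
  exact hG.join_unique g12 hgne hcol (hx.adj y₂ hy₂ hv2) (hx.adj y₁ hy₁ hv1) (hx.adj y₃ hy₃ hv3)
    hx₂ hx₁ hx₃

end UniformExtension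

end UniformExtension

section Insertion

variable {V : Type u} {W : Type w} {T : SimpleGraph W} {G : SimpleGraph V} {τ : V → ZMod 3} {q : ℕ}
  {v₀ : V} {M : Set (W × ℤ)}

theorem UniformExtension.of_rank {Y Z : Set (W × ℤ)} (hYZ : Y ⊆ Z) (hZ : Z.Finite) (r : W × ℤ → ℤ)
    (h : ∀ M v, Y ⊆ M → M ⊆ Z → v ∈ Z → v ∉ M → (∀ u ∈ M, u ∉ Y → r u ≤ r v) →
      UniformExtension T G τ v₀ M (insert v M)) : UniformExtension T G τ v₀ Y Z := by
  suffices key : ∀ n M, Y ⊆ M → M ⊆ Z → (Z \ M).ncard = n →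
      (∀ u ∈ M, u ∉ Y → ∀ x ∈ Z \ M, r u ≤ r x) → UniformExtension T G τ v₀ M Z from
    key _ Y subset_rfl hYZ rfl fun u hu hn => absurd hu hn
  have hfin : ∀ M, (Z \ M).Finite := fun M => hZ.subset Set.sdiff_subset
  intro n
  induction n with
  | zero =>
    intro M _ hMZ hcard _
    rw [Set.ncard_eq_zero (hfin M), Set.sdiff_eq_empty] at hcard
    exact hMZ.antisymm hcard ▸ .refl _
  | succ n ih =>
    intro M hYM hMZ hcard hrank
    have hne : (Z \ M).Nonempty := by
      rw [← Set.ncard_pos (hfin M)]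
      omega
    obtain ⟨v, hv, hmin⟩ := Set.exists_min_image (Z \ M) r (hfin M) hne
    have hMv := Set.subset_insert v M
    have hvZ : insert v M ⊆ Z := Set.insert_subset hv.1 hMZ
    refine (h M v hYM hMZ hv.1 hv.2 fun u hu huY => hrank u hu huY v hv).trans hMv hvZ
      (ih _ (hYM.trans hMv) hvZ ?_ ?_)
    · have := Set.ncard_sdiff_singleton_of_mem hv
      rw [Set.sdiff_sdiff, Set.union_singleton] at this
      omega
    · rintro u hu huY x ⟨hxZ, hxv⟩
      have hx : x ∈ Z \ M := ⟨hxZ, fun hxM => hxv (hMv hxM)⟩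
      rcases hu with rfl | hu
      exacts [hmin x hx, hrank u hu huY x hx]

theorem UniformExtension.insert_of_adj_imp_path (hT : T.IsTree) (hG : IsRegularBuildingGraph G τ q)
    {v y₁ y₂ y₃ : W × ℤ}
    (hdeg : ((wallGraph T).commonNeighbors y₁ y₂).encard ≤ ((q + 1 : ℕ) : ℕ∞)) (hv : v ∉ M)
    (hy₁ : y₁ ∈ M) (hy₂ : y₂ ∈ M) (hv₁ : (wallGraph T).Adj v y₁) (hv₂ : (wallGraph T).Adj v y₂)
    (hv₃ : (wallGraph T).Adj v y₃) (h12 : (wallGraph T).Adj y₁ y₂) (h23 : (wallGraph T).Adj y₂ y₃)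
    (hne : y₁ ≠ y₃)
    (hvM : ∀ u ∈ M, (wallGraph T).Adj v u → u = y₁ ∨ u = y₂ ∨ u = y₃) (hlink : LinksJoined T M v) :
    UniformExtension T G τ v₀ M (insert v M) := by
  by_cases hy₃ : y₃ ∈ M
  · refine insert_path hT hG.toIsBuildingGraph hv hy₁ hy₂ hy₃ h12.symm h23 hne
      (fun u hu => ⟨hvM u hu, ?_⟩) hlink
    rintro (rfl | rfl | rfl)
    exacts [hv₁, hv₂, hv₃]
  · refine insert_edge hG hdeg hv hy₁ hy₂ h12 (fun u hu => ⟨fun hvu => ?_, ?_⟩) hlink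
    · rcases hvM u hu hvu with rfl | rfl | rfl
      exacts [Or.inl rfl, Or.inr rfl, absurd hu hy₃]
    · rintro (rfl | rfl)
      exacts [hv₁, hv₂]

theorem UniformExtension.insert_of_neighbor_subsingleton (hG : IsRegularBuildingGraph G τ q)
    {v y : W × ℤ} (hv : v ∉ M) (hy : y ∈ M) (hvM : ∀ u ∈ M, (wallGraph T).Adj v u ↔ u = y)
    (hyM : ∀ c ∈ M, ∀ c' ∈ M, (wallGraph T).Adj y c → (wallGraph T).Adj y c' → c = c')
    (h3 : ∀ c ∈ M, (wallGraph T).Adj y c → ¬ (3 : ℤ) ∣ v.2 - c.2) :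
    UniformExtension T G τ v₀ M (insert v M) := by
  by_cases hex : ∃ c ∈ M, (wallGraph T).Adj y c
  · obtain ⟨c, hc, hyc⟩ := hex
    exact insert_opposite hG hv hy hc hvM
      (fun u hu => ⟨fun hyu => hyM u hu c hc hyu hyc, fun huc => huc ▸ hyc⟩) (h3 c hc hyc)
  · push Not at hex
    exact insert_of_neighbor_isolated hG hv hy hvM hex

theorem linksJoined_of_forall_sign {x : W} {m : ℤ}
    (hvertical : ∀ e : ℤ, e = 1 ∨ e = -1 → (x, m + 2 * e) ∈ M → (x, m + 4 * e) ∈ M →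
      ∃ z, T.Adj x z ∧ (z, m + e) ∈ M ∧ (z, m + 3 * e) ∈ M)
    (htransverse : ∀ e : ℤ, e = 1 ∨ e = -1 → ∀ z d, T.Adj x z → T.Adj z d → d ≠ x →
      (z, m + e) ∈ M → (d, m + 2 * e) ∈ M →
      (x, m + 2 * e) ∈ M ∧ (z, m + 3 * e) ∈ M ∨ (z, m - e) ∈ M ∧ (d, m) ∈ M) :
    LinksJoined T M (x, m) := by
  rintro ⟨z, n⟩ hy hvy ⟨d, k⟩ hc hyc hvc h3
  rw [wallGraph_adj, not_or, not_and, not_and] at hvc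
  dsimp only at hvc h3
  rcases hvy with ⟨rfl, hn⟩ | ⟨hxz, hn⟩ <;> rcases hyc with ⟨rfl, hk⟩ | ⟨hzd, hk⟩ <;>
    dsimp only at *
  · obtain ⟨e, he, rfl⟩ : ∃ e : ℤ, (e = 1 ∨ e = -1) ∧ n = m + 2 * e := by
      rcases hn with rfl | rfl
      exacts [⟨1, by omega⟩, ⟨-1, by omega⟩]
    obtain rfl : k = m + 4 * e := by omega
    obtain ⟨z, hxz, hz₁, hz₃⟩ := hvertical e he hy hc
    exact ⟨_, hz₁, _, hz₃, wallGraph_adj_transverse hxz (by omega),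
      wallGraph_adj_transverse hxz (by omega), wallGraph_adj_transverse hxz.symm (by omega),
      wallGraph_adj_transverse hxz.symm (by omega), wallGraph_adj_vertical (by omega)⟩
  · exact absurd (hvc.2 hzd) (by omega)
  · exact absurd (hvc.2 hxz) (by omega)
  · by_cases hdx : d = x
    · exact absurd (hvc.1 hdx.symm) (by omega)
    obtain ⟨e, he, rfl⟩ : ∃ e : ℤ, (e = 1 ∨ e = -1) ∧ n = m + e := by
      rcases hn with rfl | rfl
      exacts [⟨1, by omega⟩, ⟨-1, by omega⟩]
    obtain rfl : k = m + 2 * e := by omega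
    rcases htransverse e he z d hxz hzd hdx hy hc with ⟨h₁, h₂⟩ | ⟨h₁, h₂⟩
    · exact ⟨_, h₁, _, h₂, wallGraph_adj_vertical (by omega),
        wallGraph_adj_transverse hxz.symm (by omega), wallGraph_adj_vertical (by omega),
        wallGraph_adj_transverse hzd (by omega), wallGraph_adj_transverse hxz.symm (by omega)⟩
    · exact ⟨_, h₁, _, h₂, wallGraph_adj_transverse hxz (by omega),
        wallGraph_adj_vertical (by omega), wallGraph_adj_transverse hzd.symm (by omega),
        wallGraph_adj_vertical (by omega), wallGraph_adj_transverse hzd.symm (by omega)⟩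

theorem encard_commonNeighbors_wallGraph_le (hT : T.IsTree) (hq : 1 ≤ q)
    (hdeg : ∀ z, (T.neighborSet z).encard = ((q + 1 : ℕ) : ℕ∞)) {y y' : W × ℤ}
    (h : (wallGraph T).Adj y y') :
    ((wallGraph T).commonNeighbors y y').encard ≤ ((q + 1 : ℕ) : ℕ∞) := by
  have hcommon : ∀ x ∈ (wallGraph T).commonNeighbors y y',
      (x.1 = y.1 ∧ y'.1 ≠ y.1 ∧ x.2 - y.2 = 2 * (y'.2 - y.2)) ∨
      (x.1 ≠ y.1 ∧ y'.1 = y.1 ∧ y'.2 - y.2 = 2 * (x.2 - y.2)) ∨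
      (x.1 ≠ y.1 ∧ x.1 = y'.1 ∧ x.2 + y'.2 = 2 * y.2) := fun x hx =>
    (wallGraph_adj_iff_of_common_neighbor hT hx.1 h).1 (SimpleGraph.Adj.symm hx.2)
  by_cases hz : y'.1 = y.1
  · rw [← hdeg y.1]
    refine Set.encard_le_encard_of_injOn (f := Prod.fst) (fun x hx => ?_) fun x hx x' hx' e => ?_
    · have := hcommon x hx
      rcases wallGraph_adj_cases hx.1 with hfst | hfst
      · grind
      · exact hfst.2.1
    · have := hcommon x hx
      have := hcommon x' hx'
      exact Prod.ext e (by grind)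
  · have hsub : (wallGraph T).commonNeighbors y y' ⊆
        {(y.1, y.2 + 2 * (y'.2 - y.2)), (y'.1, 2 * y.2 - y'.2)} := by
      intro x hx
      have := hcommon x hx
      simp only [Set.mem_insert_iff, Set.mem_singleton_iff, Prod.ext_iff]
      grind
    calc _ ≤ _ := Set.encard_le_encard hsub
      _ ≤ _ := Set.encard_insert_le _ _
      _ = ((2 : ℕ) : ℕ∞) := by rw [Set.encard_singleton]; rfl
      _ ≤ _ := by exact_mod_cast (by omega : 2 ≤ q + 1)

end Insertion

section Reflection

variable {V : Type u} {W : Type w} {T : SimpleGraph W} {G : SimpleGraph V} {τ : V → ZMod 3}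
  {v₀ : V}

/-- The reflection of the wall-tree in its base. -/
def wallFlip (a : W × ℤ) : W × ℤ := (a.1, -a.2)

theorem wallFlip_involutive : Function.Involutive (wallFlip (W := W)) :=
  fun a => Prod.ext rfl (neg_neg a.2)

theorem preimage_wallFlip_preimage (D : Set (W × ℤ)) : wallFlip ⁻¹' (wallFlip ⁻¹' D) = D := by
  rw [← Set.preimage_comp, wallFlip_involutive.comp_self, Set.preimage_id]

theorem wallGraph_adj_wallFlip {a b : W × ℤ} :
    (wallGraph T).Adj (wallFlip a) (wallFlip b) ↔ (wallGraph T).Adj a b := by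
  have h2 : (-b.2 = -a.2 + 2 ∨ -a.2 = -b.2 + 2) ↔ (b.2 = a.2 + 2 ∨ a.2 = b.2 + 2) := by omega
  have h1 : (-b.2 = -a.2 + 1 ∨ -a.2 = -b.2 + 1) ↔ (b.2 = a.2 + 1 ∨ a.2 = b.2 + 1) := by omega
  simp only [wallGraph_adj, wallFlip, h1, h2]

theorem IsLinkCompatible.of_wallFlip {b c : W × ℤ} {x y : V}
    (h : IsLinkCompatible T G τ (wallFlip b) (wallFlip c) x y) :
    IsLinkCompatible T G τ b c x y where
  color_eq_iff := by
    rw [h.color_eq_iff, dvd_sub_comm]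
    simp only [wallFlip, sub_neg_eq_add, neg_add_eq_sub]
  eq_of_eq e := wallFlip_involutive.injective (h.eq_of_eq e)
  adj_of_adj e := wallGraph_adj_wallFlip.1 (h.adj_of_adj e)

theorem IsLocalEmbedding.comp_wallFlip {D : Set (W × ℤ)} {g : W × ℤ → V}
    (hg : IsLocalEmbedding T G τ D g) :
    IsLocalEmbedding T G τ (wallFlip ⁻¹' D) (g ∘ wallFlip) where
  adj ha hb hab := hg.adj ha hb (wallGraph_adj_wallFlip.2 hab)
  compatible hy hb hc hyb hyc := .of_wallFlip <|
    hg.compatible hy hb hc (wallGraph_adj_wallFlip.2 hyb) (wallGraph_adj_wallFlip.2 hyc)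

theorem comp_wallFlip_mem_localExtensions {D₀ D : Set (W × ℤ)} {g k : W × ℤ → V}
    (hk : k ∈ localExtensions T G τ v₀ D₀ D g) :
    k ∘ wallFlip ∈
      localExtensions T G τ v₀ (wallFlip ⁻¹' D₀) (wallFlip ⁻¹' D) (g ∘ wallFlip) :=
  ⟨hk.1.comp_wallFlip, fun _ hx => hk.2.1 hx, fun _ hx => hk.2.2 _ hx⟩

theorem UniformExtension.of_wallFlip {D₀ D : Set (W × ℤ)}
    (h : UniformExtension T G τ v₀ (wallFlip ⁻¹' D₀) (wallFlip ⁻¹' D)) :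
    UniformExtension T G τ v₀ D₀ D := by
  obtain ⟨N, hN, h⟩ := h
  refine ⟨N, hN, fun g hg => ?_⟩
  have hcomp : ∀ k : W × ℤ → V, (k ∘ wallFlip) ∘ wallFlip = k := fun k => by
    rw [Function.comp_assoc, wallFlip_involutive.comp_self, Function.comp_id]
  have hinj : Function.Injective fun k : W × ℤ → V => k ∘ wallFlip :=
    Function.Involutive.injective hcomp
  rw [← h _ hg.comp_wallFlip, ← hinj.encard_image]
  congr 1
  ext k
  refine ⟨?_, fun hk => ⟨k ∘ wallFlip, ?_, hcomp k⟩⟩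
  · rintro ⟨k, hk, rfl⟩
    exact comp_wallFlip_mem_localExtensions hk
  · simpa only [preimage_wallFlip_preimage, hcomp] using comp_wallFlip_mem_localExtensions hk

end Reflection

section DoubleCone

variable {W : Type w} {T : SimpleGraph W} {o : W} {S S' : Set W} {p t p' t' : W × ℤ}

theorem two_dvd_dist_add_dist_add_dist (hT : T.IsTree) (o p z : W) :
    2 ∣ T.dist o z + T.dist o p + T.dist p z := by
  obtain ⟨r⟩ := hT.connected.preconnected z p
  induction r with
  | nil =>
    rw [SimpleGraph.dist_self]
    omega
  | @cons a b c h _ ih =>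
    have := hT.dist_eq_dist_add_one_of_adj o h
    have := hT.dist_eq_dist_add_one_of_adj c h
    omega

/-- The part over `S` of the intersection of the upper cone of `p` with the lower cone of `t` in the
wall-tree over `T` with base point `o`. The finite convex subsets of the wall-tree are of this
form. -/
def doubleCone (T : SimpleGraph W) (o : W) (S : Set W) (p t : W × ℤ) : Set (W × ℤ) :=
  {a | a.1 ∈ S ∧ (a.2 - T.dist o a.1) % 2 = 0 ∧ p.2 + T.dist p.1 a.1 ≤ a.2 ∧
    a.2 + T.dist t.1 a.1 ≤ t.2}

theorem doubleCone_mono (hT : T.Connected) (hS : S ⊆ S') (hp : p'.2 + T.dist p'.1 p.1 ≤ p.2)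
    (ht : t.2 + T.dist t'.1 t.1 ≤ t'.2) : doubleCone T o S p t ⊆ doubleCone T o S' p' t' := by
  rintro a ⟨haS, hpar, hpa, hat⟩
  have := hT.dist_triangle (u := p'.1) (v := p.1) (w := a.1)
  have := hT.dist_triangle (u := t'.1) (v := t.1) (w := a.1)
  exact ⟨hS haS, hpar, by omega, by omega⟩

theorem preimage_wallFlip_doubleCone :
    wallFlip ⁻¹' doubleCone T o S p t = doubleCone T o S (wallFlip t) (wallFlip p) := by
  ext ⟨x, m⟩
  simp only [doubleCone, wallFlip, Set.mem_preimage, Set.mem_ofPred_eq]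
  refine and_congr_right fun _ => ?_
  omega

/-- `S` contains the geodesics of the tree `T` between its members. -/
def TreeConvex (T : SimpleGraph W) (S : Set W) : Prop :=
  ∀ x ∈ S, ∀ z ∈ S, ∀ c, T.Adj z c → T.dist x c < T.dist x z → c ∈ S

namespace TreeConvex

variable {x z c : W}

theorem dist_eq_of_notMem (hS : TreeConvex T S) (hT : T.IsTree) (hx : x ∈ S) (hz : z ∈ S)
    (hzc : T.Adj z c) (hc : c ∉ S) : T.dist x c = T.dist x z + 1 := by
  rcases hT.dist_eq_dist_add_one_of_adj x hzc with h | h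
  · exact absurd (hS x hx z hz c hzc (by omega)) hc
  · exact h

theorem eq_of_adj_of_notMem (hS : TreeConvex T S) (hT : T.IsTree) (hx : x ∈ S) (hz : z ∈ S)
    (hzc : T.Adj z c) (hcx : T.Adj c x) (hc : c ∉ S) : x = z := by
  have h1 := hS.dist_eq_of_notMem hT hx hz hzc hc
  rw [SimpleGraph.dist_eq_one_iff_adj.2 hcx.symm] at h1
  exact hT.connected.dist_eq_zero_iff.1 (by omega)

theorem insert_adj (hS : TreeConvex T S) (hT : T.IsTree) (hz : z ∈ S) (hzc : T.Adj z c)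
    (hc : c ∉ S) : TreeConvex T (insert c S) := by
  have far : ∀ x ∈ S, T.dist x c = T.dist x z + 1 := fun x hx =>
    hS.dist_eq_of_notMem hT hx hz hzc hc
  rintro x (rfl | hx) y (rfl | hy) d hyd hd
  · simp at hd
  · rcases eq_or_ne z y with rfl | hzy
    · rw [SimpleGraph.dist_eq_one_iff_adj.2 hzc.symm, Nat.lt_one_iff,
        hT.connected.dist_eq_zero_iff] at hd
      exact Or.inl hd.symm
    · obtain ⟨a, hya, ha⟩ := exists_adj_dist_eq_add_one hT.connected hzy
      have haS := hS z hz y hy a hya (by omega)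
      have hxy := far y hy
      have hxa := far a haS
      rw [SimpleGraph.dist_comm, SimpleGraph.dist_comm (v := z)] at hxy hxa
      exact Or.inr (eq_of_adj_of_dist_lt hT hya hyd (x := x) (by omega) hd ▸ haS)
  · have hxc := far x hx
    exact Or.inr (eq_of_adj_of_dist_lt hT hzc.symm hyd (x := x) (by omega) hd ▸ hz)
  · exact Or.inr (hS x hx y hy d hyd hd)

end TreeConvex

/-- The set `S` and the vertices `p`, `t` define a finite double cone with nonempty fibres over
the convex set `S` and with lowest vertex `p` and highest vertex `t`. -/
structure IsConeDatum (T : SimpleGraph W) (o : W) (S : Set W) (p t : W × ℤ) : Prop where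
  finite : S.Finite
  convex : TreeConvex T S
  lower_mem : p.1 ∈ S
  upper_mem : t.1 ∈ S
  lower_even : (p.2 - T.dist o p.1) % 2 = 0
  upper_even : (t.2 - T.dist o t.1) % 2 = 0
  nonempty : ∀ z ∈ S, p.2 + T.dist p.1 z + T.dist t.1 z ≤ t.2

namespace IsConeDatum

theorem doubleCone_finite (h : IsConeDatum T o S p t) : (doubleCone T o S p t).Finite := by
  refine (h.finite.prod (Set.finite_Icc p.2 t.2)).subset ?_
  rintro a ⟨haS, -, hpa, hat⟩
  exact ⟨haS, by omega, by omega⟩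

theorem mk_mem_doubleCone (h : IsConeDatum T o S p t) (hT : T.IsTree) {z : W} (hz : z ∈ S) :
    (z, p.2 + T.dist p.1 z) ∈ doubleCone T o S p t := by
  have := h.nonempty z hz
  have := h.lower_even
  have := two_dvd_dist_add_dist_add_dist hT o p.1 z
  refine ⟨hz, ?_, le_rfl, ?_⟩ <;> dsimp only <;> omega

theorem lower_mem_doubleCone (h : IsConeDatum T o S p t) : p ∈ doubleCone T o S p t := by
  have hle := h.nonempty _ h.lower_mem
  rw [SimpleGraph.dist_self, Nat.cast_zero, add_zero] at hle
  exact ⟨h.lower_mem, h.lower_even, by simp, hle⟩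

theorem wallFlip (h : IsConeDatum T o S p t) : IsConeDatum T o S (wallFlip t) (wallFlip p) where
  finite := h.finite
  convex := h.convex
  lower_mem := h.upper_mem
  upper_mem := h.lower_mem
  lower_even := by
    have := h.upper_even
    dsimp only [BuildingSymmetry.wallFlip]
    omega
  upper_even := by
    have := h.lower_even
    dsimp only [BuildingSymmetry.wallFlip]
    omega
  nonempty z hz := by
    have := h.nonempty z hz
    dsimp only [BuildingSymmetry.wallFlip]
    omega

theorem upper_mem_doubleCone (h : IsConeDatum T o S p t) : t ∈ doubleCone T o S p t := by
  have ht := h.wallFlip.lower_mem_doubleCone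
  rwa [← preimage_wallFlip_doubleCone, Set.mem_preimage, wallFlip_involutive] at ht

theorem of_lower_le (h : IsConeDatum T o S p t) (hT : T.Connected) (hpS : p'.1 ∈ S)
    (hpar : (p'.2 - T.dist o p'.1) % 2 = 0) (hle : p'.2 + T.dist p'.1 p.1 ≤ p.2) :
    IsConeDatum T o S p' t where
  finite := h.finite
  convex := h.convex
  lower_mem := hpS
  upper_mem := h.upper_mem
  lower_even := hpar
  upper_even := h.upper_even
  nonempty z hz := by
    have := h.nonempty z hz
    have := hT.dist_triangle (u := p'.1) (v := p.1) (w := z)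
    omega

theorem insert_leaf (h : IsConeDatum T o S p t) (hT : T.IsTree) {z c : W} (hz : z ∈ S)
    (hzc : T.Adj z c) (hc : c ∉ S) (hle : p.2 + T.dist p.1 z + 2 + T.dist t.1 z ≤ t.2) :
    IsConeDatum T o (insert c S) p t where
  finite := h.finite.insert c
  convex := h.convex.insert_adj hT hz hzc hc
  lower_mem := Or.inr h.lower_mem
  upper_mem := Or.inr h.upper_mem
  lower_even := h.lower_even
  upper_even := h.upper_even
  nonempty := by
    have := h.convex.dist_eq_of_notMem hT h.lower_mem hz hzc hc
    have := h.convex.dist_eq_of_notMem hT h.upper_mem hz hzc hc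
    rintro x (rfl | hx)
    · omega
    · exact h.nonempty x hx

theorem insert_lower (h : IsConeDatum T o S p t) (hT : T.IsTree) {c : W} (hc : c ∉ S)
    (hpc : T.Adj p.1 c) (hle : p.2 + T.dist t.1 p.1 = t.2) :
    IsConeDatum T o (insert c S) (c, p.2 - 1) t where
  finite := h.finite.insert c
  convex := h.convex.insert_adj hT h.lower_mem hpc hc
  lower_mem := Or.inl rfl
  upper_mem := Or.inr h.upper_mem
  lower_even := by
    have := h.lower_even
    have := hT.dist_eq_dist_add_one_of_adj o hpc
    dsimp only
    omega
  upper_even := h.upper_even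
  nonempty := by
    rintro x (rfl | hx)
    · have := h.convex.dist_eq_of_notMem hT h.upper_mem h.lower_mem hpc hc
      rw [SimpleGraph.dist_self]
      dsimp only
      omega
    · have hcx := h.convex.dist_eq_of_notMem hT hx h.lower_mem hpc hc
      rw [SimpleGraph.dist_comm, SimpleGraph.dist_comm (v := p.1)] at hcx
      have := h.nonempty x hx
      dsimp only
      omega

end IsConeDatum

end DoubleCone

section Enlargement

variable {V : Type u} {W : Type w} {T : SimpleGraph W} {G : SimpleGraph V} {τ : V → ZMod 3} {q : ℕ}
  {v₀ : V} {o : W} {S : Set W} {M : Set (W × ℤ)} {p t : W × ℤ}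

section Leaf

variable {z c : W} {m : ℤ}

theorem adj_cases_of_leaf (hT : T.IsTree) (hS : TreeConvex T S) (hz : z ∈ S) (hzc : T.Adj z c)
    (hc : c ∉ S) (hM : ∀ u ∈ M, u.1 = c ∧ u.2 ≤ m ∨ u.1 ∈ S) :
    ∀ u ∈ M, (wallGraph T).Adj (c, m) u → u = (z, m + 1) ∨ u = (z, m - 1) ∨ u = (c, m - 2) := by
  rintro ⟨x, n⟩ hu hvu
  rcases wallGraph_adj_cases hvu with ⟨rfl, hn⟩ | ⟨hxc, hcx, hn⟩ <;> dsimp only at *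
  · have hnm := ((hM _ hu).resolve_right hc).2
    exact Or.inr (Or.inr (Prod.ext rfl (by dsimp only at *; omega)))
  · obtain rfl := hS.eq_of_adj_of_notMem hT ((hM _ hu).resolve_left fun e => hxc e.1) hz hzc hcx hc
    rcases hn with rfl | rfl
    exacts [Or.inl rfl, Or.inr (Or.inl rfl)]

theorem linksJoined_of_leaf (hT : T.IsTree) (h : IsConeDatum T o S p t) (hz : z ∈ S)
    (hzc : T.Adj z c) (hc : c ∉ S) (hcone : (c, m) ∈ doubleCone T o (insert c S) p t)
    (hYM : doubleCone T o S p t ⊆ M) (hMZ : M ⊆ doubleCone T o (insert c S) p t)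
    (hM : ∀ u ∈ M, u.1 = c ∧ u.2 ≤ m ∨ u.1 ∈ S) : LinksJoined T M (c, m) := by
  obtain ⟨-, hpar, hpm, hmt⟩ := hcone
  dsimp only at hpar hpm hmt
  have hp := h.convex.dist_eq_of_notMem hT h.lower_mem hz hzc hc
  have ht := h.convex.dist_eq_of_notMem hT h.upper_mem hz hzc hc
  have ho := hT.dist_eq_dist_add_one_of_adj o hzc
  have hmem : ∀ n : ℤ, n = m - 1 ∨ n = m + 1 ∨ n = m - 3 → p.2 + T.dist p.1 z ≤ n → (z, n) ∈ M :=
    fun n hn hpn => hYM ⟨hz, by dsimp only; omega, hpn, by dsimp only; omega⟩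
  refine linksJoined_of_forall_sign (fun e he hy hd => ?_) fun e he y d hcy hyd hdc hy hd => ?_
  · obtain rfl : e = -1 := by
      have := (hM _ hy).resolve_right hc
      dsimp only at this
      omega
    have hpd := (hMZ hd).2.2.1
    dsimp only at hpd
    exact ⟨z, hzc.symm, hmem _ (by omega) (by omega), hmem _ (by omega) (by omega)⟩
  · have hyS : y ∈ S := (hM _ hy).resolve_left fun hyc => hcy.ne hyc.1.symm
    obtain rfl := h.convex.eq_of_adj_of_notMem hT hyS hz hzc hcy hc
    have hdS := (hM _ hd).resolve_left fun hdc' => hdc hdc'.1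
    refine Or.inr ⟨hmem _ (by omega) (by omega), hYM ⟨hdS, ?_, ?_, ?_⟩⟩
    · have := hT.dist_eq_dist_add_one_of_adj o hyd
      dsimp only
      omega
    · have := hT.dist_eq_dist_add_one_of_adj p.1 hyd
      dsimp only
      omega
    · have := hT.dist_eq_dist_add_one_of_adj t.1 hyd
      dsimp only
      omega

theorem UniformExtension.doubleCone_insert_leaf (hT : T.IsTree) (hG : IsRegularBuildingGraph G τ q)
    (hdeg : ∀ z, (T.neighborSet z).encard = ((q + 1 : ℕ) : ℕ∞)) (h : IsConeDatum T o S p t)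
    (hz : z ∈ S) (hzc : T.Adj z c) (hc : c ∉ S)
    (hle : p.2 + T.dist p.1 z + 2 + T.dist t.1 z ≤ t.2) :
    UniformExtension T G τ v₀ (doubleCone T o S p t) (doubleCone T o (insert c S) p t) := by
  have hq := hG.two_le
  refine .of_rank (fun a ha => ⟨Or.inr ha.1, ha.2⟩)
    (h.insert_leaf hT hz hzc hc hle).doubleCone_finite Prod.snd ?_
  rintro M ⟨x, m⟩ hYM hMZ hv hvM hrank
  obtain rfl : x = c := hv.1.resolve_right fun hxS => hvM (hYM ⟨hxS, hv.2⟩)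
  have hM : ∀ u ∈ M, u.1 = x ∧ u.2 ≤ m ∨ u.1 ∈ S := fun u hu =>
    (hMZ hu).1.imp_left fun hux => ⟨hux, hrank u hu fun huY => hc (hux ▸ huY.1)⟩
  obtain ⟨-, hpar, hpm, hmt⟩ := id hv
  dsimp only at hpar hpm hmt
  have hp := h.convex.dist_eq_of_notMem hT h.lower_mem hz hzc hc
  have ht := h.convex.dist_eq_of_notMem hT h.upper_mem hz hzc hc
  have ho := hT.dist_eq_dist_add_one_of_adj o hzc
  have h₁ : (z, m + 1) ∈ M := hYM ⟨hz, by dsimp only; omega, by dsimp only; omega,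
    by dsimp only; omega⟩
  have h₂ : (z, m - 1) ∈ M := hYM ⟨hz, by dsimp only; omega, by dsimp only; omega,
    by dsimp only; omega⟩
  have h12 : (wallGraph T).Adj (z, m + 1) (z, m - 1) := wallGraph_adj_vertical (by omega)
  exact .insert_of_adj_imp_path hT hG
    (encard_commonNeighbors_wallGraph_le hT (by omega) hdeg h12) hvM h₁ h₂
    (wallGraph_adj_transverse hzc.symm (by omega)) (wallGraph_adj_transverse hzc.symm (by omega))
    (wallGraph_adj_vertical (by omega)) h12 (wallGraph_adj_transverse hzc (by omega))
    (fun e => hzc.ne (congrArg Prod.fst e)) (adj_cases_of_leaf hT h.convex hz hzc hc hM)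
    (linksJoined_of_leaf hT h hz hzc hc hv hYM hMZ hM)

end Leaf

section LowerVertex

theorem doubleCone_insert_lower (hT : T.IsTree) (h : IsConeDatum T o S p t) {c : W} (hc : c ∉ S)
    (hpc : T.Adj p.1 c) (hle : p.2 + T.dist t.1 p.1 = t.2) :
    doubleCone T o (insert c S) (c, p.2 - 1) t = insert (c, p.2 - 1) (doubleCone T o S p t) := by
  have hcone := (h.insert_lower hT hc hpc hle).lower_mem_doubleCone
  have far : ∀ x ∈ S, T.dist c x = T.dist p.1 x + 1 := fun x hx => by
    rw [SimpleGraph.dist_comm, h.convex.dist_eq_of_notMem hT hx h.lower_mem hpc hc,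
      SimpleGraph.dist_comm]
  ext ⟨x, m⟩
  constructor
  · rintro ⟨rfl | hxS, hpar, hpm, hmt⟩
    · have := h.convex.dist_eq_of_notMem hT h.upper_mem h.lower_mem hpc hc
      exact Or.inl (Prod.ext rfl (by dsimp only at *; omega))
    · have := far x hxS
      exact Or.inr ⟨hxS, hpar, by dsimp only at *; omega, hmt⟩
  · rintro (hx | ⟨hxS, hpar, hpm, hmt⟩)
    · exact hx ▸ hcone
    · have := far x hxS
      exact ⟨Or.inr hxS, hpar, by dsimp only at *; omega, hmt⟩

theorem UniformExtension.doubleCone_insert_lower (hT : T.IsTree)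
    (hG : IsRegularBuildingGraph G τ q) (h : IsConeDatum T o S p t) {c : W} (hc : c ∉ S)
    (hpc : T.Adj p.1 c) (hle : p.2 + T.dist t.1 p.1 = t.2) :
    UniformExtension T G τ v₀ (doubleCone T o S p t)
      (doubleCone T o (insert c S) (c, p.2 - 1) t) := by
  rw [BuildingSymmetry.doubleCone_insert_lower hT h hc hpc hle]
  have hup : ∀ u ∈ doubleCone T o S p t, (wallGraph T).Adj p u →
      T.Adj p.1 u.1 ∧ u.2 = p.2 + 1 ∧ T.dist t.1 u.1 < T.dist t.1 p.1 := by
    rintro ⟨x, m⟩ ⟨-, -, hpm, hmt⟩ hpu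
    rcases wallGraph_adj_cases hpu with ⟨rfl, hm⟩ | ⟨-, hpx, hm⟩ <;> dsimp only at *
    · rw [SimpleGraph.dist_self] at hpm
      omega
    · rw [SimpleGraph.dist_eq_one_iff_adj.2 hpx] at hpm
      have := hT.dist_eq_dist_add_one_of_adj t.1 hpx
      exact ⟨hpx, by omega, by omega⟩
  refine insert_of_neighbor_subsingleton hG (fun hcone => hc hcone.1) h.lower_mem_doubleCone
    ?_ ?_ ?_
  · rintro ⟨x, m⟩ ⟨hxS, -, hpm, -⟩
    constructor
    · intro hvu
      rcases wallGraph_adj_cases hvu with ⟨rfl, -⟩ | ⟨-, hcx, hm⟩ <;> dsimp only at *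
      · exact absurd hxS hc
      · obtain rfl := h.convex.eq_of_adj_of_notMem hT hxS h.lower_mem hpc hcx hc
        rw [SimpleGraph.dist_self] at hpm
        exact Prod.ext rfl (by dsimp only; omega)
    · rintro rfl
      exact wallGraph_adj_transverse hpc.symm (by omega)
  · intro u hu u' hu' hpu hpu'
    obtain ⟨hadj, hlevel, hdist⟩ := hup u hu hpu
    obtain ⟨hadj', hlevel', hdist'⟩ := hup u' hu' hpu'
    exact Prod.ext (eq_of_adj_of_dist_lt hT hadj hadj' hdist hdist') (by omega)
  · intro u hu hpu
    have := (hup u hu hpu).2.1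
    dsimp only
    omega

theorem doubleCone_lower_segment (h : IsConeDatum T o S p t) (hS : ∀ z ∈ S, z = p.1) :
    doubleCone T o S (p.1, p.2 - 2) t = insert (p.1, p.2 - 2) (doubleCone T o S p t) := by
  have hpar := h.lower_even
  have hpt := h.lower_mem_doubleCone.2.2.2
  ext ⟨x, m⟩
  constructor
  · rintro ⟨hxS, hpar', hpm, hmt⟩
    obtain rfl := hS x hxS
    by_cases hm : m = p.2 - 2
    · exact Or.inl (Prod.ext rfl hm)
    · rw [SimpleGraph.dist_self] at hpm
      refine Or.inr ⟨hxS, hpar', ?_, hmt⟩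
      rw [SimpleGraph.dist_self]
      dsimp only at *
      omega
  · rintro (hx | ⟨hxS, hpar', hpm, hmt⟩)
    · obtain ⟨rfl, rfl⟩ := Prod.mk.injEq .. ▸ hx
      refine ⟨h.lower_mem, by dsimp only; omega, by simp, by dsimp only; omega⟩
    · exact ⟨hxS, hpar', by dsimp only at *; omega, hmt⟩

theorem UniformExtension.doubleCone_lower_segment (hG : IsRegularBuildingGraph G τ q)
    (h : IsConeDatum T o S p t) (hS : ∀ z ∈ S, z = p.1) :
    UniformExtension T G τ v₀ (doubleCone T o S p t) (doubleCone T o S (p.1, p.2 - 2) t) := by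
  rw [BuildingSymmetry.doubleCone_lower_segment h hS]
  have hfibre : ∀ u ∈ doubleCone T o S p t, u.1 = p.1 ∧ p.2 ≤ u.2 := by
    rintro u ⟨huS, -, hpu, -⟩
    exact ⟨hS _ huS, by omega⟩
  have hadj : ∀ u ∈ doubleCone T o S p t, ∀ m, (wallGraph T).Adj (p.1, m) u →
      u.2 = m + 2 ∨ u.2 = m - 2 := by
    intro u hu m hvu
    exact (wallGraph_adj_cases hvu).elim And.right fun h => absurd (hfibre u hu).1 h.1
  refine insert_of_neighbor_subsingleton hG (fun hcone => ?_) h.lower_mem_doubleCone ?_ ?_ ?_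
  · have := (hfibre _ hcone).2
    dsimp only at this
    omega
  · intro u hu
    refine ⟨fun hvu => Prod.ext (hfibre u hu).1 ?_, fun hup => hup ▸ wallGraph_adj_vertical ?_⟩
    · have := hadj u hu _ hvu
      have := (hfibre u hu).2
      omega
    · omega
  · intro u hu u' hu' hpu hpu'
    have := hfibre u hu
    have := hfibre u' hu'
    have := hadj u hu _ hpu
    have := hadj u' hu' _ hpu'
    exact Prod.ext (by simp only [*]) (by omega)
  · intro u hu hpu
    have := (hfibre u hu).2
    have := hadj u hu _ hpu
    dsimp only
    omega

end LowerVertex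

section Strip

variable {x y c : W} {m : ℤ}

theorem eq_of_mem_doubleCone_of_notMem (hT : T.IsTree) (hpar : (p.2 - T.dist o p.1) % 2 = 0)
    (hpc : T.Adj p.1 c) {v : W × ℤ} (hv : v ∈ doubleCone T o S (c, p.2 - 1) t)
    (hv' : v ∉ doubleCone T o S p t) :
    v.2 = p.2 + T.dist p.1 v.1 - 2 ∧ v.1 ≠ p.1 := by
  obtain ⟨hvS, hpar', hcv, hvt⟩ := hv
  have hlow : ¬ p.2 + T.dist p.1 v.1 ≤ v.2 := fun hpv => hv' ⟨hvS, hpar', hpv, hvt⟩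
  have hcp := hT.dist_eq_dist_add_one_of_adj v.1 hpc
  rw [SimpleGraph.dist_comm, SimpleGraph.dist_comm (v := c)] at hcp
  have := two_dvd_dist_add_dist_add_dist hT o p.1 v.1
  dsimp only at hcv
  refine ⟨by omega, fun hvp => ?_⟩
  rw [hvp] at hcv hcp hlow
  rw [SimpleGraph.dist_self] at hcp hlow
  omega

theorem adj_cases_of_strip (hT : T.IsTree) (hxy : T.Adj x y)
    (hy : T.dist p.1 x = T.dist p.1 y + 1) (hm : m = p.2 + T.dist p.1 x - 2)
    (hlow : ∀ u ∈ M, p.2 + T.dist p.1 u.1 - 2 ≤ u.2)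
    (hlow' : ∀ u ∈ M, T.dist p.1 x < T.dist p.1 u.1 → p.2 + T.dist p.1 u.1 ≤ u.2) :
    ∀ u ∈ M, (wallGraph T).Adj (x, m) u → u = (x, m + 2) ∨ u = (y, m + 1) ∨ u = (y, m - 1) := by
  rintro ⟨z, n⟩ hu hvu
  have h₁ := hlow _ hu
  have h₂ := hlow' _ hu
  rcases wallGraph_adj_cases hvu with ⟨rfl, hn⟩ | ⟨-, hxz, hn⟩ <;> dsimp only at *
  · exact Or.inl (Prod.ext rfl (by dsimp only; omega))
  · have := hT.dist_eq_dist_add_one_of_adj p.1 hxz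
    obtain rfl := eq_of_adj_of_dist_lt hT hxz hxy (x := p.1) (by omega) (by omega)
    rcases hn with rfl | rfl
    exacts [Or.inr (Or.inl rfl), Or.inr (Or.inr rfl)]

theorem linksJoined_of_strip (hT : T.IsTree) (h : IsConeDatum T o S p t) (hxS : x ∈ S)
    (hpar : (m - T.dist o x) % 2 = 0) (hyS : y ∈ S) (hxy : T.Adj x y)
    (hy : T.dist p.1 x = T.dist p.1 y + 1) (hm : m = p.2 + T.dist p.1 x - 2)
    (hYM : doubleCone T o S p t ⊆ M) (hMt : ∀ u ∈ M, u.1 ∈ S ∧ u.2 + T.dist t.1 u.1 ≤ t.2)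
    (hlow : ∀ u ∈ M, p.2 + T.dist p.1 u.1 - 2 ≤ u.2)
    (hlow' : ∀ u ∈ M, T.dist p.1 x < T.dist p.1 u.1 → p.2 + T.dist p.1 u.1 ≤ u.2) :
    LinksJoined T M (x, m) := by
  have hcases := adj_cases_of_strip hT hxy hy hm hlow hlow'
  have hxt := h.nonempty x hxS
  have hyt := h.nonempty y hyS
  have ho := hT.dist_eq_dist_add_one_of_adj o hxy
  have ht := hT.dist_eq_dist_add_one_of_adj t.1 hxy
  have hx₂ : (x, m + 2) ∈ M := hYM ⟨hxS, by dsimp only; omega, by dsimp only; omega,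
    by dsimp only; omega⟩
  have hmem : ∀ n : ℤ, n = m + 1 ∨ n = m + 3 → n + T.dist t.1 y ≤ t.2 → (y, n) ∈ M :=
    fun n hn hnt => hYM ⟨hyS, by dsimp only; omega, by dsimp only; omega, hnt⟩
  refine linksJoined_of_forall_sign (fun e he hye hd => ?_) fun e he z d hxz hzd hdx hze hd => ?_
  · obtain rfl : e = 1 := by
      have := hlow _ hye
      dsimp only at this
      omega
    have hdt := (hMt _ hd).2
    dsimp only at hdt
    exact ⟨y, hxy, hmem _ (by omega) (by omega), hmem _ (by omega) (by omega)⟩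
  · obtain rfl : z = y := by
      rcases hcases _ hze (wallGraph_adj_transverse hxz (by omega)) with h | h | h
      exacts [absurd (congrArg Prod.fst h) hxz.ne.symm, congrArg Prod.fst h, congrArg Prod.fst h]
    obtain ⟨hdS, hdt⟩ := hMt _ hd
    have hzdt := hT.dist_eq_dist_add_one_of_adj t.1 hzd
    dsimp only at hdS hdt
    rcases he with rfl | rfl
    · have htop : m + 3 + T.dist t.1 z ≤ t.2 := by
        by_contra hn
        exact hdx (eq_of_adj_of_dist_lt hT hzd hxy.symm (x := t.1) (by omega) (by omega))
      exact Or.inl ⟨hx₂, hmem _ (by omega) (by omega)⟩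
    · have hpd := hlow _ hd
      dsimp only at hpd
      have := hT.dist_eq_dist_add_one_of_adj o hzd
      have := hT.dist_eq_dist_add_one_of_adj p.1 hzd
      refine Or.inr ⟨hmem _ (by omega) (by omega), hYM ⟨hdS, ?_, ?_, ?_⟩⟩ <;> dsimp only <;> omega

theorem UniformExtension.doubleCone_strip (hT : T.IsTree) (hG : IsRegularBuildingGraph G τ q)
    (hdeg : ∀ z, (T.neighborSet z).encard = ((q + 1 : ℕ) : ℕ∞)) (h : IsConeDatum T o S p t)
    (hpc : T.Adj p.1 c) (hD : IsConeDatum T o S (c, p.2 - 1) t)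
    (hsub : doubleCone T o S p t ⊆ doubleCone T o S (c, p.2 - 1) t) :
    UniformExtension T G τ v₀ (doubleCone T o S p t) (doubleCone T o S (c, p.2 - 1) t) := by
  have hq := hG.two_le
  refine .of_rank hsub hD.doubleCone_finite (fun u => (T.dist p.1 u.1 : ℤ)) ?_
  rintro M ⟨x, m⟩ hYM hMZ hv hvM hrank
  have hnew : ∀ u ∈ M, u ∉ doubleCone T o S p t → u.2 = p.2 + T.dist p.1 u.1 - 2 := fun u hu huY =>
    (eq_of_mem_doubleCone_of_notMem hT h.lower_even hpc (hMZ hu) huY).1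
  have hlow : ∀ u ∈ M, p.2 + T.dist p.1 u.1 - 2 ≤ u.2 := fun u hu => by
    by_cases huY : u ∈ doubleCone T o S p t
    · have := huY.2.2.1
      omega
    · exact (hnew u hu huY).ge
  have hlow' : ∀ u ∈ M, T.dist p.1 x < T.dist p.1 u.1 → p.2 + T.dist p.1 u.1 ≤ u.2 :=
    fun u hu hlt => by
      have huY : u ∈ doubleCone T o S p t := by
        by_contra huY
        have := hrank u hu huY
        dsimp only at this
        omega
      exact huY.2.2.1
  obtain ⟨hm, hxp⟩ :=
    eq_of_mem_doubleCone_of_notMem hT h.lower_even hpc hv fun hvY => hvM (hYM hvY)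
  obtain ⟨hxS, hpar, -, -⟩ := hv
  dsimp only at hm hxp hxS hpar
  obtain ⟨y, hxy, hy⟩ := exists_adj_dist_eq_add_one hT.connected hxp.symm
  have hyS : y ∈ S := h.convex _ h.lower_mem x hxS y hxy (by omega)
  have hxt := h.nonempty x hxS
  have hyt := h.nonempty y hyS
  have ho := hT.dist_eq_dist_add_one_of_adj o hxy
  have h₁ : (x, m + 2) ∈ M := hYM ⟨hxS, by dsimp only; omega, by dsimp only; omega,
    by dsimp only; omega⟩
  have h₂ : (y, m + 1) ∈ M := hYM ⟨hyS, by dsimp only; omega, by dsimp only; omega,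
    by dsimp only; omega⟩
  have h12 : (wallGraph T).Adj (x, m + 2) (y, m + 1) := wallGraph_adj_transverse hxy (by omega)
  exact .insert_of_adj_imp_path hT hG
    (encard_commonNeighbors_wallGraph_le hT (by omega) hdeg h12) hvM h₁ h₂
    (wallGraph_adj_vertical (by omega)) (wallGraph_adj_transverse hxy (by omega))
    (wallGraph_adj_transverse hxy (by omega)) h12 (wallGraph_adj_vertical (by omega))
    (fun e => hxy.ne (congrArg Prod.fst e)) (adj_cases_of_strip hT hxy hy hm hlow hlow')
    (linksJoined_of_strip hT h hxS hpar hyS hxy hy hm hYM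
      (fun u hu => ⟨(hMZ hu).1, (hMZ hu).2.2.2⟩) hlow hlow')

end Strip

end Enlargement

section Uniformity

variable {V : Type u} {W : Type w} {T : SimpleGraph W} {G : SimpleGraph V} {τ : V → ZMod 3} {q : ℕ}
  {v₀ : V} {o : W} {S S' : Set W} {p t p' t' : W × ℤ}

theorem doubleCone_subset_of_lower_le (hT : T.Connected) (hS : S ⊆ S')
    (hp : p'.2 + T.dist p'.1 p.1 ≤ p.2) : doubleCone T o S p t ⊆ doubleCone T o S' p' t :=
  doubleCone_mono hT hS hp (by simp)

theorem IsConeDatum.insert_leaf_or_insert_lower (h : IsConeDatum T o S p t) (hT : T.IsTree) :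
    p.2 + T.dist p.1 p.1 + 2 + T.dist t.1 p.1 ≤ t.2 ∨ p.2 + T.dist t.1 p.1 = t.2 := by
  have hpt := h.nonempty _ h.lower_mem
  have := h.lower_even
  have := h.upper_even
  have := two_dvd_dist_add_dist_add_dist hT o t.1 p.1
  rw [SimpleGraph.dist_self] at hpt ⊢
  omega

theorem UniformExtension.doubleCone_adj_lower (hT : T.IsTree) (hG : IsRegularBuildingGraph G τ q)
    (hdeg : ∀ z, (T.neighborSet z).encard = ((q + 1 : ℕ) : ℕ∞)) (h : IsConeDatum T o S p t)
    {c : W} (hpc : T.Adj p.1 c) :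
    IsConeDatum T o (insert c S) (c, p.2 - 1) t ∧
      UniformExtension T G τ v₀ (doubleCone T o S p t)
        (doubleCone T o (insert c S) (c, p.2 - 1) t) := by
  have hcp : p.2 - 1 + T.dist c p.1 ≤ p.2 := by
    rw [SimpleGraph.dist_eq_one_iff_adj.2 hpc.symm]
    omega
  have strip : ∀ {S}, IsConeDatum T o S p t → c ∈ S → IsConeDatum T o S (c, p.2 - 1) t ∧
      UniformExtension T G τ v₀ (doubleCone T o S p t) (doubleCone T o S (c, p.2 - 1) t) := by
    intro S h hc
    have h₁ : IsConeDatum T o S (c, p.2 - 1) t := h.of_lower_le hT.connected hc (by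
      have := h.lower_even
      have := hT.dist_eq_dist_add_one_of_adj o hpc
      dsimp only
      omega) hcp
    exact ⟨h₁, doubleCone_strip hT hG hdeg h hpc h₁
      (doubleCone_subset_of_lower_le hT.connected subset_rfl hcp)⟩
  by_cases hc : c ∈ S
  · rw [Set.insert_eq_of_mem hc]
    exact strip h hc
  · rcases h.insert_leaf_or_insert_lower hT with hle | hle
    · have h₁ := h.insert_leaf hT h.lower_mem hpc hc hle
      obtain ⟨h₂, hU⟩ := strip h₁ (Set.mem_insert c S)
      exact ⟨h₂, (doubleCone_insert_leaf hT hG hdeg h h.lower_mem hpc hc hle).trans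
        (doubleCone_subset_of_lower_le hT.connected (Set.subset_insert c S) (by simp))
        (doubleCone_subset_of_lower_le hT.connected subset_rfl hcp) hU⟩
    · exact ⟨h.insert_lower hT hc hpc hle, doubleCone_insert_lower hT hG h hc hpc hle⟩

theorem IsConeDatum.exists_adj_or_forall_eq (h : IsConeDatum T o S p t) (hT : T.IsTree)
    (hS' : TreeConvex T S') (hp' : p'.1 ∈ S') (hpar : (p'.2 - T.dist o p'.1) % 2 = 0)
    (hS : S ⊆ S') (hle : p'.2 + T.dist p'.1 p.1 ≤ p.2) (hne : p ≠ p') :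
    (∃ c ∈ S', T.Adj p.1 c ∧ p'.2 + T.dist p'.1 c ≤ p.2 - 1) ∨
      (∀ z ∈ S, z = p.1) ∧ p'.2 + T.dist p'.1 p.1 ≤ p.2 - 2 := by
  by_cases hpp : p'.1 = p.1
  · have hlt : p'.2 + 2 ≤ p.2 := by
      have := h.lower_even
      have : p'.2 ≠ p.2 := fun e => hne (Prod.ext hpp.symm e.symm)
      rw [hpp] at hpar
      omega
    by_cases hc : ∃ c ∈ S, T.Adj p.1 c
    · obtain ⟨c, hc, hpc⟩ := hc
      refine Or.inl ⟨c, hS hc, hpc, ?_⟩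
      rw [hpp, SimpleGraph.dist_eq_one_iff_adj.2 hpc]
      omega
    · refine Or.inr ⟨fun z hz => ?_, ?_⟩
      · by_contra hzp
        obtain ⟨c, hpc, hd⟩ := exists_adj_dist_eq_add_one hT.connected hzp
        exact hc ⟨c, h.convex z hz p.1 h.lower_mem c hpc (by omega), hpc⟩
      · rw [hpp, SimpleGraph.dist_self]
        omega
  · obtain ⟨c, hpc, hd⟩ := exists_adj_dist_eq_add_one hT.connected hpp
    exact Or.inl ⟨c, hS' _ hp' _ (hS h.lower_mem) c hpc (by omega), hpc, by omega⟩

theorem exists_uniformExtension_doubleCone_lower_lt (hT : T.IsTree)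
    (hG : IsRegularBuildingGraph G τ q)
    (hdeg : ∀ z, (T.neighborSet z).encard = ((q + 1 : ℕ) : ℕ∞)) (h : IsConeDatum T o S p t)
    (hS' : TreeConvex T S') (hp' : p'.1 ∈ S') (hpar : (p'.2 - T.dist o p'.1) % 2 = 0)
    (hS : S ⊆ S') (hle : p'.2 + T.dist p'.1 p.1 ≤ p.2) (hne : p ≠ p') :
    ∃ S₁ p₁, S ⊆ S₁ ∧ S₁ ⊆ S' ∧ p₁.2 < p.2 ∧ p₁.2 + T.dist p₁.1 p.1 ≤ p.2 ∧
      p'.2 + T.dist p'.1 p₁.1 ≤ p₁.2 ∧ IsConeDatum T o S₁ p₁ t ∧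
      UniformExtension T G τ v₀ (doubleCone T o S p t) (doubleCone T o S₁ p₁ t) := by
  rcases h.exists_adj_or_forall_eq hT hS' hp' hpar hS hle hne with
    ⟨c, hc, hpc, hle₁⟩ | ⟨hSp, hle₁⟩
  · exact ⟨insert c S, (c, p.2 - 1), Set.subset_insert c S, Set.insert_subset hc hS,
      by dsimp only; omega, by simp [SimpleGraph.dist_eq_one_iff_adj.2 hpc.symm], hle₁,
      UniformExtension.doubleCone_adj_lower hT hG hdeg h hpc⟩
  · have hlow : p.2 - 2 + T.dist p.1 p.1 ≤ p.2 := by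
      rw [SimpleGraph.dist_self]
      omega
    refine ⟨S, (p.1, p.2 - 2), subset_rfl, hS, by dsimp only; omega, hlow, hle₁,
      h.of_lower_le hT.connected h.lower_mem ?_ hlow, .doubleCone_lower_segment hG h hSp⟩
    have := h.lower_even
    dsimp only
    omega

theorem exists_uniformExtension_doubleCone_lower (hT : T.IsTree)
    (hG : IsRegularBuildingGraph G τ q)
    (hdeg : ∀ z, (T.neighborSet z).encard = ((q + 1 : ℕ) : ℕ∞)) (h : IsConeDatum T o S p t)
    (hS' : TreeConvex T S') (hp' : p'.1 ∈ S') (hpar : (p'.2 - T.dist o p'.1) % 2 = 0)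
    (hS : S ⊆ S') (hle : p'.2 + T.dist p'.1 p.1 ≤ p.2) :
    ∃ S₁, S ⊆ S₁ ∧ S₁ ⊆ S' ∧ IsConeDatum T o S₁ p' t ∧
      UniformExtension T G τ v₀ (doubleCone T o S p t) (doubleCone T o S₁ p' t) := by
  induction n : (p.2 - p'.2).toNat using Nat.strong_induction_on generalizing S p with
  | _ n ih =>
  by_cases hne : p = p'
  · subst hne
    exact ⟨S, subset_rfl, hS, h, .refl _⟩
  · obtain ⟨S₁, p₁, hSS₁, hS₁, hlt, hp₁, hle₁, h₁, hU₁⟩ :=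
      exists_uniformExtension_doubleCone_lower_lt (v₀ := v₀) hT hG hdeg h hS' hp' hpar hS hle hne
    obtain ⟨S₂, hS₁₂, hS₂, h₂, hU₂⟩ := ih _ (by omega) h₁ hS₁ hle₁ rfl
    exact ⟨S₂, hSS₁.trans hS₁₂, hS₂, h₂, hU₁.trans
      (doubleCone_subset_of_lower_le hT.connected hSS₁ hp₁)
      (doubleCone_subset_of_lower_le hT.connected hS₁₂ hle₁) hU₂⟩

theorem exists_uniformExtension_doubleCone_upper (hT : T.IsTree)
    (hG : IsRegularBuildingGraph G τ q)
    (hdeg : ∀ z, (T.neighborSet z).encard = ((q + 1 : ℕ) : ℕ∞)) (h : IsConeDatum T o S p t)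
    (hS' : TreeConvex T S') (ht' : t'.1 ∈ S') (hpar : (t'.2 - T.dist o t'.1) % 2 = 0)
    (hS : S ⊆ S') (hle : t.2 + T.dist t'.1 t.1 ≤ t'.2) :
    ∃ S₁, S ⊆ S₁ ∧ S₁ ⊆ S' ∧ IsConeDatum T o S₁ p t' ∧
      UniformExtension T G τ v₀ (doubleCone T o S p t) (doubleCone T o S₁ p t') := by
  obtain ⟨S₁, hSS₁, hS₁, h₁, hU⟩ := exists_uniformExtension_doubleCone_lower (v₀ := v₀)
    (p' := wallFlip t') hT hG hdeg h.wallFlip hS' ht' (by dsimp only [wallFlip]; omega) hS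
    (by dsimp only [wallFlip]; omega)
  have h₁' := h₁.wallFlip
  rw [wallFlip_involutive, wallFlip_involutive] at h₁'
  refine ⟨S₁, hSS₁, hS₁, h₁', .of_wallFlip ?_⟩
  rwa [preimage_wallFlip_doubleCone, preimage_wallFlip_doubleCone]

theorem uniformExtension_doubleCone_of_subset (hT : T.IsTree) (hG : IsRegularBuildingGraph G τ q)
    (hdeg : ∀ z, (T.neighborSet z).encard = ((q + 1 : ℕ) : ℕ∞)) (h : IsConeDatum T o S p t)
    (h' : IsConeDatum T o S' p t) (hS : S ⊆ S') :
    UniformExtension T G τ v₀ (doubleCone T o S p t) (doubleCone T o S' p t) := by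
  induction n : (S' \ S).ncard generalizing S with
  | zero =>
    rw [Set.ncard_eq_zero h'.finite.sdiff, Set.sdiff_eq_empty] at n
    rw [hS.antisymm n]
    exact .refl _
  | succ n ih =>
    obtain ⟨c, hc, hmin⟩ := Set.exists_min_image (S' \ S) (fun x => T.dist p.1 x) h'.finite.sdiff
      (Set.nonempty_of_ncard_ne_zero (by omega))
    obtain ⟨z, hcz, hd⟩ := exists_adj_dist_eq_add_one hT.connected (x := p.1) (z := c)
      fun hpc => hc.2 (hpc ▸ h.lower_mem)
    have hz : z ∈ S := by
      by_contra hz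
      have := hmin z ⟨h'.convex _ h'.lower_mem c hc.1 z hcz (by omega), hz⟩
      omega
    have hct := h'.nonempty c hc.1
    rw [h.convex.dist_eq_of_notMem hT h.upper_mem hz hcz.symm hc.2] at hct
    have hle : p.2 + T.dist p.1 z + 2 + T.dist t.1 z ≤ t.2 := by omega
    have hcS : insert c S ⊆ S' := Set.insert_subset hc.1 hS
    refine (UniformExtension.doubleCone_insert_leaf hT hG hdeg h hz hcz.symm hc.2 hle).trans
      (doubleCone_subset_of_lower_le hT.connected (Set.subset_insert c S) (by simp))
      (doubleCone_subset_of_lower_le hT.connected hcS (by simp))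
      (ih (h.insert_leaf hT hz hcz.symm hc.2 hle) hcS ?_)
    have := Set.ncard_sdiff_singleton_add_one hc h'.finite.sdiff
    rw [Set.sdiff_sdiff, Set.union_singleton] at this
    omega

theorem uniformExtension_doubleCone (hT : T.IsTree) (hG : IsRegularBuildingGraph G τ q)
    (hdeg : ∀ z, (T.neighborSet z).encard = ((q + 1 : ℕ) : ℕ∞)) (h : IsConeDatum T o S p t)
    (h' : IsConeDatum T o S' p' t') (hsub : doubleCone T o S p t ⊆ doubleCone T o S' p' t') :
    UniformExtension T G τ v₀ (doubleCone T o S p t) (doubleCone T o S' p' t') := by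
  have hS : S ⊆ S' := fun z hz => (hsub (h.mk_mem_doubleCone hT hz)).1
  have hp := (hsub h.lower_mem_doubleCone).2.2.1
  have ht := (hsub h.upper_mem_doubleCone).2.2.2
  obtain ⟨S₁, hSS₁, hS₁, h₁, hU₁⟩ := exists_uniformExtension_doubleCone_lower (v₀ := v₀)
    hT hG hdeg h h'.convex h'.lower_mem h'.lower_even hS hp
  obtain ⟨S₂, hS₁₂, hS₂, h₂, hU₂⟩ := exists_uniformExtension_doubleCone_upper (v₀ := v₀)
    hT hG hdeg h₁ h'.convex h'.upper_mem h'.upper_even hS₁ ht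
  exact hU₁.trans (doubleCone_mono hT.connected hSS₁ hp (by simp))
    (doubleCone_mono hT.connected hS₁ (by simp) ht)
    (hU₂.trans (doubleCone_mono hT.connected hS₁₂ (by simp) ht)
      (doubleCone_mono hT.connected hS₂ (by simp) (by simp))
      (uniformExtension_doubleCone_of_subset hT hG hdeg h₂ h' hS₂))

end Uniformity

section Classification

variable {W : Type w} {T : SimpleGraph W} {o : W} {A : Set (W × ℤ)} {p : W × ℤ}

/-- The closure properties of the finite convex sets of vertices of the wall-tree that determine
their shape. -/
structure IsWallConvex (T : SimpleGraph W) (o : W) (A : Set (W × ℤ)) : Prop where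
  finite : A.Finite
  nonempty : A.Nonempty
  even : ∀ a ∈ A, (a.2 - T.dist o a.1) % 2 = 0
  treeConvex : TreeConvex T (Prod.fst '' A)
  vertical : ∀ {z m n k}, (z, m) ∈ A → (z, n) ∈ A → m ≤ k → k ≤ n → (k - m) % 2 = 0 → (z, k) ∈ A
  up : ∀ {z z' m n}, T.Adj z z' → (z, m) ∈ A → (z', n) ∈ A → m < n → (z', m + 1) ∈ A
  down : ∀ {z z' m n}, T.Adj z z' → (z, m) ∈ A → (z', n) ∈ A → n < m → (z', m - 1) ∈ A
  join : ∀ {y b c}, b ∈ A → c ∈ A → b ≠ c → ¬ (wallGraph T).Adj b c → (wallGraph T).Adj y b →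
    (wallGraph T).Adj y c → y ∈ A

namespace IsWallConvex

theorem wallFlip (hA : IsWallConvex T o A) : IsWallConvex T o (wallFlip ⁻¹' A) := by
  have hflip := wallFlip_involutive (W := W)
  have hfst : Prod.fst '' (BuildingSymmetry.wallFlip ⁻¹' A) = Prod.fst '' A := by
    rw [← hflip.image_eq_preimage_symm, Set.image_image]
    rfl
  refine ⟨hA.finite.preimage hflip.injective.injOn, hA.nonempty.preimage hflip.surjective, ?_,
    hfst ▸ hA.treeConvex, ?_, ?_, ?_, ?_⟩
  · intro a ha
    have := hA.even _ ha
    dsimp only [BuildingSymmetry.wallFlip] at this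
    omega
  · intro z m n k hm hn hmk hkn hpar
    have hm' := hA.even _ hm
    have hn' := hA.even _ hn
    dsimp only [BuildingSymmetry.wallFlip] at hm' hn'
    exact hA.vertical (m := -n) (n := -m) hn hm (by omega) (by omega) (by omega)
  · intro z z' m n hz hm hn hmn
    have := hA.down hz hm hn (by dsimp only; omega)
    rwa [← neg_add'] at this
  · intro z z' m n hz hm hn hnm
    have := hA.up hz hm hn (by dsimp only; omega)
    rwa [neg_add_eq_sub, ← neg_sub] at this
  · intro y b c hb hc hbc hadj hyb hyc
    exact hA.join hb hc (hflip.injective.ne hbc) (mt wallGraph_adj_wallFlip.1 hadj)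
      (wallGraph_adj_wallFlip.2 hyb) (wallGraph_adj_wallFlip.2 hyc)

theorem lt_of_adj_of_isLeast (hA : IsWallConvex T o A) (hT : T.IsTree) (hp : p ∈ A)
    (hmin : ∀ a ∈ A, p.2 ≤ a.2) {z c : W} {n : ℤ} (hzc : T.Adj z c)
    (hd : T.dist p.1 z = T.dist p.1 c + 1) (hc : c ∈ Prod.fst '' A)
    (hlow : ∀ x ∈ Prod.fst '' A, T.dist p.1 x < T.dist p.1 z →
      IsLeast {m : ℤ | (x, m) ∈ A} (p.2 + T.dist p.1 x)) (hn : (z, n) ∈ A) :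
    p.2 + T.dist p.1 c < n := by
  by_contra hlt
  obtain ⟨hcA, hcmin⟩ := hlow c hc (by omega)
  have hpar := hA.even _ hn
  have hpar' := hA.even _ hcA
  have hpar'' := hA.even _ hp
  have hoz := hT.dist_eq_dist_add_one_of_adj o hzc
  dsimp only at hpar hpar'
  have hup : p.2 + T.dist p.1 c ≤ n + 1 := hcmin (hA.up hzc hn hcA (by omega))
  have hn' : n = p.2 + T.dist p.1 c - 1 := by omega
  have hpc : p.1 ≠ c := by
    rintro rfl
    have := hmin _ hn
    rw [SimpleGraph.dist_self] at hn'
    omega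
  obtain ⟨c', hcc', hd'⟩ := exists_adj_dist_eq_add_one hT.connected hpc
  have hc'A := (hlow c' (hA.treeConvex _ ⟨p, hp, rfl⟩ _ hc c' hcc' (by omega)) (by omega)).1
  have hjoin : (c, p.2 + T.dist p.1 c - 2) ∈ A := by
    refine hA.join hn hc'A ?_ (fun hadj => not_three_dvd_of_wallGraph_adj hadj ?_)
      (wallGraph_adj_transverse hzc.symm (by omega)) (wallGraph_adj_transverse hcc' (by omega))
    · rw [Ne, Prod.mk.injEq]
      rintro ⟨rfl, -⟩
      omega
    · dsimp only
      omega
  have := hcmin hjoin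
  omega

theorem exists_isLeast (hA : IsWallConvex T o A) (hT : T.IsTree) :
    ∃ p ∈ A, ∀ z ∈ Prod.fst '' A, IsLeast {n : ℤ | (z, n) ∈ A} (p.2 + T.dist p.1 z) := by
  obtain ⟨p, hp, hmin⟩ := Set.exists_min_image A Prod.snd hA.finite hA.nonempty
  refine ⟨p, hp, fun z hz => ?_⟩
  induction k : T.dist p.1 z using Nat.strong_induction_on generalizing z with
  | _ k ih =>
  by_cases hpz : p.1 = z
  · subst hpz
    rw [SimpleGraph.dist_self] at k
    subst k
    rw [Nat.cast_zero, add_zero]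
    exact ⟨hp, fun n hn => hmin _ hn⟩
  · obtain ⟨c, hzc, hd⟩ := exists_adj_dist_eq_add_one hT.connected hpz
    have hc := hA.treeConvex _ ⟨p, hp, rfl⟩ _ hz c hzc (by omega)
    have hlt : ∀ n, (z, n) ∈ A → p.2 + T.dist p.1 c < n := fun n hn =>
      hA.lt_of_adj_of_isLeast hT hp hmin hzc hd hc (fun x hx hxz => ih _ (by omega) x hx rfl) hn
    obtain ⟨⟨z, n⟩, hn, rfl⟩ := hz
    have hup := hA.up hzc.symm (ih _ (by omega) c hc rfl).1 hn (hlt n hn)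
    rw [← k, hd, Nat.cast_add_one, ← add_assoc]
    exact ⟨hup, fun m hm => hlt m hm⟩

theorem exists_isGreatest (hA : IsWallConvex T o A) (hT : T.IsTree) :
    ∃ t ∈ A, ∀ z ∈ Prod.fst '' A, IsGreatest {n : ℤ | (z, n) ∈ A} (t.2 - T.dist t.1 z) := by
  obtain ⟨t, ht, hleast⟩ := hA.wallFlip.exists_isLeast hT
  refine ⟨BuildingSymmetry.wallFlip t, ht, ?_⟩
  rintro z ⟨⟨z, n⟩, hn, rfl⟩
  have hflip : ∀ {m : ℤ}, (z, m) ∈ A → (z, -m) ∈ BuildingSymmetry.wallFlip ⁻¹' A := fun {m} hm => by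
    rwa [Set.mem_preimage, BuildingSymmetry.wallFlip, neg_neg]
  obtain ⟨hmem, hle⟩ := hleast z ⟨_, hflip hn, rfl⟩
  refine ⟨?_, fun m hm => ?_⟩
  · rw [Set.mem_ofPred_eq, BuildingSymmetry.wallFlip, ← neg_add']
    exact hmem
  · have := hle (hflip hm)
    dsimp only [BuildingSymmetry.wallFlip]
    omega

theorem exists_eq_doubleCone (hA : IsWallConvex T o A) (hT : T.IsTree) :
    ∃ p t, IsConeDatum T o (Prod.fst '' A) p t ∧ A = doubleCone T o (Prod.fst '' A) p t := by
  obtain ⟨p, hp, hleast⟩ := hA.exists_isLeast hT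
  obtain ⟨t, ht, hgreatest⟩ := hA.exists_isGreatest hT
  have hpt : ∀ z ∈ Prod.fst '' A, p.2 + T.dist p.1 z + T.dist t.1 z ≤ t.2 := fun z hz => by
    have := (hgreatest z hz).2 (hleast z hz).1
    omega
  refine ⟨p, t, ⟨hA.finite.image _, hA.treeConvex, ⟨p, hp, rfl⟩, ⟨t, ht, rfl⟩, hA.even _ hp,
    hA.even _ ht, hpt⟩, ?_⟩
  ext ⟨z, n⟩
  constructor
  · intro hn
    have hz : z ∈ Prod.fst '' A := ⟨_, hn, rfl⟩
    have hle := (hgreatest z hz).2 hn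
    exact ⟨hz, hA.even _ hn, (hleast z hz).2 hn, by dsimp only; omega⟩
  · rintro ⟨hz, hpar, hpn, hnt⟩
    have hpar' := hA.even _ (hleast z hz).1
    dsimp only at *
    exact hA.vertical (hleast z hz).1 (hgreatest z hz).1 hpn (by omega) (by omega)

end IsWallConvex

end Classification

section ModelWallTree

variable {Z : Type u} {W : Type w} {T : SimpleGraph W} {o : W} {S : Set (WallTreeVertex T o)}
  {a b c : WallTreeVertex T o}

theorem skeleton_modelWallTree_adj :
    (skeleton (modelWallTree T o)).Adj a b ↔ (wallGraph T).Adj a.1 b.1 := by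
  rw [modelWallTree, skeleton_flagComplex, SimpleGraph.fromRel_adj, wallGraph_adj, Ne,
    Subtype.ext_iff, Prod.ext_iff, T.adj_comm b.1.1 a.1.1]
  have := T.ne_of_adj (a := a.1.1) (b := b.1.1)
  grind

theorem isFlag_modelWallTree : IsFlag (modelWallTree T o) := isFlag_flagComplex _

theorem even_of_wallGraph_adj (hT : T.IsTree) {y b : W × ℤ} (h : (wallGraph T).Adj y b)
    (hb : Even (b.2 - (T.dist o b.1 : ℤ))) : Even (y.2 - (T.dist o y.1 : ℤ)) := by
  rw [Int.even_iff] at hb ⊢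
  rcases h with ⟨h, h'⟩ | ⟨h, h'⟩
  · rw [h]
    omega
  · have := hT.dist_eq_dist_add_one_of_adj o h
    omega

theorem natAbs_add_dist_le_two_mul_length (hT : T.IsTree)
    (r : (skeleton (modelWallTree T o)).Walk a b) :
    (b.1.2 - a.1.2).natAbs + T.dist a.1.1 b.1.1 ≤ 2 * r.length := by
  induction r with
  | nil => simp
  | cons h r ih =>
    rename_i a b c
    rw [SimpleGraph.Walk.length_cons]
    rcases skeleton_modelWallTree_adj.1 h with ⟨h1, h2⟩ | ⟨h1, h2⟩
    · rw [h1]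
      omega
    · have := hT.connected.dist_triangle (u := a.1.1) (v := b.1.1) (w := c.1.1)
      rw [SimpleGraph.dist_eq_one_iff_adj.2 h1] at this
      omega

theorem exists_vertical_walk (k : ℕ) (h : a.1.1 = b.1.1) (hk : b.1.2 = a.1.2 + 2 * k) :
    ∃ r : (skeleton (modelWallTree T o)).Walk a b, r.length = k := by
  induction k generalizing a with
  | zero =>
    obtain rfl : a = b := Subtype.ext (Prod.ext h (by omega))
    exact ⟨.nil, rfl⟩
  | succ k ih =>
    have ha := a.2
    let c : WallTreeVertex T o := ⟨(a.1.1, a.1.2 + 2), by grind⟩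
    have hac : (skeleton (modelWallTree T o)).Adj a c :=
      skeleton_modelWallTree_adj.2 (Or.inl ⟨rfl, Or.inl rfl⟩)
    obtain ⟨r, hr⟩ := ih (a := c) h (by dsimp only [c]; omega)
    exact ⟨.cons hac r, by rw [SimpleGraph.Walk.length_cons, hr]⟩

theorem reachable_and_two_mul_dist_le_of_fst_eq (h : a.1.1 = b.1.1) :
    (skeleton (modelWallTree T o)).Reachable a b ∧
      2 * (skeleton (modelWallTree T o)).dist a b ≤ (b.1.2 - a.1.2).natAbs := by
  wlog hab : a.1.2 ≤ b.1.2 generalizing a b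
  · rw [SimpleGraph.reachable_comm, SimpleGraph.dist_comm, ← neg_sub, Int.natAbs_neg]
    exact this h.symm (by omega)
  have ha := Int.even_iff.1 a.2
  have hb := Int.even_iff.1 b.2
  rw [h] at ha
  obtain ⟨r, hr⟩ := exists_vertical_walk ((b.1.2 - a.1.2) / 2).toNat h (by omega)
  have := SimpleGraph.dist_le r
  exact ⟨⟨r⟩, by omega⟩

theorem mem_of_geodesicallyConvex_of_fst_eq (hT : T.IsTree)
    (hS : GeodesicallyConvex (skeleton (modelWallTree T o)) S) (ha : a ∈ S) (hb : b ∈ S)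
    (hac : (skeleton (modelWallTree T o)).Reachable a c) (hcb : c.1.1 = b.1.1)
    (h : 2 * (skeleton (modelWallTree T o)).dist a c + (b.1.2 - c.1.2).natAbs ≤
      (b.1.2 - a.1.2).natAbs + T.dist a.1.1 b.1.1) : c ∈ S := by
  obtain ⟨hcb, hdist⟩ := reachable_and_two_mul_dist_le_of_fst_eq hcb
  obtain ⟨r, hr⟩ := (hac.trans hcb).exists_walk_length_eq_dist
  have hle := natAbs_add_dist_le_two_mul_length hT r
  have htri := hac.dist_triangle_left b
  exact hS.mem_of_dist ha hb hac hcb (by omega)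

theorem mem_of_geodesicallyConvex_of_adj (hT : T.IsTree)
    (hS : GeodesicallyConvex (skeleton (modelWallTree T o)) S) (ha : a ∈ S) (hb : b ∈ S)
    (hac : T.Adj a.1.1 c.1.1) (hcb : c.1.1 = b.1.1)
    (h : (a.1.2 < b.1.2 ∧ c.1.2 = a.1.2 + 1) ∨ (b.1.2 < a.1.2 ∧ c.1.2 = a.1.2 - 1)) : c ∈ S := by
  have hadj : (skeleton (modelWallTree T o)).Adj a c :=
    skeleton_modelWallTree_adj.2 (Or.inr ⟨hac, by omega⟩)
  refine mem_of_geodesicallyConvex_of_fst_eq hT hS ha hb hadj.reachable hcb ?_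
  rw [SimpleGraph.dist_eq_one_iff_adj.2 hadj, SimpleGraph.dist_eq_one_iff_adj.2 (hcb ▸ hac)]
  omega

theorem exists_walk_support_subset_range {H : SimpleGraph Z} {f : Z → W}
    (hf : ∀ a b, H.Adj a b → f a = f b ∨ T.Adj (f a) (f b)) {a b : Z} (r : H.Walk a b) :
    ∃ p : T.Walk (f a) (f b), ∀ c ∈ p.support, c ∈ Set.range f := by
  induction r with
  | nil => exact ⟨.nil, by simp⟩
  | @cons a b c h _ ih =>
    obtain ⟨p, hp⟩ := ih
    rcases hf _ _ h with e | e
    · exact e ▸ ⟨p, hp⟩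
    · refine ⟨.cons e p, fun d hd => ?_⟩
      rw [SimpleGraph.Walk.support_cons, List.mem_cons] at hd
      exact hd.elim (fun h => ⟨a, h.symm⟩) (hp d)

theorem treeConvex_range (hT : T.IsTree) {H : SimpleGraph Z} (hH : H.Preconnected) {f : Z → W}
    (hf : ∀ a b, H.Adj a b → f a = f b ∨ T.Adj (f a) (f b)) : TreeConvex T (Set.range f) := by
  rintro _ ⟨x, rfl⟩ _ ⟨z, rfl⟩ c hc hd
  obtain ⟨r⟩ := hH z x
  obtain ⟨p, hp⟩ := exists_walk_support_subset_range hf r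
  exact hp c (mem_support_of_dist_lt hT hc hd p)

/-- The set of vertices `(z, n)` in the image of a map to the wall-tree. -/
def wallImage (j : Z → WallTreeVertex T o) : Set (W × ℤ) := Set.range fun x => (j x).1

theorem val_mem_wallImage {j : Z → WallTreeVertex T o} (ha : a ∈ Set.range j) :
    a.1 ∈ wallImage j := by
  obtain ⟨x, rfl⟩ := ha
  exact ⟨x, rfl⟩

theorem exists_mem_range_of_mem_wallImage {j : Z → WallTreeVertex T o} {a : W × ℤ}
    (ha : a ∈ wallImage j) : ∃ h, (⟨a, h⟩ : WallTreeVertex T o) ∈ Set.range j := by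
  obtain ⟨x, rfl⟩ := ha
  exact ⟨(j x).2, x, rfl⟩

theorem mem_wallImage_of_adj (hT : T.IsTree) {j : Z → WallTreeVertex T o}
    (hj : GeodesicallyConvex (skeleton (modelWallTree T o)) (Set.range j)) {z z' : W} {m n k : ℤ}
    (hz : T.Adj z z') (hm : (z, m) ∈ wallImage j) (hn : (z', n) ∈ wallImage j)
    (hk : (m < n ∧ k = m + 1) ∨ (n < m ∧ k = m - 1)) : (z', k) ∈ wallImage j := by
  obtain ⟨em, hm⟩ := exists_mem_range_of_mem_wallImage hm
  obtain ⟨en, hn⟩ := exists_mem_range_of_mem_wallImage hn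
  have ek : Even (k - (T.dist o z' : ℤ)) := even_of_wallGraph_adj (y := (z', k)) hT
    (wallGraph_adj_transverse hz.symm (by omega)) em
  exact val_mem_wallImage
    (mem_of_geodesicallyConvex_of_adj hT hj hm hn (c := ⟨(z', k), ek⟩) hz rfl hk)

theorem isWallConvex_wallImage (hT : T.IsTree) [Finite Z] {Y : AbstractSimplicialComplex Z}
    (hY : (skeleton Y).Connected) {j : Z → WallTreeVertex T o}
    (hj : IsIsometry Y (modelWallTree T o) j) : IsWallConvex T o (wallImage j) := by
  refine ⟨Set.finite_range _, ?_, ?_, ?_, ?_, ?_, ?_, ?_⟩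
  · obtain ⟨x⟩ := hY.nonempty
    exact ⟨_, x, rfl⟩
  · rintro _ ⟨x, rfl⟩
    exact Int.even_iff.1 (j x).2
  · rw [wallImage, ← Set.range_comp]
    refine treeConvex_range hT hY.preconnected fun a b hab => ?_
    rw [← hj.adj_iff, skeleton_modelWallTree_adj] at hab
    exact hab.imp And.left And.left
  · intro z m n k hm hn hmk hkn hpar
    obtain ⟨em, hm⟩ := exists_mem_range_of_mem_wallImage hm
    obtain ⟨en, hn⟩ := exists_mem_range_of_mem_wallImage hn
    have ek : Even (k - (T.dist o z : ℤ)) := by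
      rw [Int.even_iff] at em ⊢
      dsimp only at em
      omega
    obtain ⟨hr, hd⟩ := reachable_and_two_mul_dist_le_of_fst_eq (a := ⟨(z, m), em⟩)
      (b := ⟨(z, k), ek⟩) rfl
    refine val_mem_wallImage (mem_of_geodesicallyConvex_of_fst_eq hT hj.convex hm hn hr rfl ?_)
    dsimp only at hd ⊢
    omega
  · exact fun hz hm hn h => mem_wallImage_of_adj hT hj.convex hz hm hn (Or.inl ⟨h, rfl⟩)
  · exact fun hz hm hn h => mem_wallImage_of_adj hT hj.convex hz hm hn (Or.inr ⟨h, rfl⟩)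
  · intro y b c hb hc hne hbc hyb hyc
    obtain ⟨eb, hb⟩ := exists_mem_range_of_mem_wallImage hb
    obtain ⟨ec, hc⟩ := exists_mem_range_of_mem_wallImage hc
    refine val_mem_wallImage (a := ⟨y, even_of_wallGraph_adj hT hyb eb⟩)
      (hj.convex.mem_of_adj_of_adj hb hc (fun h => hne (congrArg Subtype.val h)) ?_ ?_ ?_) <;>
    rwa [skeleton_modelWallTree_adj]

end ModelWallTree

section Symmetry

variable {V : Type v} {X : AbstractSimplicialComplex V} {τ : V → ZMod 3} {W : Type w}
  {T : SimpleGraph W} {o : W} {Z : Type u} {Y : AbstractSimplicialComplex Z}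
  {j : Z → WallTreeVertex T o} {g : W × ℤ → V}

theorem IsIsometry.wallGraph_adj_iff (hj : IsIsometry Y (modelWallTree T o) j) {a b : Z} :
    (wallGraph T).Adj (j a).1 (j b).1 ↔ (skeleton Y).Adj a b := by
  rw [← skeleton_modelWallTree_adj, hj.adj_iff]

theorem IsIsometry.val_injective (hj : IsIsometry Y (modelWallTree T o) j) :
    Function.Injective fun x => (j x).1 :=
  Subtype.val_injective.comp hj.injective

theorem color_eq_iff_of_isIsometry (hG : IsBuildingGraph (skeleton X) τ)
    (hj : IsIsometry Y (modelWallTree T o) j) (hA : IsWallConvex T o (wallImage j))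
    (hg : IsIsometry Y X fun x => g (j x).1) {y b c : Z} (hb : (skeleton Y).Adj y b)
    (hc : (skeleton Y).Adj y c) (hbc : b ≠ c) :
    τ (g (j b).1) = τ (g (j c).1) ↔ (3 : ℤ) ∣ (j b).1.2 - (j c).1.2 := by
  have hadj : ∀ {a b : Z}, (skeleton X).Adj (g (j a).1) (g (j b).1) ↔ (skeleton Y).Adj a b :=
    hg.adj_iff
  have hb' := hj.wallGraph_adj_iff.2 hb
  have hc' := hj.wallGraph_adj_iff.2 hc
  have hbc' := hj.val_injective.ne hbc
  constructor
  · intro hτ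
    obtain ⟨x, hxy, hxb, hxc⟩ := hG.exists_join (hadj.2 hb) (hadj.2 hc) hτ
    obtain ⟨w, rfl⟩ : x ∈ Set.range fun x => g (j x).1 := hg.convex.mem_of_adj_of_adj ⟨b, rfl⟩
      ⟨c, rfl⟩ (hg.injective.ne hbc) (hG.not_adj_of_color_eq hτ) hxb hxc
    have hwy := not_three_dvd_of_wallGraph_adj (hj.wallGraph_adj_iff.2 (hadj.1 hxy))
    have hwb := not_three_dvd_of_wallGraph_adj (hj.wallGraph_adj_iff.2 (hadj.1 hxb))
    have hwc := not_three_dvd_of_wallGraph_adj (hj.wallGraph_adj_iff.2 (hadj.1 hxc))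
    have hyb := not_three_dvd_of_wallGraph_adj hb'
    have hyc := not_three_dvd_of_wallGraph_adj hc'
    omega
  · intro h3
    obtain ⟨x, hxy, hxb, hxc⟩ := exists_common_wallGraph_neighbor hb' hc' hbc' h3
    obtain ⟨w, rfl⟩ := hA.join ⟨b, rfl⟩ ⟨c, rfl⟩ hbc'
      (fun h => not_three_dvd_of_wallGraph_adj h h3) hxb hxc
    rw [hj.wallGraph_adj_iff, ← hadj] at hxy hxb hxc
    exact hG.color_eq hxy hxb (hadj.2 hb) hxc (hadj.2 hc)

theorem isLocalEmbedding_of_isIsometry (hG : IsBuildingGraph (skeleton X) τ)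
    (hj : IsIsometry Y (modelWallTree T o) j) (hA : IsWallConvex T o (wallImage j))
    (hg : IsIsometry Y X fun x => g (j x).1) :
    IsLocalEmbedding T (skeleton X) τ (wallImage j) g where
  adj := by
    rintro _ _ ⟨a, rfl⟩ ⟨b, rfl⟩ h
    exact hg.adj_iff.2 (hj.wallGraph_adj_iff.1 h)
  compatible := by
    rintro _ _ _ ⟨y, rfl⟩ ⟨b, rfl⟩ ⟨c, rfl⟩ hb hc
    by_cases hbc : b = c
    · exact hbc ▸ .refl _ _
    rw [hj.wallGraph_adj_iff] at hb hc
    exact ⟨color_eq_iff_of_isIsometry hG hj hA hg hb hc hbc,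
      fun h => absurd (hg.injective h) hbc, fun h => hj.wallGraph_adj_iff.2 (hg.adj_iff.1 h)⟩

theorem isLocallyConvexEmbedding_of_isLocalEmbedding (hG : IsBuildingGraph (skeleton X) τ)
    (hj : IsIsometry Y (modelWallTree T o) j) (hA : IsWallConvex T o (wallImage j))
    (hg : IsLocalEmbedding T (skeleton X) τ (wallImage j) g) :
    IsLocallyConvexEmbedding (skeleton Y) (skeleton X) fun x => g (j x).1 := by
  have hadj : ∀ {a b}, (skeleton Y).Adj a b → (skeleton X).Adj (g (j a).1) (g (j b).1) :=
    fun h => hg.adj ⟨_, rfl⟩ ⟨_, rfl⟩ (hj.wallGraph_adj_iff.2 h)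
  have hlink : ∀ {y b c}, (skeleton Y).Adj y b → (skeleton Y).Adj y c →
      IsLinkCompatible T (skeleton X) τ (j b).1 (j c).1 (g (j b).1) (g (j c).1) :=
    fun {y _ _} hb hc => hg.compatible ⟨y, rfl⟩ ⟨_, rfl⟩ ⟨_, rfl⟩ (hj.wallGraph_adj_iff.2 hb)
      (hj.wallGraph_adj_iff.2 hc)
  have hne : ∀ {y b c}, (skeleton Y).Adj y b → (skeleton Y).Adj y c → b ≠ c →
      g (j b).1 ≠ g (j c).1 :=
    fun hb hc hbc h => hbc (hj.val_injective ((hlink hb hc).eq_of_eq h))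
  have hna : ∀ {y b c}, (skeleton Y).Adj y b → (skeleton Y).Adj y c → ¬ (skeleton Y).Adj b c →
      ¬ (skeleton X).Adj (g (j b).1) (g (j c).1) :=
    fun hb hc hn h => hn (hj.wallGraph_adj_iff.1 ((hlink hb hc).adj_of_adj h))
  refine ⟨hadj, fun hb hc hbc _ => hne hb hc hbc, fun hb hc _ hn => hna hb hc hn, ?_⟩
  intro y b c x hb hc hbc hn hxb hxc
  rcases hG.eq_or_adj_of_common (hadj hb) (hadj hc) hxb hxc (hne hb hc hbc) (hna hb hc hn)
    with h | h
  · exact ⟨y, hb, hc, h.symm⟩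
  have hτ : τ (g (j b).1) = τ (g (j c).1) := by
    by_contra hτ
    exact hG.color hxc.symm (hG.color_eq_of_ne (hadj hb) (hadj hc) h.symm hτ (hG.color hxb.symm))
  have h3 := (hlink hb hc).color_eq_iff.1 hτ
  have hbc' := hj.val_injective.ne hbc
  obtain ⟨x', hx'y, hx'b, hx'c⟩ := exists_common_wallGraph_neighbor (hj.wallGraph_adj_iff.2 hb)
    (hj.wallGraph_adj_iff.2 hc) hbc' h3
  obtain ⟨w, rfl⟩ := hA.join ⟨b, rfl⟩ ⟨c, rfl⟩ hbc'
    (fun h => not_three_dvd_of_wallGraph_adj h h3) hx'b hx'c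
  rw [hj.wallGraph_adj_iff] at hx'y hx'b hx'c
  exact ⟨w, hx'b, hx'c, hG.join_unique (hadj hb) (hne hb hc hbc) hτ (hadj hx'y) (hadj hx'b)
    (hadj hx'c) h hxb hxc⟩

theorem isIsometry_of_isLocalEmbedding (hG : IsBuildingGraph (skeleton X) τ) (hX : IsFlag X)
    (hY : (skeleton Y).Connected) (hj : IsIsometry Y (modelWallTree T o) j)
    (hA : IsWallConvex T o (wallImage j))
    (hg : IsLocalEmbedding T (skeleton X) τ (wallImage j) g) :
    IsIsometry Y X fun x => g (j x).1 := by
  have hf := isLocallyConvexEmbedding_of_isLocalEmbedding hG hj hA hg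
  refine isIsometry_of_isFlag (hj.isFlag isFlag_modelWallTree) hX (fun a b => ?_)
    (geodesicallyConvex_of_dist ?_)
  · rw [← (hG.connected _ _).coe_dist_eq_edist, ← (hY a b).coe_dist_eq_edist, hf.dist_eq hY hG]
  · rintro _ ⟨a, rfl⟩ _ ⟨b, rfl⟩ c - - h
    exact hf.mem_range_of_dist_add_dist_eq hY hG h

theorem uniformExtension_of_isWallConvex {q : ℕ} {G : SimpleGraph V} {v₀ : V} {A A' : Set (W × ℤ)}
    (hT : T.IsTree) (hdeg : ∀ z, (T.neighborSet z).encard = ((q + 1 : ℕ) : ℕ∞))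
    (hG : IsRegularBuildingGraph G τ q) (hA : IsWallConvex T o A) (hA' : IsWallConvex T o A')
    (hsub : A ⊆ A') : UniformExtension T G τ v₀ A A' := by
  obtain ⟨p, t, h, e⟩ := hA.exists_eq_doubleCone hT
  obtain ⟨p', t', h', e'⟩ := hA'.exists_eq_doubleCone hT
  rw [e, e'] at hsub ⊢
  exact uniformExtension_doubleCone hT hG hdeg h h' hsub

theorem encard_isometric_extensions_eq (hG : IsBuildingGraph (skeleton X) τ) (hX : IsFlag X)
    (hY : (skeleton Y).Connected) (hj : IsIsometry Y (modelWallTree T o) j)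
    (hA : IsWallConvex T o (wallImage j)) (v₀ : V) {Z' : Type u} {i : Z' → Z} {α : Z' → V}
    (hgα : ∀ x, g (j (i x)).1 = α x) :
    {β : Z → V | IsIsometry Y X β ∧ β ∘ i = α}.encard =
      (localExtensions T (skeleton X) τ v₀ (wallImage (j ∘ i)) (wallImage j) g).encard := by
  let E : (Z → V) → W × ℤ → V := fun β => Function.extend (fun x => (j x).1) β fun _ => v₀
  have hE : ∀ β x, E β (j x).1 = β x := fun β => hj.val_injective.extend_apply β _
  have hE' : ∀ β a, a ∉ wallImage j → E β a = v₀ := fun β a ha => Function.extend_apply' _ _ _ ha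
  have hEinj : Function.Injective E := fun β β' h => funext fun x => by rw [← hE β, h, hE]
  rw [← hEinj.encard_image]
  congr 1
  ext h
  constructor
  · rintro ⟨β, ⟨hβ, rfl⟩, rfl⟩
    refine ⟨isLocalEmbedding_of_isIsometry hG hj hA (by simpa only [hE] using hβ), ?_, hE' β⟩
    rintro _ ⟨x, rfl⟩
    exact (hE β (i x)).trans (hgα x).symm
  · rintro ⟨hloc, heq, hout⟩
    refine ⟨fun x => h (j x).1, ⟨isIsometry_of_isLocalEmbedding hG hX hY hj hA hloc, ?_⟩, ?_⟩
    · exact funext fun x => (heq ⟨x, rfl⟩).trans (hgα x)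
    · funext a
      by_cases ha : a ∈ wallImage j
      · obtain ⟨x, rfl⟩ := ha
        exact hE _ x
      · rw [hout a ha, hE' _ a ha]

end Symmetry

end BuildingSymmetry

theorem mainTheorem4 {V : Type v} (X : AbstractSimplicialComplex V)
    (hX : BuildingSymmetry.IsA2TildeBuilding X) (q : ℕ)
    (hq : ∃ e ∈ X.faces, e.card = 2 ∧
      (BuildingSymmetry.trianglesOver X e).encard = ((q + 1 : ℕ) : ℕ∞))
    {W : Type w} (T : SimpleGraph W) (hT : T.IsTree)
    (hdeg : ∀ z, (T.neighborSet z).encard = ((q + 1 : ℕ) : ℕ∞)) (o : W) :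
    BuildingSymmetry.IsSymmetricFor.{u} X
      (fun {_} Y => BuildingSymmetry.IsConvexInWallTree T o Y) := by
  open BuildingSymmetry in
  intro Z' Z _ _ Y' Y hY' hY _ ⟨_, j, hj⟩ i hi
  obtain ⟨τ, hG⟩ := hX.exists_isRegularBuildingGraph hq
  obtain ⟨v₀⟩ := hX.nonempty
  have hji := hj.comp isFlag_modelWallTree hi
  have hA := isWallConvex_wallImage hT hY hj
  have hA' := isWallConvex_wallImage hT hY' hji
  have hsub : wallImage (j ∘ i) ⊆ wallImage j := Set.range_comp_subset_range i fun x => (j x).1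
  obtain ⟨N, hN, hcount⟩ := uniformExtension_of_isWallConvex (v₀ := v₀) hT hdeg hG hA' hA hsub
  refine ⟨N, hN, fun α hα => ?_⟩
  obtain ⟨g, hgα⟩ : ∃ g : W × ℤ → V, ∀ x, g (j (i x)).1 = α x :=
    ⟨Function.extend _ α fun _ => v₀, hji.val_injective.extend_apply α _⟩
  have hg := isLocalEmbedding_of_isIsometry hG.toIsBuildingGraph hji hA' (g := g)
    (by simpa only [Function.comp_apply, hgα] using hα)
  rw [encard_isometric_extensions_eq hG.toIsBuildingGraph hX.isFlag hY hj hA v₀ hgα, hcount g hg]
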